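/- Conventions. $\operatorname{sign}(a)=1$ for $a\ge 0$ and $-1$ for $a<0$. A halfspace over $\mathbb R^n$ is a function $h(x)=\operatorname{sign}(\langle w,x\rangle-t)$ with $w$ a unit vector and $t\in\mathbb R$. For a probability distribution $\mu$ on $\mathbb R^n$ and measurable $f,g:\mathbb R^n\to\{\pm1\}$, $\mathrm{dist}_\mu(f,g)=\Pr_{x\sim\mu}[f(x)\ne g(x)]$; $f$ is $\epsilon$-close to $g$ if $\mathrm{dist}_\mu(f,g)\le\epsilon$; the center of mass of $f$ is $\mathbb E_\mu[xf(x)]$; $f,g$ are aligned if $\mathbb E_\mu[xf(x)]=s\,\mathbb E_\mu[xg(x)]$ for some $s>0$. $\mu$ is rotation-invariant (RI) if it is the law of $au$ with $u$ uniform on the unit sphere and $a\ge0$ independent of $u$; it is a bounded RI distribution with radius $R>0$ and constant $C\in(0,1]$ if moreover $\Pr[CR\le\|x\|\le R]=1$. Algorithm. Simple-Tester has constants $L,K_1,K_3>0$; it knows $n,C,\epsilon,\delta$, and sees $\mu$ and $f$ only through independent labelled examples $(x,f(x))$, $x\sim\mu$. Sample sizes are rounded up to integers. Put $e=K_1C^2\epsilon^3$.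 (a) $\tilde v$ is the average of the labels of $\frac{2}{e^2}\ln\frac{6}{\delta}$ examples. (b) From two independent samples $x_1,\dots,x_m$ and $y_1,\dots,y_m$ with $m=L\frac{\sqrt n}{e^2}\ln\frac3\delta$, compute $\tilde c^{\,2}=m^{-2}\sum_{i,j}f(x_i)f(y_j)\langle x_i,y_j\rangle$. (c) From $k=\frac{1}{2(e/2)^2}\ln\frac{12}{\delta}$ fresh points $X$ let $\tilde t=\max\{t:\frac1k\#\{x\in X:x_1\ge t\}\ge\frac{1-\tilde v}2\}$ (if this set is unbounded, the value of $\tilde t$ is immaterial). From the first coordinates $z_1,\dots,z_q$ and $z_1',\dots,z_q'$ of two further samples with $q=L\frac{\sqrt n}{(e/2)^2}\ln\frac6\delta$, compute $\tilde p^{\,2}=q^{-2}\sum_{i,j}\operatorname{sign}(z_i-\tilde t)\operatorname{sign}(z'_j-\tilde t)\,z_iz_j'$. (d) Accept if $\tilde p^{\,2}-\tilde c^{\,2}<K_3C^2\epsilon^3$ or $|\tilde v|\ge1-\epsilon/2$; otherwise reject. Theorem. There are universal constants $L,K_1,K_3>0$ such that the following holds for every fixed $C\in(0,1]$. For all $n\ge3$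 and $\epsilon,\delta\in(0,1/2)$, Simple-Tester draws $O\!\left(\frac{\sqrt n}{\epsilon^6}\log\frac1\delta\right)$ examples in total, where the implied constant depends only on $C$. For every $\eta>0$ there is a constant $K_2(\eta)>0$, depending only on $\eta$ (and on the fixed $C$), such that for all $n\ge3$, every bounded RI distribution $\mu$ over $\mathbb R^n$ with $R=\sqrt n$ and constant $C$, every measurable $f:\mathbb R^n\to\{\pm1\}$ and all $\epsilon,\delta\in(0,1/2)$: 1. if $f$ is $K_2(\eta)\epsilon^{3+\eta}$-close to some halfspace, then Simple-Tester accepts with probability at least $1-\delta$; 2. with probability at least $1-\delta$, if Simple-Tester accepts then there is a halfspace $h$ with $\mathbb E_\mu[h]=\mathbb E_\mu[f]$ and $\mathrm{dist}_\mu(f,h)\le\epsilon$ that is aligned with $f$ (the alignment is required only if $\mathbb E_\mu[xf(x)]\ne0$). -/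

import Mathlib

open MeasureTheory

namespace HalfspaceTesting

noncomputable section

/-! ### Halfspaces and rotation-invariant distributions -/

/-- The `±1`-valued sign, with `sign 0 = 1`. -/
def sgn (a : ℝ) : ℝ := if 0 ≤ a then 1 else -1

/-- `f` takes its values in `{±1}`. -/
def IsSignValued {V : Type*} (f : V → ℝ) : Prop := ∀ x, f x = 1 ∨ f x = -1

/-- `h x = sign (⟨w, x⟩ - t)` for a unit vector `w` and a threshold `t`. -/
def IsHalfspace {n : ℕ} (h : EuclideanSpace ℝ (Fin n) → ℝ) : Prop :=
  ∃ (w : EuclideanSpace ℝ (Fin n)) (t : ℝ), ‖w‖ = 1 ∧ ∀ x, h x = sgn (inner ℝ w x - t)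

/-- The distance between two functions: the probability that they differ. -/
def fdist {n : ℕ} (μ : Measure (EuclideanSpace ℝ (Fin n)))
    (f g : EuclideanSpace ℝ (Fin n) → ℝ) : ℝ :=
  μ.real {x | f x ≠ g x}

/-- The center of mass `E[x f(x)]`. -/
def center {n : ℕ} (μ : Measure (EuclideanSpace ℝ (Fin n)))
    (f : EuclideanSpace ℝ (Fin n) → ℝ) : EuclideanSpace ℝ (Fin n) :=
  ∫ x, f x • x ∂μ

/-- `f` and `g` are aligned: `E[x f(x)] = s E[x g(x)]` for some `s > 0`. -/
def Aligned {n : ℕ} (μ : Measure (EuclideanSpace ℝ (Fin n)))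
    (f g : EuclideanSpace ℝ (Fin n) → ℝ) : Prop :=
  ∃ s : ℝ, 0 < s ∧ center μ f = s • center μ g

/-- The uniform probability distribution on the unit sphere (normalised surface measure). -/
def uniformSphere (n : ℕ) : Measure (Metric.sphere (0 : EuclideanSpace ℝ (Fin n)) 1) :=
  ((volume : Measure (EuclideanSpace ℝ (Fin n))).toSphere Set.univ)⁻¹ •
    (volume : Measure (EuclideanSpace ℝ (Fin n))).toSphere

/-- `μ` is the law of `a • u` with `u` uniform on the unit sphere and `a ≥ 0` independent of `u`,
distributed according to some radial distribution `ρ`. -/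
def IsRotationInvariant {n : ℕ} (μ : Measure (EuclideanSpace ℝ (Fin n))) : Prop :=
  ∃ ρ : Measure NNReal, IsProbabilityMeasure ρ ∧
    μ = (ρ.prod (uniformSphere n)).map
      (fun p => (p.1 : ℝ) • (p.2 : EuclideanSpace ℝ (Fin n)))

/-- A bounded RI distribution with radius `R` and constant `C`. -/
def IsBoundedRI {n : ℕ} (μ : Measure (EuclideanSpace ℝ (Fin n))) (R C : ℝ) : Prop :=
  IsRotationInvariant μ ∧ 0 < R ∧ 0 < C ∧ C ≤ 1 ∧ ∀ᵐ x ∂μ, C * R ≤ ‖x‖ ∧ ‖x‖ ≤ R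

/-! ### The estimators

They are functions of the random examples; an example is a pair (point, label). -/

/-- Estimate-Mean: the average label. -/
def estimateMean {V : Type*} {m : ℕ} (S : Fin m → V × ℝ) : ℝ :=
  (1 / (m : ℝ)) * ∑ i, (S i).2

/-- Estimate-IP: `m⁻² ∑ᵢⱼ f(xᵢ) g(yⱼ) ⟨xᵢ, yⱼ⟩`, from `m` examples `(xᵢ, f(xᵢ))` and
`m` examples `(yⱼ, g(yⱼ))`. -/
def estimateIP {V : Type*} [NormedAddCommGroup V] [InnerProductSpace ℝ V] {m : ℕ}
    (S T : Fin m → V × ℝ) : ℝ :=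
  (1 / (m : ℝ) ^ 2) * ∑ i, ∑ j, (S i).2 * (T j).2 * inner ℝ (S i).1 (T j).1

/-- The first coordinate `x₁ = ⟨x, e₁⟩` (and `0` in dimension `0`). -/
def firstCoord {n : ℕ} (x : EuclideanSpace ℝ (Fin n)) : ℝ :=
  if hn : 0 < n then x ⟨0, hn⟩ else 0

/-- The greatest `t` such that a fraction at least `(1 - v) / 2` of the points `X i` has first
coordinate at least `t`. For `m > 0` and `-1 ≤ v < 1` the supremum is a maximum. -/
def empiricalThreshold {n m : ℕ} (v : ℝ) (X : Fin m → EuclideanSpace ℝ (Fin n)) : ℝ :=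
  sSup {t : ℝ | (1 - v) / 2 ≤
    ((Finset.univ.filter fun i => t ≤ firstCoord (X i)).card : ℝ) / (m : ℝ)}

/-- A sample point projected to its first coordinate and labelled by `z ↦ sign (z - t)`. -/
def projectedExample {n : ℕ} (t : ℝ) (x : EuclideanSpace ℝ (Fin n)) : ℝ × ℝ :=
  (firstCoord x, sgn (firstCoord x - t))

/-- Estimate-Halfspace-Norm: estimate a threshold from the points `X`, then run Estimate-Norm for
the halfspace with that threshold over the one-dimensional projection, with the points `Y`, `Z`. -/
def estimateHalfspaceNorm {n m q : ℕ} (v : ℝ) (X : Fin m → EuclideanSpace ℝ (Fin n))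
    (Y Z : Fin q → EuclideanSpace ℝ (Fin n)) : ℝ :=
  estimateIP (fun i => projectedExample (empiricalThreshold v X) (Y i))
    (fun j => projectedExample (empiricalThreshold v X) (Z j))

/-! ### Sample sizes, rounded up to integers -/

/-- Sample size of Estimate-Mean with accuracy `ε` and confidence `δ`. -/
def meanSize (ε δ : ℝ) : ℕ := ⌈2 / ε ^ 2 * Real.log (2 / δ)⌉₊

/-- Size of each of the two samples of Estimate-IP for accuracy `ε` and confidence `δ`. -/
def ipSize (L : ℝ) (n : ℕ) (ε δ : ℝ) : ℕ := ⌈L * (Real.sqrt n / ε ^ 2) * Real.log (1 / δ)⌉₊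

/-- Size of the sample from which Estimate-Halfspace-Norm estimates the threshold. -/
def thresholdSize (ε δ : ℝ) : ℕ := ⌈1 / (2 * (ε / 2) ^ 2) * Real.log (4 / δ)⌉₊

/-! ### Simple-Tester -/

/-- The index set of all the examples that Simple-Tester draws, with `e = K₁ C² ε³`: one sample
for Estimate-Mean, two for Estimate-Norm, and three for Estimate-Halfspace-Norm (one for the
threshold and two for its call of Estimate-Norm, which has parameters `e / 2` and
`(δ / 3) / 2`). -/
abbrev ExampleIndex (L K₁ C : ℝ) (n : ℕ) (ε δ : ℝ) : Type :=
  Fin (meanSize (K₁ * C ^ 2 * ε ^ 3) (δ / 3)) ⊕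
    (Fin (ipSize L n (K₁ * C ^ 2 * ε ^ 3) (δ / 3)) ⊕
      Fin (ipSize L n (K₁ * C ^ 2 * ε ^ 3) (δ / 3))) ⊕
    Fin (thresholdSize (K₁ * C ^ 2 * ε ^ 3) (δ / 3)) ⊕
    (Fin (ipSize L n (K₁ * C ^ 2 * ε ^ 3 / 2) (δ / 3 / 2)) ⊕
      Fin (ipSize L n (K₁ * C ^ 2 * ε ^ 3 / 2) (δ / 3 / 2)))

/-- The number of examples that Simple-Tester draws. -/
def simpleTesterSamples (L K₁ C : ℝ) (n : ℕ) (ε δ : ℝ) : ℕ :=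
  Fintype.card (ExampleIndex L K₁ C n ε δ)

/-- Simple-Tester accepts on the labelled examples `S`. The decision depends on the distribution
and on the tested function only through these examples. -/
def SimpleTesterAccepts (L K₁ K₃ C : ℝ) {n : ℕ} (ε δ : ℝ)
    (S : ExampleIndex L K₁ C n ε δ → EuclideanSpace ℝ (Fin n) × ℝ) : Prop :=
  let v : ℝ := estimateMean fun i => S (.inl i)
  let c : ℝ := estimateIP (fun i => S (.inr (.inl (.inl i)))) (fun i => S (.inr (.inl (.inr i))))
  let p : ℝ := estimateHalfspaceNorm v (fun i => (S (.inr (.inr (.inl i)))).1)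
    (fun i => (S (.inr (.inr (.inr (.inl i))))).1) (fun i => (S (.inr (.inr (.inr (.inr i))))).1)
  p - c < K₃ * C ^ 2 * ε ^ 3 ∨ 1 - ε / 2 ≤ |v|

/-- The probability, over independent points drawn from `μ` and labelled by `f`, that the labelled
examples indexed by `ι` satisfy `A`. -/
def exampleProb {n : ℕ} (μ : Measure (EuclideanSpace ℝ (Fin n)))
    (f : EuclideanSpace ℝ (Fin n) → ℝ) {ι : Type} [Fintype ι]
    (A : (ι → EuclideanSpace ℝ (Fin n) × ℝ) → Prop) : ℝ :=
  (Measure.pi fun _ : ι => μ).real {x | A fun i => (x i, f (x i))}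

end

end HalfspaceTesting

open HalfspaceTesting

/-!
Write `z` for a one-dimensional marginal of `μ`; by rotation invariance all `⟨w, x⟩` with `‖w‖ = 1`
have the law of `z`. Let `T t = P(z ≥ t)` (`upperTail`) and `P t = E[z sign (z - t)]`
(`thresholdMoment`). A halfspace `h` with normal `w` and threshold `t` has mean `2 T t - 1` and
center of mass `P t • w`, and among the functions of its mean it maximizes the inner product of the
center of mass with `w`. So if `t` is chosen such that `2 T t - 1 = E[f]`, then
`P t ^ 2 - ‖E[x f(x)]‖ ^ 2 ≥ 0`, and the tester accepts when its estimate of this gap is small.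

*The gap controls the distance.* For the halfspace `h` of the same mean as `f` with normal parallel
to the center of mass of `f`, the difference `P t - ‖E[x f(x)]‖` is twice the integral of
`|⟨w, x⟩ - t|` over the points where `f` and `h` differ. As `z` has density at most `1 / (2 C)`,
this is at least `C ε ^ 2 / 2` if the distance is at least `ε`. Unless `f` is nearly constant, `P t`
is at least `C ε / 4`, and the gap is at least `C ^ 2 ε ^ 3 / 8` (`IsBoundedRI.exists_halfspace`).
Conversely, `f` being `τ`-close to a halfspace changes the gap by at most a multiple of
`τ log (1 / τ)`, as `z` is sub-Gaussian
(`IsBoundedRI.abs_thresholdMoment_sq_sub_norm_center_sq_le`); for `τ = κ ε ^ (3 + η)` this is of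
order `ε ^ 3`.

*The marginals.* The density bound and the sub-Gaussian bound for `z` come from the law of `cos θ`
with `θ` of density proportional to `sin ^ (n - 2)`, which is found by computing Lebesgue integrals
of functions of `⟨w, x⟩` and `‖x‖` in polar coordinates in two ways (`lintegral_uniformSphere`).

*The estimates.* The estimator of `‖E[x f(x)]‖ ^ 2` is `⟨α, β⟩` for two independent sample averages
`α`, `β`. Its deviation consists of two linear terms, which are sub-Gaussian, and of
`⟨α - c, β - c⟩`. Conditionally on `β` the latter is sub-Gaussian with variance proxy proportional
to `‖β - c‖ ^ 2 / m`, and `‖β - c‖ ^ 2` has exponential moments, which gives the sample size of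
order `√n / e ^ 2` (`measureReal_inner_average_le`). An error in the threshold matters only through
its tail, since `P ^ 2` is a Lipschitz function of `T` with a universal constant
(`IsTame.abs_thresholdMoment_sq_sub_le`). The tester's threshold has tail near `(1 - E[f]) / 2`,
hence approximates `-t` in place of `t`; this is harmless because `P` is even.
-/

namespace HalfspaceTesting

open ProbabilityTheory Set Real
open scoped ENNReal NNReal

/-! ### The one-dimensional marginals of the sphere -/

section Polar

variable {E : Type*} [NormedAddCommGroup E] [MeasurableSpace E] [BorelSpace E]

theorem lintegral_volumeIoiPow (m : ℕ) {g : ℝ → ℝ≥0∞} (hg : Measurable g) :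
    ∫⁻ r, g r.1 ∂(Measure.volumeIoiPow m) =
      ∫⁻ r in Ioi (0 : ℝ), ENNReal.ofReal (r ^ m) * g r := by
  rw [Measure.volumeIoiPow, lintegral_withDensity_eq_lintegral_mul _ (by fun_prop) (by fun_prop),
    ← lintegral_subtype_comap measurableSet_Ioi]
  rfl

/-- Polar coordinates for the Lebesgue integral of a nonnegative function. -/
theorem lintegral_eq_lintegral_sphere [NormedSpace ℝ E] [FiniteDimensional ℝ E] [Nontrivial E]
    (μ : Measure E) [μ.IsAddHaarMeasure] {H : E → ℝ≥0∞} (hH : Measurable H) :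
    ∫⁻ x, H x ∂μ = ∫⁻ u, (∫⁻ r in Ioi (0 : ℝ),
      ENNReal.ofReal (r ^ (Module.finrank ℝ E - 1)) * H (r • (u : E))) ∂μ.toSphere := by
  have h0 : ∫⁻ x, H x ∂μ = ∫⁻ x : ({(0 : E)}ᶜ : Set E), H x ∂(μ.comap (↑)) := by
    rw [lintegral_subtype_comap (measurableSet_singleton _).compl, restrict_compl_singleton]
  have h1 := μ.measurePreserving_homeomorphUnitSphereProd.lintegral_comp
    (f := fun p => H (p.2.1 • p.1.1)) (by fun_prop)
  rw [h0]
  calc _ = ∫⁻ x : ({(0 : E)}ᶜ : Set E), H ((homeomorphUnitSphereProd E x).2.1 •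
            (homeomorphUnitSphereProd E x).1.1) ∂(μ.comap (↑)) := by
        congr 1; ext x
        have : (homeomorphUnitSphereProd E x).2.1 • (homeomorphUnitSphereProd E x).1.1 = x.1 := by
          rw [← homeomorphUnitSphereProd_symm_apply_coe]; simp
        rw [this]
    _ = _ := by
        rw [h1, lintegral_prod _ (by fun_prop)]
        refine lintegral_congr fun u => ?_
        exact lintegral_volumeIoiPow _ (g := fun r => H (r • u.1)) (by fun_prop)

/-- The Lebesgue integral splits along the line through a unit vector and its orthogonal
complement. -/
theorem lintegral_eq_lintegral_line [InnerProductSpace ℝ E] [FiniteDimensional ℝ E]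
    {w : E} (hw : ‖w‖ = 1) {H : E → ℝ≥0∞} (hH : Measurable H) :
    ∫⁻ x, H x = ∫⁻ z : ℝ, ∫⁻ y : (ℝ ∙ w)ᗮ, H (z • w + y) := by
  have e1 : MeasurePreserving (LinearIsometryEquiv.toSpanUnitSingleton (𝕜 := ℝ) w hw) :=
    LinearIsometryEquiv.measurePreserving _
  have e2 : MeasurePreserving (ℝ ∙ w).orthogonalDecomposition.symm :=
    LinearIsometryEquiv.measurePreserving _
  have e3 := WithLp.volume_preserving_toLp (ℝ ∙ w) (ℝ ∙ w)ᗮ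
  have e4 := e1.prod (MeasurePreserving.id (volume : Measure (ℝ ∙ w)ᗮ))
  have e5 := (e2.comp e3).comp e4
  have e6 : ∀ p : ℝ × (ℝ ∙ w)ᗮ, ((⇑(ℝ ∙ w).orthogonalDecomposition.symm ∘ WithLp.toLp 2) ∘
      Prod.map (⇑(LinearIsometryEquiv.toSpanUnitSingleton w hw)) id) p = p.1 • w + p.2 := by
    intro p
    simp [Submodule.orthogonalDecomposition_symm_apply]
  rw [← e5.lintegral_comp hH]
  simp_rw [e6]
  exact lintegral_prod (fun p : ℝ × (ℝ ∙ w)ᗮ => H (p.1 • w + p.2)) (by fun_prop)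

/-- In coordinates adapted to a unit vector `w`, a function of `⟨w, x⟩` and `‖x‖` is integrated
over the half-plane of pairs `(⟨w, x⟩, dist (x, ℝ w))`, and then in polar coordinates there. -/
theorem lintegral_inner_norm [InnerProductSpace ℝ E] [FiniteDimensional ℝ E]
    (hE : 2 ≤ Module.finrank ℝ E) {w : E} (hw : ‖w‖ = 1) :
    ∃ κ : ℝ≥0∞, κ ≠ ∞ ∧ ∀ G : ℝ → ℝ → ℝ≥0∞, Measurable (Function.uncurry G) →
      ∫⁻ x : E, G (inner ℝ w x) ‖x‖ = κ * ∫⁻ θ in Ioo 0 π, ∫⁻ r in Ioi (0 : ℝ),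
        ENNReal.ofReal (sin θ ^ (Module.finrank ℝ E - 2)) *
          (ENNReal.ofReal (r ^ (Module.finrank ℝ E - 1)) * G (r * cos θ) r) := by
  obtain ⟨d, hd⟩ : ∃ d, Module.finrank ℝ E = d + 2 := ⟨_, (Nat.sub_add_cancel hE).symm⟩
  have hw0 : w ≠ 0 := by rintro rfl; simp at hw
  have hK : Module.finrank ℝ (ℝ ∙ w)ᗮ = d + 1 := by
    have h1 := Submodule.finrank_add_finrank_orthogonal (ℝ ∙ w)
    rw [finrank_span_singleton hw0] at h1
    omega
  have : Nontrivial (ℝ ∙ w)ᗮ := Module.nontrivial_of_finrank_pos (R := ℝ) (by omega)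
  refine ⟨(volume : Measure (ℝ ∙ w)ᗮ).toSphere univ, measure_ne_top _ _, fun G hG => ?_⟩
  have hG' : ∀ {α : Type _} [MeasurableSpace α] {a b : α → ℝ}, Measurable a → Measurable b →
      Measurable fun x => G (a x) (b x) := fun ha hb => hG.comp (ha.prodMk hb)
  -- the point `z w + y` with `y` orthogonal to `w`
  have e1 : ∀ (z : ℝ) (y : (ℝ ∙ w)ᗮ), inner ℝ w (z • w + (y : E)) = z := by
    intro z y
    have := Submodule.mem_orthogonal_singleton_iff_inner_right.1 y.2
    rw [inner_add_right, this, inner_smul_right, real_inner_self_eq_norm_sq, hw]; simp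
  have e2 : ∀ (z : ℝ) (y : (ℝ ∙ w)ᗮ), ‖z • w + (y : E)‖ = √(z ^ 2 + ‖y‖ ^ 2) := by
    intro z y
    have h0 := Submodule.mem_orthogonal_singleton_iff_inner_right.1 y.2
    have h1 : inner ℝ (z • w) (y : E) = 0 := by rw [inner_smul_left, h0]; simp
    have h2 := norm_add_sq_eq_norm_sq_add_norm_sq_of_inner_eq_zero _ _ h1
    rw [← sqrt_sq (norm_nonneg (z • w + (y : E))), sq, h2, norm_smul, hw]
    congr 1
    simp [sq]
  rw [lintegral_eq_lintegral_line hw (hG' (by fun_prop) (by fun_prop))]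
  simp_rw [e1, e2]
  have e3 : ∀ z : ℝ, ∫⁻ y : (ℝ ∙ w)ᗮ, G z √(z ^ 2 + ‖y‖ ^ 2) =
      (volume : Measure (ℝ ∙ w)ᗮ).toSphere univ *
        ∫⁻ s in Ioi (0 : ℝ), ENNReal.ofReal (s ^ d) * G z √(z ^ 2 + s ^ 2) := by
    intro z
    rw [lintegral_eq_lintegral_sphere _ (hG' (by fun_prop) (by fun_prop)), hK, mul_comm,
      ← lintegral_const]
    refine lintegral_congr fun u => setLIntegral_congr_fun measurableSet_Ioi fun s _ => ?_
    simp [norm_smul]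
  simp_rw [e3]
  have hm : Measurable fun p : ℝ × ℝ => ENNReal.ofReal (p.2 ^ d) * G p.1 √(p.1 ^ 2 + p.2 ^ 2) :=
    Measurable.mul (by fun_prop) (hG.comp (measurable_fst.prodMk
      (g := fun p : ℝ × ℝ => √(p.1 ^ 2 + p.2 ^ 2)) (by fun_prop)))
  rw [lintegral_const_mul' _ _ (measure_ne_top _ _)]
  congr 1
  have hm' : Measurable fun p : ℝ × ℝ => ENNReal.ofReal (sin p.2 ^ d) *
      (ENNReal.ofReal (p.1 ^ (d + 1)) * G (p.1 * cos p.2) p.1) :=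
    Measurable.mul (by fun_prop) (Measurable.mul (by fun_prop)
      (hG.comp (Measurable.prodMk (f := fun p : ℝ × ℝ => p.1 * cos p.2) (by fun_prop)
        measurable_fst)))
  calc _ = ∫⁻ z : ℝ, ∫⁻ s : ℝ, (univ ×ˢ Ioi (0 : ℝ)).indicator
            (fun p : ℝ × ℝ => ENNReal.ofReal (p.2 ^ d) * G p.1 √(p.1 ^ 2 + p.2 ^ 2)) (z, s) := by
        refine lintegral_congr fun z => ?_
        rw [← lintegral_indicator measurableSet_Ioi]
        refine lintegral_congr fun s => ?_
        simp [indicator]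
    _ = ∫⁻ p : ℝ × ℝ, (univ ×ˢ Ioi (0 : ℝ)).indicator
            (fun p : ℝ × ℝ => ENNReal.ofReal (p.2 ^ d) * G p.1 √(p.1 ^ 2 + p.2 ^ 2)) p := by
        rw [Measure.volume_eq_prod, lintegral_prod _
          (hm.indicator (MeasurableSet.univ.prod measurableSet_Ioi)).aemeasurable]
    _ = ∫⁻ p in polarCoord.target, (Ioi (0 : ℝ) ×ˢ Ioo 0 π).indicator (fun p : ℝ × ℝ =>
          ENNReal.ofReal (sin p.2 ^ d) *
            (ENNReal.ofReal (p.1 ^ (d + 1)) * G (p.1 * cos p.2) p.1)) p := by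
        rw [← lintegral_comp_polarCoord_symm]
        refine setLIntegral_congr_fun polarCoord.open_target.measurableSet ?_
        rintro ⟨r, θ⟩ ⟨hr, hθ⟩
        have hr : 0 < r := hr
        have hθ1 : -π < θ := hθ.1
        have hθ2 : θ < π := hθ.2
        by_cases h0 : 0 < θ
        · have hs : 0 < sin θ := sin_pos_of_pos_of_lt_pi h0 hθ2
          have h1 : (r * cos θ, r * sin θ) ∈ (univ : Set ℝ) ×ˢ Ioi (0 : ℝ) :=
            ⟨trivial, mul_pos hr hs⟩
          have h2 : (r, θ) ∈ Ioi (0 : ℝ) ×ˢ Ioo 0 π := ⟨hr, h0, hθ2⟩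
          have h3 : √((r * cos θ) ^ 2 + (r * sin θ) ^ 2) = r := by
            rw [show (r * cos θ) ^ 2 + (r * sin θ) ^ 2 = r ^ 2 * (sin θ ^ 2 + cos θ ^ 2) by ring,
              sin_sq_add_cos_sq, mul_one, sqrt_sq hr.le]
          simp only [polarCoord_symm_apply, indicator_of_mem h1, indicator_of_mem h2, smul_eq_mul,
            h3]
          rw [← mul_assoc, ← mul_assoc, ← ENNReal.ofReal_mul hr.le,
            ← ENNReal.ofReal_mul (by positivity)]
          congr 2
          ring
        · have hs : sin θ ≤ 0 := sin_nonpos_of_nonpos_of_neg_pi_le (not_lt.1 h0) hθ1.le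
          have h1 : (r * cos θ, r * sin θ) ∉ (univ : Set ℝ) ×ˢ Ioi (0 : ℝ) := fun h =>
            absurd h.2 (not_lt.2 (mul_nonpos_of_nonneg_of_nonpos hr.le hs))
          have h2 : (r, θ) ∉ Ioi (0 : ℝ) ×ˢ Ioo 0 π := fun h => h0 h.2.1
          simp only [polarCoord_symm_apply, indicator_of_notMem h1, indicator_of_notMem h2,
            smul_zero]
    _ = ∫⁻ p in Ioi (0 : ℝ) ×ˢ Ioo 0 π, ENNReal.ofReal (sin p.2 ^ d) *
            (ENNReal.ofReal (p.1 ^ (d + 1)) * G (p.1 * cos p.2) p.1) := by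
        rw [setLIntegral_indicator (measurableSet_Ioi.prod measurableSet_Ioo),
          inter_eq_self_of_subset_left]
        exact prod_mono le_rfl (Ioo_subset_Ioo_left (by linarith [pi_pos]))
    _ = _ := by
        rw [Measure.volume_eq_prod, setLIntegral_prod_symm _ hm'.aemeasurable, hd]
        rfl

end Polar

/-- The law of `⟨w, u⟩` for `u` uniform on the unit sphere is the law of `cos θ`, where `θ` has
density proportional to `sin ^ (n - 2)` on `(0, π)`. -/
theorem lintegral_uniformSphere {n : ℕ} (hn : 2 ≤ n) {w : EuclideanSpace ℝ (Fin n)} (hw : ‖w‖ = 1)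
    {F : ℝ → ℝ≥0∞} (hF : Measurable F) :
    ∫⁻ u, F (inner ℝ w (u : EuclideanSpace ℝ (Fin n))) ∂(uniformSphere n) =
      (∫⁻ θ in Ioo 0 π, ENNReal.ofReal (sin θ ^ (n - 2)))⁻¹ *
        ∫⁻ θ in Ioo 0 π, ENNReal.ofReal (sin θ ^ (n - 2)) * F (cos θ) := by
  have hd : Module.finrank ℝ (EuclideanSpace ℝ (Fin n)) = n := finrank_euclideanSpace_fin
  have : Nontrivial (EuclideanSpace ℝ (Fin n)) :=
    Module.nontrivial_of_finrank_pos (R := ℝ) (by omega)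
  obtain ⟨κ, hκ, H⟩ := lintegral_inner_norm (by omega) hw
  rw [hd] at H
  set σ := (volume : Measure (EuclideanSpace ℝ (Fin n))).toSphere with hσ
  set R : ℝ≥0∞ := ∫⁻ r in Ioi (0 : ℝ), ENNReal.ofReal (r ^ (n - 1)) * (Iio (1 : ℝ)).indicator 1 r
    with hR
  have hind : Measurable ((Iio (1 : ℝ)).indicator (1 : ℝ → ℝ≥0∞)) :=
    measurable_one.indicator measurableSet_Iio
  have hRm : Measurable fun r : ℝ => ENNReal.ofReal (r ^ (n - 1)) * (Iio (1 : ℝ)).indicator 1 r :=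
    Measurable.mul (by fun_prop) hind
  have hR0 : R ≠ 0 := by
    have h1 : ∫⁻ r in Ioo (1 / 2 : ℝ) 1, ENNReal.ofReal ((1 / 2) ^ (n - 1)) ≤ R := by
      rw [hR, ← lintegral_indicator measurableSet_Ioi, ← lintegral_indicator measurableSet_Ioo]
      refine lintegral_mono fun r => ?_
      by_cases hr : r ∈ Ioo (1 / 2 : ℝ) 1
      · have h0 : r ∈ Ioi (0 : ℝ) := lt_trans (by norm_num) hr.1
        have h1 : r ∈ Iio (1 : ℝ) := hr.2
        rw [indicator_of_mem hr, indicator_of_mem h0, indicator_of_mem h1, Pi.one_apply, mul_one]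
        exact ENNReal.ofReal_le_ofReal (pow_le_pow_left₀ (by norm_num) hr.1.le _)
      · rw [indicator_of_notMem hr]; exact zero_le
    refine (lt_of_lt_of_le ?_ h1).ne'
    rw [setLIntegral_const, Real.volume_Ioo]
    exact ENNReal.mul_pos (by simp) (by norm_num)
  have hRtop : R ≠ ∞ := by
    have h1 : R ≤ ∫⁻ r in Ioo (0 : ℝ) 1, 1 := by
      rw [hR, ← lintegral_indicator measurableSet_Ioi, ← lintegral_indicator measurableSet_Ioo]
      refine lintegral_mono fun r => ?_
      by_cases h0 : 0 < r <;> by_cases h1 : r < 1 <;> simp [indicator, h0, h1]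
      exact pow_le_one₀ h0.le h1.le
    refine ne_top_of_le_ne_top ?_ h1
    simp
  have key : ∀ F : ℝ → ℝ≥0∞, Measurable F → ∫⁻ u, F (inner ℝ w u.1) ∂σ =
      κ * ∫⁻ θ in Ioo 0 π, ENNReal.ofReal (sin θ ^ (n - 2)) * F (cos θ) := by
    intro F hF
    have h1 := H (fun z r => F (z / r) * (Iio (1 : ℝ)).indicator 1 r)
      (Measurable.mul (by fun_prop) (hind.comp measurable_snd))
    have hm : Measurable fun x : EuclideanSpace ℝ (Fin n) =>
        F (inner ℝ w x / ‖x‖) * (Iio (1 : ℝ)).indicator 1 ‖x‖ :=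
      Measurable.mul (by fun_prop) (hind.comp measurable_norm)
    rw [lintegral_eq_lintegral_sphere _ hm, hd] at h1
    have h2 : ∀ u : Metric.sphere (0 : EuclideanSpace ℝ (Fin n)) 1, ∫⁻ r in Ioi (0 : ℝ),
        ENNReal.ofReal (r ^ (n - 1)) * (F (inner ℝ w (r • u.1) / ‖r • u.1‖) *
          (Iio (1 : ℝ)).indicator 1 ‖r • u.1‖) = F (inner ℝ w u.1) * R := by
      intro u
      rw [hR, ← lintegral_const_mul _ hRm]
      refine setLIntegral_congr_fun measurableSet_Ioi fun r (hr : 0 < r) => ?_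
      have h3 : ‖r • u.1‖ = r := by simp [norm_smul, abs_of_pos hr]
      rw [h3, inner_smul_right, mul_div_cancel_left₀ _ hr.ne']
      ring
    have h4 : ∀ θ : ℝ, ∫⁻ r in Ioi (0 : ℝ), ENNReal.ofReal (sin θ ^ (n - 2)) *
        (ENNReal.ofReal (r ^ (n - 1)) * (F (r * cos θ / r) * (Iio (1 : ℝ)).indicator 1 r)) =
        ENNReal.ofReal (sin θ ^ (n - 2)) * F (cos θ) * R := by
      intro θ
      rw [hR, ← lintegral_const_mul _ hRm]
      refine setLIntegral_congr_fun measurableSet_Ioi fun r (hr : 0 < r) => ?_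
      rw [mul_div_cancel_left₀ _ hr.ne']
      ring
    simp_rw [h2, h4] at h1
    rw [lintegral_mul_const' _ _ hRtop, lintegral_mul_const' _ _ hRtop, ← mul_assoc] at h1
    exact (ENNReal.mul_left_inj hR0 hRtop).1 h1
  have h1 := key 1 measurable_one
  simp only [Pi.one_apply, lintegral_one, mul_one] at h1
  have hσ0 : σ univ ≠ 0 :=
    Measure.measure_univ_ne_zero.2 (Measure.toSphere_ne_zero _)
  rw [uniformSphere, lintegral_smul_measure, key F hF, ← hσ, h1, smul_eq_mul, ← mul_assoc]
  congr 1
  rw [h1] at hσ0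
  have hκ0 := left_ne_zero_of_mul hσ0
  rw [ENNReal.mul_inv (Or.inl hκ0) (Or.inl hκ), mul_right_comm, ENNReal.inv_mul_cancel hκ0 hκ,
    one_mul]

/-- Wallis: `W k * W (k + 1) = 2 π / (k + 1)` for `W k = ∫ sin ^ k` over `[0, π]`. -/
theorem integral_sin_pow_mul_succ (k : ℕ) :
    (∫ x in (0 : ℝ)..π, sin x ^ k) * (∫ x in (0 : ℝ)..π, sin x ^ (k + 1)) = 2 * π / (k + 1) := by
  induction k with
  | zero => simp; ring
  | succ k ih =>
    have h := integral_sin_pow (a := 0) (b := π) k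
    simp only [sin_zero, sin_pi, ne_eq, Nat.succ_ne_zero, not_false_eq_true, zero_pow, zero_mul,
      sub_self, zero_div, zero_add] at h
    rw [show k + 1 + 1 = k + 2 from rfl, h]
    rw [eq_div_iff (by positivity)] at ih
    push_cast
    field_simp
    linear_combination (k + 2) * ih

theorem two_div_sqrt_le_integral_sin_pow {n : ℕ} (hn : 2 ≤ n) :
    2 / √n ≤ ∫ x in (0 : ℝ)..π, sin x ^ (n - 2) := by
  obtain ⟨k, rfl⟩ : ∃ k, n = k + 2 := ⟨n - 2, by omega⟩
  simp only [Nat.add_sub_cancel]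
  have h1 := integral_sin_pow_mul_succ k
  have h2 : (∫ x in (0 : ℝ)..π, sin x ^ (k + 1)) ≤ ∫ x in (0 : ℝ)..π, sin x ^ k :=
    integral_sin_pow_succ_le k
  have h3 : 0 < ∫ x in (0 : ℝ)..π, sin x ^ k := integral_sin_pow_pos _
  have h4 : (2 / √(k + 2 : ℕ)) ^ 2 ≤ (∫ x in (0 : ℝ)..π, sin x ^ k) ^ 2 := by
    calc (2 / √(k + 2 : ℕ)) ^ 2 = 4 / (k + 2) := by
          rw [div_pow, sq_sqrt (by positivity)]; push_cast; norm_num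
      _ ≤ 2 * π / (k + 1) := by
          gcongr
          · linarith [pi_gt_three]
          · norm_num
      _ ≤ _ := by rw [← h1, sq]; gcongr
  exact le_of_sq_le_sq h4 h3.le

theorem lintegral_sin_pow (k : ℕ) :
    ∫⁻ θ in Ioo 0 π, ENNReal.ofReal (sin θ ^ k) =
      ENNReal.ofReal (∫ θ in (0 : ℝ)..π, sin θ ^ k) := by
  rw [intervalIntegral.integral_of_le pi_pos.le, Measure.restrict_congr_set Ioo_ae_eq_Ioc,
    ofReal_integral_eq_lintegral_ofReal]
  · exact ((continuous_sin.pow k).integrableOn_Icc).mono_set Ioc_subset_Icc_self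
  · filter_upwards [ae_restrict_mem measurableSet_Ioc] with θ hθ
    exact pow_nonneg (sin_nonneg_of_nonneg_of_le_pi hθ.1.le hθ.2) _

/-- The mass that a one-dimensional marginal of the sphere gives to an interval: in dimension at
least three, `sin ^ (n - 2) ≤ sin`, and `sin θ dθ` is mapped to Lebesgue measure by `cos`. -/
theorem uniformSphere_inner_mem_Icc_le {n : ℕ} (hn : 3 ≤ n) {w : EuclideanSpace ℝ (Fin n)}
    (hw : ‖w‖ = 1) {a b : ℝ} (hab : a ≤ b) :
    uniformSphere n {u | inner ℝ w (u : EuclideanSpace ℝ (Fin n)) ∈ Icc a b} ≤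
      ENNReal.ofReal (√n / 2 * (b - a)) := by
  have hm : MeasurableSet {u : Metric.sphere (0 : EuclideanSpace ℝ (Fin n)) 1 |
      inner ℝ w u.1 ∈ Icc a b} := by
    have : Measurable fun u : Metric.sphere (0 : EuclideanSpace ℝ (Fin n)) 1 => inner ℝ w u.1 := by
      fun_prop
    exact this measurableSet_Icc
  have h1 := lintegral_uniformSphere (by omega : 2 ≤ n) hw
    (F := (Icc a b).indicator 1) (measurable_one.indicator measurableSet_Icc)
  have h2 : (fun u : Metric.sphere (0 : EuclideanSpace ℝ (Fin n)) 1 =>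
      (Icc a b).indicator (1 : ℝ → ℝ≥0∞) (inner ℝ w u.1)) =
      {u : Metric.sphere (0 : EuclideanSpace ℝ (Fin n)) 1 |
        inner ℝ w u.1 ∈ Icc a b}.indicator 1 := by
    ext u; simp [indicator]
  rw [h2, lintegral_indicator_one hm, lintegral_sin_pow] at h1
  have h3 : ∫⁻ θ in Ioo 0 π, ENNReal.ofReal (sin θ ^ (n - 2)) * (Icc a b).indicator 1 (cos θ) ≤
      ENNReal.ofReal (b - a) := by
    have hle : arccos b ≤ arccos a := antitone_arccos hab
    calc _ ≤ ∫⁻ θ in Ioc (arccos b) (arccos a), ENNReal.ofReal (sin θ) := by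
          rw [Measure.restrict_congr_set Ioc_ae_eq_Icc, ← lintegral_indicator measurableSet_Ioo,
            ← lintegral_indicator measurableSet_Icc]
          refine lintegral_mono fun θ => ?_
          by_cases h : θ ∈ Ioo 0 π
          · rw [indicator_of_mem h]
            by_cases h' : cos θ ∈ Icc a b
            · rw [indicator_of_mem h', indicator_of_mem, Pi.one_apply, mul_one]
              · have hs := sin_nonneg_of_nonneg_of_le_pi h.1.le h.2.le
                exact ENNReal.ofReal_le_ofReal (pow_le_of_le_one hs (sin_le_one θ) (by omega))
              · rw [← arccos_cos h.1.le h.2.le]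
                exact ⟨antitone_arccos h'.2, antitone_arccos h'.1⟩
            · simp [indicator_of_notMem h']
          · rw [indicator_of_notMem h]; exact zero_le
      _ = ENNReal.ofReal (∫ θ in (arccos b)..(arccos a), sin θ) := by
          rw [intervalIntegral.integral_of_le hle, ofReal_integral_eq_lintegral_ofReal]
          · exact (continuous_sin.integrableOn_Icc).mono_set Ioc_subset_Icc_self
          · filter_upwards [ae_restrict_mem measurableSet_Ioc] with θ hθ
            exact sin_nonneg_of_nonneg_of_le_pi ((arccos_nonneg b).trans hθ.1.le)
              (hθ.2.trans (arccos_le_pi a))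
      _ ≤ _ := by
          rw [integral_sin]
          have clip : ∀ x : ℝ, cos (arccos x) = max (-1) (min x 1) := by
            intro x
            rcases le_total x (-1) with h | h
            · rw [arccos_of_le_neg_one h, cos_pi, max_eq_left ((min_le_left _ _).trans h)]
            · rcases le_total x 1 with h' | h'
              · rw [cos_arccos h h', min_eq_left h', max_eq_right h]
              · rw [arccos_of_one_le h', cos_zero, min_eq_right h', max_eq_right (by norm_num)]
          rw [clip, clip]
          apply ENNReal.ofReal_le_ofReal
          grind
  have hW := two_div_sqrt_le_integral_sin_pow (by omega : 2 ≤ n)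
  have hn0 : (0 : ℝ) < √n := sqrt_pos.2 (by exact_mod_cast (by omega : 0 < n))
  rw [h1, ENNReal.ofReal_mul (by positivity)]
  refine mul_le_mul' ?_ h3
  rw [← ENNReal.ofReal_inv_of_pos (integral_sin_pow_pos _)]
  apply ENNReal.ofReal_le_ofReal
  rw [show √n / 2 = (2 / √n)⁻¹ by rw [inv_div]]
  exact inv_anti₀ (by positivity) hW

/-- The moment generating function of `cos θ` with weight `sin ^ k θ` satisfies `M' ≤ t / (k + 1) M`
for `t ≥ 0` (integrate by parts), hence is at most that of a Gaussian of variance `1 / (k + 1)`. -/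
theorem integral_sin_pow_mul_exp_le (k : ℕ) (t : ℝ) :
    ∫ θ in (0 : ℝ)..π, sin θ ^ k * exp (t * cos θ) ≤
      (∫ θ in (0 : ℝ)..π, sin θ ^ k) * exp (t ^ 2 / (2 * (k + 1))) := by
  set M : ℝ → ℝ := fun t => ∫ θ in (0 : ℝ)..π, sin θ ^ k * exp (t * cos θ) with hM
  have hi : ∀ f : ℝ → ℝ, Continuous f → IntervalIntegrable f volume 0 π :=
    fun f hf => hf.intervalIntegrable _ _
  have hd : ∀ t, HasDerivAt M (∫ θ in (0 : ℝ)..π, sin θ ^ k * (exp (t * cos θ) * cos θ)) t := by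
    intro t
    refine (intervalIntegral.hasDerivAt_integral_of_dominated_loc_of_deriv_le
      (F := fun t θ => sin θ ^ k * exp (t * cos θ))
      (F' := fun t θ => sin θ ^ k * (exp (t * cos θ) * cos θ))
      (s := Metric.ball t 1) (bound := fun _ => exp (|t| + 1)) (Metric.ball_mem_nhds t one_pos)
      ?_ ?_ ?_ ?_ ?_ ?_).2
    · exact .of_forall fun x => (by fun_prop : Continuous _).aestronglyMeasurable
    · exact hi _ (by fun_prop)
    · exact (by fun_prop : Continuous _).aestronglyMeasurable
    · refine .of_forall fun θ _ x hx => ?_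
      rw [norm_mul, norm_mul, norm_pow, norm_of_nonneg (exp_pos _).le]
      have h1 : ‖sin θ‖ ^ k ≤ 1 := pow_le_one₀ (norm_nonneg _) (abs_sin_le_one θ)
      have h2 : ‖cos θ‖ ≤ 1 := abs_cos_le_one θ
      have h3 : |x| ≤ |t| + 1 := by
        have h4 : |x - t| < 1 := by simpa [Real.dist_eq] using hx
        have := abs_sub_abs_le_abs_sub x t
        linarith
      have h5 : x * cos θ ≤ |t| + 1 := by
        calc x * cos θ ≤ |x * cos θ| := le_abs_self _
          _ = |x| * |cos θ| := abs_mul _ _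
          _ ≤ |x| * 1 := by gcongr; exact abs_cos_le_one θ
          _ ≤ _ := by linarith
      calc ‖sin θ‖ ^ k * (exp (x * cos θ) * ‖cos θ‖) ≤ 1 * (exp (|t| + 1) * 1) := by
            gcongr
        _ = _ := by ring
    · exact hi _ continuous_const
    · refine .of_forall fun θ _ x _ => ?_
      have := ((hasDerivAt_id x).mul_const (cos θ)).exp.const_mul (sin θ ^ k)
      simpa using this
  have hparts : ∀ t, (k + 1) * ∫ θ in (0 : ℝ)..π, sin θ ^ k * (exp (t * cos θ) * cos θ) =
      t * ∫ θ in (0 : ℝ)..π, sin θ ^ (k + 2) * exp (t * cos θ) := by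
    intro t
    have h1 : ∫ θ in (0 : ℝ)..π, ((k + 1) * (sin θ ^ k * (exp (t * cos θ) * cos θ)) -
        t * (sin θ ^ (k + 2) * exp (t * cos θ))) = 0 := by
      rw [intervalIntegral.integral_eq_sub_of_hasDerivAt
        (f := fun θ => sin θ ^ (k + 1) * exp (t * cos θ))]
      · simp
      · intro θ _
        have h2 := ((hasDerivAt_sin θ).pow (k + 1)).mul ((hasDerivAt_cos θ).const_mul t).exp
        convert! h2 using 1
        simp
        ring
      · exact hi _ (by fun_prop)
    rw [intervalIntegral.integral_sub (hi _ (by fun_prop)) (hi _ (by fun_prop)),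
      intervalIntegral.integral_const_mul, intervalIntegral.integral_const_mul] at h1
    linarith
  have hcmp : ∀ t, ∫ θ in (0 : ℝ)..π, sin θ ^ (k + 2) * exp (t * cos θ) ≤ M t := by
    intro t
    refine intervalIntegral.integral_mono_on pi_pos.le (hi _ (by fun_prop)) (hi _ (by fun_prop))
      fun θ hθ => ?_
    have hs := sin_nonneg_of_nonneg_of_le_pi hθ.1 hθ.2
    exact mul_le_mul_of_nonneg_right (pow_le_pow_of_le_one hs (sin_le_one θ) (by omega))
      (exp_pos _).le
  set g : ℝ → ℝ := fun t => M t * exp (-(t ^ 2 / (2 * (k + 1)))) with hg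
  have hk : (0 : ℝ) < k + 1 := by positivity
  have hgd : ∀ t, HasDerivAt g (t / (k + 1) *
      ((∫ θ in (0 : ℝ)..π, sin θ ^ (k + 2) * exp (t * cos θ)) - M t) *
        exp (-(t ^ 2 / (2 * (k + 1))))) t := by
    intro t
    have h1 := (hd t).mul ((((hasDerivAt_id t).pow 2).div_const (2 * ((k : ℝ) + 1))).neg.exp)
    convert! h1 using 1
    have h2 : ∫ θ in (0 : ℝ)..π, sin θ ^ k * (exp (t * cos θ) * cos θ) =
        t / (k + 1) * ∫ θ in (0 : ℝ)..π, sin θ ^ (k + 2) * exp (t * cos θ) := by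
      rw [div_mul_eq_mul_div, eq_div_iff hk.ne', ← hparts, mul_comm]
    rw [h2]
    simp
    field_simp
    ring
  have hgc : Continuous g := continuous_iff_continuousAt.2 fun t => (hgd t).continuousAt
  have hgle : g t ≤ g 0 := by
    rcases le_total 0 t with ht | ht
    · refine (antitoneOn_of_deriv_nonpos (convex_Ici 0) hgc.continuousOn
        (fun x _ => (hgd x).differentiableAt.differentiableWithinAt) fun x hx => ?_)
        self_mem_Ici ht ht
      rw [interior_Ici] at hx
      rw [(hgd x).deriv]
      have hx0 : 0 ≤ x / (k + 1) := div_nonneg (le_of_lt hx) hk.le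
      exact mul_nonpos_of_nonpos_of_nonneg
        (mul_nonpos_of_nonneg_of_nonpos hx0 (sub_nonpos.2 (hcmp x))) (exp_pos _).le
    · refine (monotoneOn_of_deriv_nonneg (convex_Iic 0) hgc.continuousOn
        (fun x _ => (hgd x).differentiableAt.differentiableWithinAt) fun x hx => ?_)
        ht self_mem_Iic ht
      rw [interior_Iic] at hx
      rw [(hgd x).deriv]
      have hx0 : x / (k + 1) ≤ 0 := div_nonpos_of_nonpos_of_nonneg (le_of_lt hx) hk.le
      exact mul_nonneg
        (mul_nonneg_of_nonpos_of_nonpos hx0 (sub_nonpos.2 (hcmp x))) (exp_pos _).le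
  have hg0 : g 0 = ∫ θ in (0 : ℝ)..π, sin θ ^ k := by simp [hg, hM]
  rw [hg0, hg] at hgle
  simp only [exp_neg] at hgle
  rwa [← div_eq_mul_inv, div_le_iff₀ (exp_pos _)] at hgle

/-- One-dimensional marginals of the sphere are sub-Gaussian with variance proxy `1 / (n - 1)`. -/
theorem lintegral_exp_inner_uniformSphere_le {n : ℕ} (hn : 2 ≤ n)
    {w : EuclideanSpace ℝ (Fin n)} (hw : ‖w‖ = 1) (t : ℝ) :
    ∫⁻ u, ENNReal.ofReal (exp (t * inner ℝ w (u : EuclideanSpace ℝ (Fin n)))) ∂(uniformSphere n) ≤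
      ENNReal.ofReal (exp (t ^ 2 / (2 * (n - 1)))) := by
  rw [lintegral_uniformSphere hn hw (F := fun z => ENNReal.ofReal (exp (t * z))) (by fun_prop),
    lintegral_sin_pow]
  have h1 : ∫⁻ θ in Ioo 0 π, ENNReal.ofReal (sin θ ^ (n - 2)) * ENNReal.ofReal (exp (t * cos θ)) =
      ENNReal.ofReal (∫ θ in (0 : ℝ)..π, sin θ ^ (n - 2) * exp (t * cos θ)) := by
    have hnn : ∀ θ ∈ Ioc 0 π, 0 ≤ sin θ ^ (n - 2) := fun θ hθ =>
      pow_nonneg (sin_nonneg_of_nonneg_of_le_pi hθ.1.le hθ.2) _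
    rw [intervalIntegral.integral_of_le pi_pos.le, Measure.restrict_congr_set Ioo_ae_eq_Ioc,
      ofReal_integral_eq_lintegral_ofReal]
    · refine setLIntegral_congr_fun measurableSet_Ioc fun θ hθ => ?_
      rw [← ENNReal.ofReal_mul (hnn θ hθ)]
    · exact ((by fun_prop : Continuous fun θ => sin θ ^ (n - 2) * exp (t * cos θ)).integrableOn_Icc
        ).mono_set Ioc_subset_Icc_self
    · filter_upwards [ae_restrict_mem measurableSet_Ioc] with θ hθ
      exact mul_nonneg (hnn θ hθ) (exp_pos _).le
  have h2 := integral_sin_pow_mul_exp_le (n - 2) t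
  have h3 : (((n - 2 : ℕ) : ℝ) + 1) = n - 1 := by push_cast [Nat.cast_sub hn]; ring
  rw [h3] at h2
  have h4 : 0 < ∫ θ in (0 : ℝ)..π, sin θ ^ (n - 2) := integral_sin_pow_pos _
  rw [h1, ← ENNReal.ofReal_inv_of_pos h4, ← ENNReal.ofReal_mul (by positivity)]
  apply ENNReal.ofReal_le_ofReal
  rw [inv_mul_le_iff₀ h4]
  exact h2

/-! ### The one-dimensional marginals of a bounded rotation-invariant distribution -/

/-- The law of the first coordinate. For a rotation-invariant distribution this is the law of
`⟨w, x⟩` for every unit vector `w`, see `IsBoundedRI.map_inner`. -/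
noncomputable def marginal {n : ℕ} (μ : Measure (EuclideanSpace ℝ (Fin n))) : Measure ℝ :=
  μ.map firstCoord

/-- The properties of the one-dimensional marginals of a bounded rotation-invariant distribution
of radius `√n` and constant `C` from which everything else about them is derived. -/
structure IsTame (ν : Measure ℝ) (C : ℝ) : Prop where
  pos : 0 < C
  symm : ν.map Neg.neg = ν
  measure_Icc_le : ∀ a b, a ≤ b → ν (Icc a b) ≤ ENNReal.ofReal ((b - a) / (2 * C))
  subgaussian : HasSubgaussianMGF id (3 / 2) ν
  bounded : ∃ B, ∀ᵐ z ∂ν, |z| ≤ B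

theorem firstCoord_eq_inner {n : ℕ} (hn : 0 < n) (x : EuclideanSpace ℝ (Fin n)) :
    firstCoord x = inner ℝ (EuclideanSpace.single ⟨0, hn⟩ (1 : ℝ)) x := by
  simp [firstCoord, hn, EuclideanSpace.inner_single_left]

theorem measurable_firstCoord {n : ℕ} :
    Measurable (firstCoord : EuclideanSpace ℝ (Fin n) → ℝ) := by
  unfold firstCoord
  split_ifs
  · fun_prop
  · exact measurable_const

theorem isProbabilityMeasure_uniformSphere {n : ℕ} (hn : 0 < n) :
    IsProbabilityMeasure (uniformSphere n) := by
  have hd : Module.finrank ℝ (EuclideanSpace ℝ (Fin n)) = n := finrank_euclideanSpace_fin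
  have : Nontrivial (EuclideanSpace ℝ (Fin n)) :=
    Module.nontrivial_of_finrank_pos (R := ℝ) (by omega)
  refine ⟨?_⟩
  rw [uniformSphere, Measure.smul_apply, smul_eq_mul]
  exact ENNReal.inv_mul_cancel
    (Measure.measure_univ_ne_zero.2 (Measure.toSphere_ne_zero _)) (measure_ne_top _ _)

/-- Integration of a function of `⟨w, x⟩` against the law of `a • u`. -/
theorem lintegral_inner_map_smul {n : ℕ} (hn : 0 < n) (ρ : Measure ℝ≥0) [IsProbabilityMeasure ρ]
    (w : EuclideanSpace ℝ (Fin n)) {F : ℝ → ℝ≥0∞} (hF : Measurable F) :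
    ∫⁻ x, F (inner ℝ w x) ∂((ρ.prod (uniformSphere n)).map
        fun p => (p.1 : ℝ) • (p.2 : EuclideanSpace ℝ (Fin n))) =
      ∫⁻ a : ℝ≥0, ∫⁻ u, F (a * inner ℝ w (u : EuclideanSpace ℝ (Fin n))) ∂(uniformSphere n) ∂ρ := by
  have := isProbabilityMeasure_uniformSphere hn
  have hm : Measurable fun p : ℝ≥0 × Metric.sphere (0 : EuclideanSpace ℝ (Fin n)) 1 =>
      (p.1 : ℝ) • (p.2 : EuclideanSpace ℝ (Fin n)) := by fun_prop
  rw [lintegral_map (by fun_prop) hm, lintegral_prod _ (by fun_prop)]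
  simp_rw [inner_smul_right]

namespace IsBoundedRI

variable {n : ℕ} {μ : Measure (EuclideanSpace ℝ (Fin n))} {C : ℝ}

theorem map_inner_eq {R : ℝ} (hn : 2 ≤ n) (hμ : IsBoundedRI μ R C)
    {w w' : EuclideanSpace ℝ (Fin n)} (hw : ‖w‖ = 1) (hw' : ‖w'‖ = 1) :
    μ.map (fun x => inner ℝ w x) = μ.map fun x => inner ℝ w' x := by
  obtain ⟨⟨ρ, hρ, h⟩, -⟩ := hμ
  refine Measure.ext_of_lintegral _ fun F hF => ?_
  rw [lintegral_map hF (by fun_prop), lintegral_map hF (by fun_prop), h,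
    lintegral_inner_map_smul (by omega) _ _ hF, lintegral_inner_map_smul (by omega) _ _ hF]
  refine lintegral_congr fun a => ?_
  rw [lintegral_uniformSphere hn hw (F := fun z => F (a * z)) (by fun_prop),
    lintegral_uniformSphere hn hw' (F := fun z => F (a * z)) (by fun_prop)]

theorem map_inner {R : ℝ} (hn : 2 ≤ n) (hμ : IsBoundedRI μ R C)
    {w : EuclideanSpace ℝ (Fin n)} (hw : ‖w‖ = 1) :
    μ.map (fun x => inner ℝ w x) = marginal μ := by
  have : (firstCoord : EuclideanSpace ℝ (Fin n) → ℝ) =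
      fun x => inner ℝ (EuclideanSpace.single ⟨0, by omega⟩ (1 : ℝ)) x := by
    ext x; exact firstCoord_eq_inner (by omega) x
  rw [marginal, this]
  exact hμ.map_inner_eq hn hw (by simp)

theorem isTame_marginal [IsProbabilityMeasure μ] (hn : 3 ≤ n) (hμ : IsBoundedRI μ √n C) :
    IsTame (marginal μ) C := by
  have hn0 : 0 < n := by omega
  have hsn : (0 : ℝ) < √n := sqrt_pos.2 (by exact_mod_cast hn0)
  set w : EuclideanSpace ℝ (Fin n) := EuclideanSpace.single ⟨0, hn0⟩ (1 : ℝ) with hw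
  have hw1 : ‖w‖ = 1 := by simp [hw]
  have hmap := hμ.map_inner (by omega) hw1
  have hmap' := hμ.map_inner (w := -w) (by omega) (by simpa using hw1)
  have hC : 0 < C := hμ.2.2.1
  have hbd : ∀ᵐ x ∂μ, C * √n ≤ ‖x‖ ∧ ‖x‖ ≤ √n := hμ.2.2.2.2
  obtain ⟨ρ, hρ, h⟩ := hμ.1
  have := isProbabilityMeasure_uniformSphere hn0
  have hρ' : ∀ᵐ a : ℝ≥0 ∂ρ, C * √n ≤ a ∧ (a : ℝ) ≤ √n := by
    rw [h] at hbd
    have hbd' := ae_of_ae_map (by fun_prop) hbd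
    filter_upwards [Measure.ae_ae_of_ae_prod hbd'] with a ha
    obtain ⟨u, hu⟩ := ha.exists
    simpa [norm_smul] using hu
  have hform : ∀ {F : ℝ → ℝ≥0∞}, Measurable F → ∫⁻ z, F z ∂(marginal μ) =
      ∫⁻ a : ℝ≥0, ∫⁻ u, F (a * inner ℝ w (u : EuclideanSpace ℝ (Fin n))) ∂(uniformSphere n) ∂ρ := by
    intro F hF
    rw [← hmap, lintegral_map hF (by fun_prop), h, lintegral_inner_map_smul hn0 _ _ hF]
  have : IsProbabilityMeasure (marginal μ) :=
    Measure.isProbabilityMeasure_map measurable_firstCoord.aemeasurable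
  have hB : ∀ᵐ z ∂(marginal μ), |z| ≤ √n := by
    rw [← hmap, ae_map_iff (by fun_prop) (measurableSet_le (by fun_prop) (by fun_prop))]
    filter_upwards [hbd] with x hx
    calc |inner ℝ w x| ≤ ‖w‖ * ‖x‖ := abs_real_inner_le_norm _ _
      _ ≤ √n := by rw [hw1, one_mul]; exact hx.2
  refine ⟨hC, ?_, fun a b hab => ?_, ⟨fun t => ?_, fun t => ?_⟩, √n, hB⟩
  · conv_lhs => rw [← hmap]
    rw [Measure.map_map measurable_neg (by fun_prop), ← hmap']
    congr 1
    ext x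
    simp
  · rw [← lintegral_indicator_one measurableSet_Icc,
      hform (measurable_one.indicator measurableSet_Icc)]
    calc _ ≤ ∫⁻ _ : ℝ≥0, ENNReal.ofReal ((b - a) / (2 * C)) ∂ρ := by
          refine lintegral_mono_ae ?_
          filter_upwards [hρ'] with r hr
          have hr0 : (0 : ℝ) < r := lt_of_lt_of_le (by positivity) hr.1
          have h1 : ∀ u : Metric.sphere (0 : EuclideanSpace ℝ (Fin n)) 1,
              (Icc a b).indicator (1 : ℝ → ℝ≥0∞) (r * inner ℝ w u.1) =
              {u : Metric.sphere (0 : EuclideanSpace ℝ (Fin n)) 1 |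
                inner ℝ w u.1 ∈ Icc (a / r) (b / r)}.indicator 1 u := by
            intro u
            simp only [indicator, Pi.one_apply, mem_Icc, mem_ofPred_eq, div_le_iff₀' hr0,
              le_div_iff₀' hr0]
          simp_rw [h1]
          rw [lintegral_indicator_one]
          · refine (uniformSphere_inner_mem_Icc_le hn hw1 (by gcongr)).trans
              (ENNReal.ofReal_le_ofReal ?_)
            have h2 : 0 ≤ b - a := sub_nonneg.2 hab
            rw [← sub_div, div_mul_div_comm, div_le_div_iff₀ (by positivity) (by positivity)]
            calc √n * (b - a) * (2 * C) = (C * √n) * ((b - a) * 2) := by ring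
              _ ≤ r * ((b - a) * 2) := by gcongr; exact hr.1
              _ = _ := by ring
          · exact (by fun_prop : Measurable fun u : Metric.sphere
              (0 : EuclideanSpace ℝ (Fin n)) 1 => inner ℝ w u.1) measurableSet_Icc
      _ = _ := by simp
  · refine Integrable.of_bound (C := exp (|t| * √n)) (by fun_prop) ?_
    filter_upwards [hB] with z hz
    rw [norm_of_nonneg (exp_pos _).le, exp_le_exp]
    calc t * id z ≤ |t * z| := le_abs_self _
      _ = |t| * |z| := abs_mul _ _
      _ ≤ _ := by gcongr
  · rw [mgf, integral_eq_lintegral_of_nonneg_ae (.of_forall fun z => (exp_pos _).le)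
      (by fun_prop)]
    refine ENNReal.toReal_le_of_le_ofReal (exp_pos _).le ?_
    simp only [id]
    rw [hform (F := fun z => ENNReal.ofReal (exp (t * z))) (by fun_prop)]
    calc _ ≤ ∫⁻ _ : ℝ≥0, ENNReal.ofReal (exp (((3 / 2 : ℝ≥0) : ℝ) * t ^ 2 / 2)) ∂ρ := by
          refine lintegral_mono_ae ?_
          filter_upwards [hρ'] with r hr
          have h1 := lintegral_exp_inner_uniformSphere_le (by omega : 2 ≤ n) hw1 (t * r)
          simp_rw [mul_assoc] at h1
          refine h1.trans (ENNReal.ofReal_le_ofReal (exp_le_exp.2 ?_))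
          have hn3 : (3 : ℝ) ≤ n := by exact_mod_cast hn
          have hr2 : (r : ℝ) ^ 2 ≤ n := by
            rw [← sq_sqrt (by positivity : (0 : ℝ) ≤ n)]
            gcongr
            exact hr.2
          rw [div_le_div_iff₀ (by linarith) (by norm_num)]
          push_cast
          have ht : 0 ≤ t ^ 2 := sq_nonneg t
          nlinarith [mul_le_mul_of_nonneg_left hr2 ht, mul_nonneg ht (sub_nonneg.2 hn3)]
      _ = _ := by simp

end IsBoundedRI

/-! ### Thresholds on the line -/

theorem measurable_sgn : Measurable sgn :=
  Measurable.ite measurableSet_Ici measurable_const measurable_const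

theorem sgn_eq_or (a : ℝ) : sgn a = 1 ∨ sgn a = -1 := by
  unfold sgn; split_ifs <;> simp

theorem abs_sgn (a : ℝ) : |sgn a| = 1 := by
  rcases sgn_eq_or a with h | h <;> simp [h]

theorem sgn_mul_self (a : ℝ) : sgn a * a = |a| := by
  unfold sgn
  split_ifs with h
  · rw [one_mul, abs_of_nonneg h]
  · rw [abs_of_neg (not_le.1 h)]; ring

theorem exp_three_quarters_le : exp (3 / 4) ≤ 5 / 2 := by
  have h1 : exp (3 / 4) ^ 4 ≤ (5 / 2) ^ 4 := by
    have h2 : exp 1 ^ 3 ≤ 2.7182818286 ^ 3 :=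
      pow_le_pow_left₀ (exp_pos _).le exp_one_lt_d9.le 3
    rw [← exp_nat_mul] at h2 ⊢
    norm_num at h2 ⊢
    linarith
  exact le_of_pow_le_pow_left₀ (by norm_num) (by norm_num) h1

/-- The mass of `[t, ∞)`. -/
noncomputable def upperTail (ν : Measure ℝ) (t : ℝ) : ℝ := ν.real (Ici t)

/-- The first moment `E[z sign (z - t)]` of a threshold function. For a halfspace `h` with
threshold `t` it is the norm of the center of mass `E[x h(x)]`. -/
noncomputable def thresholdMoment (ν : Measure ℝ) (t : ℝ) : ℝ := ∫ z, sgn (z - t) * z ∂ν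

namespace IsTame

variable {ν : Measure ℝ} {C : ℝ}

theorem measureReal_Icc_le (h : IsTame ν C) {a b : ℝ} (hab : a ≤ b) :
    ν.real (Icc a b) ≤ (b - a) / (2 * C) :=
  ENNReal.toReal_le_of_le_ofReal
    (div_nonneg (sub_nonneg.2 hab) (by linarith [h.pos])) (h.measure_Icc_le a b hab)

theorem measure_singleton (h : IsTame ν C) (t : ℝ) : ν {t} = 0 := by
  have := h.measure_Icc_le t t le_rfl
  simpa using this

theorem integral_comp_neg (h : IsTame ν C) (F : ℝ → ℝ) : ∫ z, F (-z) ∂ν = ∫ z, F z ∂ν := by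
  conv_rhs => rw [← h.symm]
  exact (integral_map_equiv (MeasurableEquiv.neg ℝ) F).symm

theorem integral_id_eq_zero (h : IsTame ν C) : ∫ z, z ∂ν = 0 := by
  have := h.integral_comp_neg fun z => z
  rw [integral_neg] at this
  linarith

theorem ae_ne (h : IsTame ν C) (t : ℝ) : ∀ᵐ z ∂ν, z ≠ t :=
  measure_eq_zero_iff_ae_notMem.1 (h.measure_singleton t)

theorem measureReal_abs_sub_le (h : IsTame ν C) (t : ℝ) {s : ℝ} (hs : 0 ≤ s) :
    ν.real {z | |z - t| ≤ s} ≤ s / C := by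
  have h1 : {z | |z - t| ≤ s} = Icc (t - s) (t + s) := by
    ext z; simp only [mem_ofPred_eq, mem_Icc, abs_le]
    constructor <;> rintro ⟨h1, h2⟩ <;> constructor <;> linarith
  rw [h1]
  refine (h.measureReal_Icc_le (by linarith)).trans_eq ?_
  have := h.pos
  field_simp
  ring

theorem thresholdMoment_neg (h : IsTame ν C) (t : ℝ) :
    thresholdMoment ν (-t) = thresholdMoment ν t := by
  rw [thresholdMoment, ← h.integral_comp_neg, thresholdMoment]
  refine integral_congr_ae ?_
  filter_upwards [h.ae_ne t] with z hz
  have : sgn (-z - -t) = -sgn (z - t) := by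
    unfold sgn
    rcases lt_or_gt_of_ne hz with hz | hz
    · rw [if_pos (by linarith), if_neg (by linarith)]; ring
    · rw [if_neg (by linarith), if_pos (by linarith)]
  rw [this]; ring

variable [IsProbabilityMeasure ν]

theorem integrable_id (h : IsTame ν C) : Integrable (fun z => z) ν := by
  obtain ⟨B, hB⟩ := h.bounded
  exact Integrable.of_bound (by fun_prop) B hB

theorem integrable_sq (h : IsTame ν C) : Integrable (fun z => z ^ 2) ν := by
  obtain ⟨B, hB⟩ := h.bounded
  refine Integrable.of_bound (by fun_prop) (B ^ 2) ?_
  filter_upwards [hB] with z hz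
  rw [norm_pow]
  exact pow_le_pow_left₀ (norm_nonneg _) hz 2

theorem integral_sq_le (h : IsTame ν C) : ∫ z, z ^ 2 ∂ν ≤ 3 := by
  have h1 := h.subgaussian.mgf_le 1
  have h2 := h.subgaussian.mgf_le (-1)
  have i1 := h.subgaussian.integrable_exp_mul 1
  have i2 := h.subgaussian.integrable_exp_mul (-1)
  simp only [mgf, id] at h1 h2 i1 i2
  have i3 : Integrable (fun z => exp (1 * z) + exp (-1 * z)) ν := i1.add i2
  -- `z ^ 2 ≤ 2 (cosh z - 1) = 4 sinh (z / 2) ^ 2`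
  have h3 : ∫ z, z ^ 2 ∂ν ≤ ∫ z, (exp (1 * z) + exp (-1 * z) - 2) ∂ν := by
    refine integral_mono h.integrable_sq (i3.sub (integrable_const 2)) fun z => ?_
    have h4 : |z / 2| ≤ |sinh (z / 2)| := by
      rw [abs_sinh]; exact self_le_sinh_iff.2 (abs_nonneg _)
    have h5 := sq_le_sq.2 h4
    have h6 := cosh_two_mul (z / 2)
    rw [cosh_sq, mul_div_cancel₀ z two_ne_zero, cosh_eq] at h6
    simp only [one_mul, neg_one_mul]
    linarith
  rw [integral_sub i3 (integrable_const 2), integral_add i1 i2] at h3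
  have h4 : exp (((3 / 2 : ℝ≥0) : ℝ) * 1 ^ 2 / 2) ≤ 5 / 2 := by
    have := exp_three_quarters_le
    push_cast
    norm_num
    exact this
  have h7 : (-1 : ℝ) ^ 2 = 1 ^ 2 := by norm_num
  rw [h7] at h2
  simp at h3
  simp only [one_mul, neg_mul] at h1 h2
  linarith

theorem setIntegral_sq_le (h : IsTame ν C) (s : Set ℝ) : ∫ z in s, z ^ 2 ∂ν ≤ 3 :=
  (setIntegral_le_integral h.integrable_sq (.of_forall fun z => sq_nonneg z)).trans
    h.integral_sq_le

theorem thresholdMoment_eq (h : IsTame ν C) (t : ℝ) :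
    thresholdMoment ν t = 2 * ∫ z in Ici t, z ∂ν := by
  have h1 : ∀ z, sgn (z - t) * z = 2 * (Ici t).indicator (fun z => z) z - z := by
    intro z
    by_cases hz : t ≤ z
    · rw [indicator_of_mem (show z ∈ Ici t from hz), sgn, if_pos (by linarith)]; ring
    · rw [indicator_of_notMem (show z ∉ Ici t from hz), sgn, if_neg (by linarith)]; ring
  rw [thresholdMoment]
  simp_rw [h1]
  rw [integral_sub ((h.integrable_id.indicator measurableSet_Ici).const_mul 2) h.integrable_id,
    h.integral_id_eq_zero, sub_zero, integral_const_mul, integral_indicator measurableSet_Ici]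

theorem upperTail_neg (h : IsTame ν C) (t : ℝ) : upperTail ν (-t) = 1 - upperTail ν t := by
  have h1 : ν.real (Ici (-t)) = ν.real (Iic t) := by
    have : ν.real (Ici (-t)) = (ν.map Neg.neg).real (Ici (-t)) := by rw [h.symm]
    rw [this, map_measureReal_apply measurable_neg measurableSet_Ici]
    congr 1; ext z; simp
  have h2 : ν.real (Iic t) = ν.real (Iio t) := by
    refine measureReal_congr ?_
    filter_upwards [h.ae_ne t] with z hz
    exact propext ⟨fun (h : z ≤ t) => lt_of_le_of_ne h hz, fun (h : z < t) => h.le⟩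
  rw [upperTail, h1, h2, upperTail, ← probReal_compl_eq_one_sub measurableSet_Ici, compl_Ici]

theorem upperTail_sub (ν : Measure ℝ) [IsFiniteMeasure ν] {s t : ℝ} (hst : s ≤ t) :
    upperTail ν s - upperTail ν t = ν.real (Ico s t) := by
  have h1 : Ici s = Ico s t ∪ Ici t := (Ico_union_Ici_eq_Ici hst).symm
  rw [upperTail, h1, measureReal_union _ measurableSet_Ici, upperTail]
  · ring
  · rw [disjoint_left]
    exact fun z hz hz' => absurd hz.2 (not_lt.2 hz')

theorem upperTail_antitone (ν : Measure ℝ) [IsFiniteMeasure ν] : Antitone (upperTail ν) := by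
  intro s t hst
  have := upperTail_sub ν hst
  linarith [measureReal_nonneg (μ := ν) (s := Ico s t)]

theorem upperTail_sub_le (h : IsTame ν C) {s t : ℝ} (hst : s ≤ t) :
    upperTail ν s - upperTail ν t ≤ (t - s) / (2 * C) := by
  rw [upperTail_sub ν hst]
  exact (measureReal_mono Ico_subset_Icc_self).trans (h.measureReal_Icc_le hst)

theorem continuous_upperTail (h : IsTame ν C) : Continuous (upperTail ν) := by
  have hC := h.pos
  refine LipschitzWith.continuous (K := (1 / (2 * C)).toNNReal) ?_
  refine LipschitzWith.of_dist_le_mul fun s t => ?_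
  rw [Real.coe_toNNReal _ (by positivity), Real.dist_eq, Real.dist_eq]
  rcases le_total s t with hst | hst
  · rw [abs_of_nonneg (sub_nonneg.2 (upperTail_antitone ν hst)), abs_sub_comm s t,
      abs_of_nonneg (sub_nonneg.2 hst), one_div_mul_eq_div]
    exact h.upperTail_sub_le hst
  · rw [abs_sub_comm, abs_of_nonneg (sub_nonneg.2 (upperTail_antitone ν hst)),
      abs_of_nonneg (sub_nonneg.2 hst), one_div_mul_eq_div]
    exact h.upperTail_sub_le hst

theorem exists_upperTail_eq (h : IsTame ν C) {p : ℝ} (hp : p ∈ Icc (0 : ℝ) 1) :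
    ∃ t, upperTail ν t = p := by
  obtain ⟨B, hB⟩ := h.bounded
  have h0 : upperTail ν (|B| + 1) = 0 := by
    have : ν (Ici (|B| + 1)) = 0 := by
      refine measure_eq_zero_iff_ae_notMem.2 ?_
      filter_upwards [hB] with z hz hz'
      have := le_abs_self z
      have := le_abs_self B
      have : |B| + 1 ≤ z := hz'
      linarith
    rw [upperTail, measureReal_def, this]; rfl
  have h1 : upperTail ν (-(|B| + 1)) = 1 := by rw [h.upperTail_neg, h0, sub_zero]
  have := intermediate_value_Icc' (by linarith [abs_nonneg B] : -(|B| + 1) ≤ |B| + 1)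
    h.continuous_upperTail.continuousOn
  rw [h0, h1] at this
  obtain ⟨t, -, ht⟩ := this hp
  exact ⟨t, ht⟩

theorem integral_sgn (ν : Measure ℝ) [IsProbabilityMeasure ν] (t : ℝ) :
    ∫ z, sgn (z - t) ∂ν = 2 * upperTail ν t - 1 := by
  have h1 : ∀ z, sgn (z - t) = 2 * (Ici t).indicator 1 z - 1 := by
    intro z
    by_cases hz : t ≤ z
    · rw [indicator_of_mem (show z ∈ Ici t from hz), sgn, if_pos (by linarith)]; norm_num
    · rw [indicator_of_notMem (show z ∉ Ici t from hz), sgn, if_neg (by linarith)]; norm_num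
  simp_rw [h1]
  rw [integral_sub _ (integrable_const _), integral_const_mul, integral_indicator_one
    measurableSet_Ici]
  · simp [upperTail]
  · exact ((integrable_indicator_iff measurableSet_Ici).2
      (integrable_const (1 : ℝ)).integrableOn).const_mul 2

/-- The square of the threshold moment is Lipschitz in the mass of the tail, uniformly in the
distribution: heuristically `d(P²) = 4 t P dT`, and `t P(t) ≤ 2 E[z²]`. -/
theorem abs_thresholdMoment_sq_sub_le_of_nonneg (h : IsTame ν C) {s t : ℝ} (hs : 0 ≤ s)
    (hst : s ≤ t) :
    |thresholdMoment ν s ^ 2 - thresholdMoment ν t ^ 2| ≤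
      36 * (upperTail ν s - upperTail ν t) := by
  set d := ∫ z in Ico s t, z ∂ν with hd
  set m := ν.real (Ico s t) with hm
  have hm0 : 0 ≤ m := measureReal_nonneg
  have hdiff : thresholdMoment ν s = thresholdMoment ν t + 2 * d := by
    rw [h.thresholdMoment_eq, h.thresholdMoment_eq, ← Ico_union_Ici_eq_Ici hst,
      setIntegral_union _ measurableSet_Ici h.integrable_id.integrableOn
        h.integrable_id.integrableOn]
    · ring
    · rw [disjoint_left]
      exact fun z hz hz' => absurd hz.2 (not_lt.2 hz')
  have hd0 : 0 ≤ d := setIntegral_nonneg measurableSet_Ico fun z hz => hs.trans hz.1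
  have hdt : d ≤ t * m := by
    calc d ≤ ∫ _ in Ico s t, t ∂ν :=
          setIntegral_mono_on h.integrable_id.integrableOn (integrable_const t).integrableOn
            measurableSet_Ico fun z hz => hz.2.le
      _ = t * m := by rw [setIntegral_const, smul_eq_mul, mul_comm]
  have hP0 : 0 ≤ thresholdMoment ν t := by
    rw [h.thresholdMoment_eq]
    exact mul_nonneg zero_le_two
      (setIntegral_nonneg measurableSet_Ici fun z hz => (hs.trans hst).trans hz)
  have hPt : thresholdMoment ν t * t ≤ 6 := by
    rw [h.thresholdMoment_eq]
    have h1 : (∫ z in Ici t, z ∂ν) * t ≤ ∫ z in Ici t, z ^ 2 ∂ν := by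
      rw [← integral_mul_const]
      refine setIntegral_mono_on (h.integrable_id.mul_const t).integrableOn
        h.integrable_sq.integrableOn measurableSet_Ici fun z (hz : t ≤ z) => ?_
      nlinarith
    linarith [h.setIntegral_sq_le (Ici t)]
  -- Cauchy-Schwarz
  have hdm : d ^ 2 ≤ 3 * m := by
    rcases hm0.eq_or_lt with h0 | h0
    · have : d = 0 := le_antisymm (by simpa [← h0] using hdt) hd0
      simp [this, ← h0]
    · have h1 : 0 ≤ ∫ z in Ico s t, (z - d / m) ^ 2 ∂ν := integral_nonneg fun z => sq_nonneg _
      have h2 : ∀ z : ℝ, (z - d / m) ^ 2 = z ^ 2 - (2 * (d / m)) * z + (d / m) ^ 2 := by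
        intro z; ring
      simp_rw [h2] at h1
      have i1 : IntegrableOn (fun z => z ^ 2 - 2 * (d / m) * z) (Ico s t) ν :=
        h.integrable_sq.integrableOn.sub (h.integrable_id.integrableOn.const_mul _)
      rw [integral_add i1 (integrable_const _).integrableOn,
        integral_sub h.integrable_sq.integrableOn (h.integrable_id.integrableOn.const_mul _),
        integral_const_mul, setIntegral_const, smul_eq_mul, ← hd, ← hm] at h1
      have h3 := h.setIntegral_sq_le (Ico s t)
      have h4 : 2 * (d / m) * d = 2 * (d ^ 2 / m) := by ring
      have h5 : m * (d / m) ^ 2 = d ^ 2 / m := by field_simp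
      rw [h4, h5] at h1
      rw [← div_le_iff₀ h0]
      linarith
  rw [upperTail_sub ν hst, ← hm, hdiff,
    show (thresholdMoment ν t + 2 * d) ^ 2 - thresholdMoment ν t ^ 2 =
      4 * (thresholdMoment ν t * d) + 4 * d ^ 2 by ring, abs_of_nonneg (by positivity)]
  have h6 : thresholdMoment ν t * d ≤ 6 * m := by
    calc thresholdMoment ν t * d ≤ thresholdMoment ν t * (t * m) := by gcongr
      _ = thresholdMoment ν t * t * m := by ring
      _ ≤ 6 * m := by gcongr
  linarith

theorem abs_thresholdMoment_sq_sub_le (h : IsTame ν C) (s t : ℝ) :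
    |thresholdMoment ν s ^ 2 - thresholdMoment ν t ^ 2| ≤
      36 * |upperTail ν s - upperTail ν t| := by
  wlog hst : s ≤ t generalizing s t
  · rw [abs_sub_comm, abs_sub_comm (upperTail ν s)]
    exact this t s (le_of_not_ge hst)
  rw [abs_of_nonneg (sub_nonneg.2 (upperTail_antitone ν hst))]
  have hneg : ∀ s t : ℝ, t ≤ 0 → s ≤ t →
      |thresholdMoment ν s ^ 2 - thresholdMoment ν t ^ 2| ≤
        36 * (upperTail ν s - upperTail ν t) := by
    intro s t ht hst
    have := h.abs_thresholdMoment_sq_sub_le_of_nonneg (neg_nonneg.2 ht) (neg_le_neg hst)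
    rw [h.thresholdMoment_neg, h.thresholdMoment_neg, h.upperTail_neg, h.upperTail_neg,
      abs_sub_comm] at this
    linarith
  rcases le_total 0 s with hs | hs
  · exact h.abs_thresholdMoment_sq_sub_le_of_nonneg hs hst
  · rcases le_total t 0 with ht | ht
    · exact hneg s t ht hst
    · have h1 := hneg s 0 le_rfl hs
      have h2 := h.abs_thresholdMoment_sq_sub_le_of_nonneg le_rfl ht
      have h3 := abs_sub_le (thresholdMoment ν s ^ 2) (thresholdMoment ν 0 ^ 2)
        (thresholdMoment ν t ^ 2)
      linarith

theorem thresholdMoment_nonneg (h : IsTame ν C) (t : ℝ) : 0 ≤ thresholdMoment ν t := by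
  wlog ht : 0 ≤ t generalizing t
  · rw [← h.thresholdMoment_neg]
    exact this (-t) (by linarith)
  rw [h.thresholdMoment_eq]
  exact mul_nonneg zero_le_two (setIntegral_nonneg measurableSet_Ici fun z hz => ht.trans hz)

/-- A threshold function that is not too biased has a large first moment. -/
theorem le_thresholdMoment (h : IsTame ν C) {ε t : ℝ} (hε : ε ≤ 1 / 2)
    (h1 : ε / 2 ≤ upperTail ν t) (h2 : upperTail ν t ≤ 1 - ε / 2) :
    C * ε / 4 ≤ thresholdMoment ν t := by
  wlog ht : 0 ≤ t generalizing t
  · rw [← h.thresholdMoment_neg]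
    exact this (by rw [h.upperTail_neg]; linarith) (by rw [h.upperTail_neg]; linarith)
      (by linarith)
  have hC := h.pos
  have key : ∀ s, 0 ≤ s → t ≤ s → 2 * (s * upperTail ν s) ≤ thresholdMoment ν t := by
    intro s hs hts
    rw [h.thresholdMoment_eq]
    have h3 : s * upperTail ν s ≤ ∫ z in Ici s, z ∂ν := by
      calc s * upperTail ν s = ∫ _ in Ici s, s ∂ν := by
            rw [setIntegral_const, smul_eq_mul, mul_comm]; rfl
        _ ≤ _ := setIntegral_mono_on (integrable_const s).integrableOn h.integrable_id.integrableOn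
            measurableSet_Ici fun z hz => hz
    have h4 : ∫ z in Ici s, z ∂ν ≤ ∫ z in Ici t, z ∂ν := by
      refine setIntegral_mono_set h.integrable_id.integrableOn ?_
        (Ici_subset_Ici.2 hts).eventuallyLE
      filter_upwards [ae_restrict_mem measurableSet_Ici] with z hz
      exact ht.trans hz
    linarith
  rcases le_total (C / 4) t with h3 | h3
  · have h4 := key t ht le_rfl
    have h5 : C / 4 * (ε / 2) ≤ t * upperTail ν t := by
      rcases le_total 0 ε with h0 | h0
      · gcongr
      · exact (mul_nonpos_of_nonneg_of_nonpos (by linarith) (by linarith)).trans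
          (mul_nonneg ht measureReal_nonneg)
    linarith
  · have h4 := key (C / 4) (by linarith) h3
    have h5 : upperTail ν (C / 4) ≥ 3 / 8 := by
      have h6 := h.upperTail_sub_le (by linarith : (0 : ℝ) ≤ C / 4)
      have h7 := h.upperTail_neg 0
      rw [neg_zero] at h7
      have h8 : (C / 4 - 0) / (2 * C) = 1 / 8 := by
        rw [div_eq_div_iff (by positivity) (by norm_num)]; ring
      linarith
    have h9 : C / 4 * (3 / 8) ≤ C / 4 * upperTail ν (C / 4) := by gcongr
    have h10 : C * ε ≤ C * (1 / 2) := by gcongr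
    linarith

end IsTame

/-! ### Centers of mass -/

/-- The halfspace with normal `w` and threshold `t`. -/
noncomputable def halfspace {n : ℕ} (w : EuclideanSpace ℝ (Fin n)) (t : ℝ)
    (x : EuclideanSpace ℝ (Fin n)) : ℝ :=
  sgn (inner ℝ w x - t)

section Basic

variable {n : ℕ} {w : EuclideanSpace ℝ (Fin n)} {t : ℝ}

theorem isHalfspace_halfspace (hw : ‖w‖ = 1) : IsHalfspace (halfspace w t) :=
  ⟨w, t, hw, fun _ => rfl⟩

theorem measurable_halfspace : Measurable (halfspace w t) :=
  measurable_sgn.comp (by fun_prop)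

theorem isSignValued_halfspace : IsSignValued (halfspace w t) := fun _ => sgn_eq_or _

theorem IsSignValued.abs_eq {V : Type*} {f : V → ℝ} (hf : IsSignValued f) (x : V) : |f x| = 1 := by
  rcases hf x with h | h <;> simp [h]

theorem IsSignValued.integrable {V : Type*} [MeasurableSpace V] {μ : Measure V} [IsFiniteMeasure μ]
    {f : V → ℝ} (hf : IsSignValued f) (hfm : Measurable f) : Integrable f μ :=
  Integrable.of_bound hfm.aestronglyMeasurable 1 (.of_forall fun x => (hf.abs_eq x).le)

theorem IsSignValued.abs_integral_le {V : Type*} [MeasurableSpace V] {μ : Measure V}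
    [IsProbabilityMeasure μ] {f : V → ℝ} (hf : IsSignValued f) : |∫ x, f x ∂μ| ≤ 1 := by
  have := norm_integral_le_of_norm_le_const (μ := μ) (f := f) (C := 1)
    (.of_forall fun x => (hf.abs_eq x).le)
  simpa using this

/-- Two sign-valued functions of the same mean differ only where one of them takes its less frequent
value, and this value has probability `(1 - |E[f]|) / 2` for both. -/
theorem fdist_le {μ : Measure (EuclideanSpace ℝ (Fin n))} [IsProbabilityMeasure μ]
    {f g : EuclideanSpace ℝ (Fin n) → ℝ} (hf : IsSignValued f) (hfm : Measurable f)
    (hg : IsSignValued g) (hgm : Measurable g) (h : ∫ x, g x ∂μ = ∫ x, f x ∂μ) :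
    fdist μ f g ≤ 1 - |∫ x, f x ∂μ| := by
  have hm : MeasurableSet {x | f x ≠ g x} := (measurableSet_eq_fun hfm hgm).compl
  have hfi := hf.integrable (μ := μ) hfm
  have hgi := hg.integrable (μ := μ) hgm
  have h1 : Integrable ({x | f x ≠ g x}.indicator (1 : EuclideanSpace ℝ (Fin n) → ℝ)) μ :=
    (integrable_indicator_iff hm).2 (integrable_const (1 : ℝ)).integrableOn
  have key : ∀ s : ℝ, |s| = 1 → fdist μ f g ≤ 1 - s * ∫ x, f x ∂μ := by
    intro s hs
    rw [fdist, ← integral_indicator_one hm]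
    have h2 : ∫ x, (1 - (s * f x + s * g x) / 2) ∂μ = 1 - s * ∫ x, f x ∂μ := by
      have h3 : Integrable (fun x => s * f x + s * g x) μ :=
        (hfi.const_mul s).add (hgi.const_mul s)
      rw [integral_sub (integrable_const _) (h3.div_const 2), integral_div,
        integral_add (hfi.const_mul s) (hgi.const_mul s), integral_const_mul, integral_const_mul, h]
      simp
    rw [← h2]
    refine integral_mono h1 ((integrable_const _).sub
      (((hfi.const_mul s).add (hgi.const_mul s)).div_const 2)) fun x => ?_
    simp only [indicator, mem_ofPred_eq, Pi.one_apply]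
    rcases hf x with h1 | h1 <;> rcases hg x with h2 | h2 <;>
      rcases eq_or_eq_neg_of_abs_eq hs with h3 | h3 <;> norm_num [h1, h2, h3]
  rcases abs_choice (∫ x, f x ∂μ) with h0 | h0 <;> rw [h0]
  · simpa using key 1 (by simp)
  · simpa using key (-1) (by simp)

/-- A sub-Gaussian variable is small in mean on a small event, up to a logarithm. -/
theorem setIntegral_abs_le_of_subgaussian {Ω : Type*} [MeasurableSpace Ω] {μ : Measure Ω}
    [IsProbabilityMeasure μ] {X : Ω → ℝ} (hX : HasSubgaussianMGF X (3 / 2) μ) {A : Set Ω} {τ : ℝ}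
    (hτ : 0 < τ) (hA : μ.real A ≤ τ) (hτ1 : τ ≤ 1) :
    ∫ x in A, |X x| ∂μ ≤ τ * (log (1 / τ) + 5) := by
  have i1 := hX.integrable_exp_mul 1
  have i2 := hX.integrable_exp_mul (-1)
  have m1 := hX.mgf_le 1
  have m2 := hX.mgf_le (-1)
  have i3 : Integrable (fun x => exp (1 * X x) + exp (-1 * X x)) μ := i1.add i2
  have hlog : 0 ≤ log (1 / τ) := log_nonneg (by rwa [le_div_iff₀ hτ, one_mul])
  have h1 : ∫ x, exp (1 * X x) + exp (-1 * X x) ∂μ ≤ 5 := by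
    rw [integral_add i1 i2]
    simp only [mgf] at m1 m2
    have h2 := exp_three_quarters_le
    push_cast at m1 m2
    norm_num at m1 m2 ⊢
    linarith
  -- `y ≤ M + exp (y - M)` with `M = log (1 / τ)`
  have h3 : ∀ x, |X x| ≤ log (1 / τ) + τ * (exp (1 * X x) + exp (-1 * X x)) := by
    intro x
    have h4 : |X x| - log (1 / τ) ≤ exp (|X x| - log (1 / τ)) := by
      linarith [add_one_le_exp (|X x| - log (1 / τ))]
    rw [exp_sub, exp_log (by positivity), div_div_eq_mul_div, div_one] at h4
    have h5 : exp |X x| ≤ exp (1 * X x) + exp (-1 * X x) := by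
      rcases abs_choice (X x) with h | h <;> rw [h]
      · rw [one_mul]; linarith [exp_pos (-1 * X x)]
      · rw [neg_one_mul]; linarith [exp_pos (1 * X x)]
    nlinarith
  calc ∫ x in A, |X x| ∂μ
      ≤ ∫ x in A, (log (1 / τ) + τ * (exp (1 * X x) + exp (-1 * X x))) ∂μ :=
        integral_mono hX.integrable.abs.integrableOn
          ((integrable_const _).add (i3.const_mul τ)).integrableOn h3
    _ = μ.real A * log (1 / τ) + τ * ∫ x in A, (exp (1 * X x) + exp (-1 * X x)) ∂μ := by
        rw [integral_add (integrable_const _) (i3.const_mul τ).integrableOn, integral_const_mul]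
        simp
    _ ≤ τ * log (1 / τ) + τ * 5 := by
        gcongr
        exact (setIntegral_le_integral i3 (.of_forall fun x => by positivity)).trans h1
    _ = _ := by ring

end Basic

namespace IsBoundedRI

variable {n : ℕ} {μ : Measure (EuclideanSpace ℝ (Fin n))} {C : ℝ}

theorem integral_comp_inner (hn : 3 ≤ n) (hμ : IsBoundedRI μ √n C)
    {w : EuclideanSpace ℝ (Fin n)} (hw : ‖w‖ = 1) {F : ℝ → ℝ} (hF : Measurable F) :
    ∫ x, F (inner ℝ w x) ∂μ = ∫ z, F z ∂(marginal μ) := by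
  rw [← hμ.map_inner (by omega) hw, integral_map (by fun_prop) hF.aestronglyMeasurable]

variable [IsProbabilityMeasure μ]

theorem isProbabilityMeasure_marginal (μ : Measure (EuclideanSpace ℝ (Fin n)))
    [IsProbabilityMeasure μ] : IsProbabilityMeasure (marginal μ) :=
  Measure.isProbabilityMeasure_map measurable_firstCoord.aemeasurable

theorem subgaussian_inner (hn : 3 ≤ n) (hμ : IsBoundedRI μ √n C)
    {w : EuclideanSpace ℝ (Fin n)} (hw : ‖w‖ = 1) :
    HasSubgaussianMGF (fun x => inner ℝ w x) (3 / 2) μ := by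
  have h := (hμ.isTame_marginal hn).subgaussian
  rw [← hμ.map_inner (by omega) hw] at h
  exact (HasSubgaussianMGF.id_map_iff (by fun_prop)).1 h

theorem integrable_smul (hμ : IsBoundedRI μ √n C) {f : EuclideanSpace ℝ (Fin n) → ℝ}
    (hf : IsSignValued f) (hfm : Measurable f) : Integrable (fun x => f x • x) μ := by
  refine Integrable.of_bound (hfm.smul measurable_id).aestronglyMeasurable √n ?_
  filter_upwards [hμ.2.2.2.2] with x hx
  rw [norm_smul, norm_eq_abs, hf.abs_eq, one_mul]
  exact hx.2

theorem inner_center (hμ : IsBoundedRI μ √n C) {f : EuclideanSpace ℝ (Fin n) → ℝ}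
    (hf : IsSignValued f) (hfm : Measurable f) (v : EuclideanSpace ℝ (Fin n)) :
    inner ℝ v (center μ f) = ∫ x, f x * inner ℝ v x ∂μ := by
  rw [center, ← integral_inner (hμ.integrable_smul hf hfm)]
  simp_rw [inner_smul_right]

theorem integrable_mul_inner (hμ : IsBoundedRI μ √n C) {f : EuclideanSpace ℝ (Fin n) → ℝ}
    (hf : IsSignValued f) (hfm : Measurable f) (v : EuclideanSpace ℝ (Fin n)) :
    Integrable (fun x => f x * inner ℝ v x) μ := by
  have := (hμ.integrable_smul hf hfm).const_inner (𝕜 := ℝ) v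
  simpa only [inner_smul_right] using this

theorem norm_center_le (hn : 3 ≤ n) (hμ : IsBoundedRI μ √n C) {f : EuclideanSpace ℝ (Fin n) → ℝ}
    (hf : IsSignValued f) (hfm : Measurable f) : ‖center μ f‖ ≤ 2 := by
  have := isProbabilityMeasure_marginal μ
  have ht := hμ.isTame_marginal hn
  rcases eq_or_ne (center μ f) 0 with h0 | h0
  · simp [h0]
  set w := (‖center μ f‖⁻¹ : ℝ) • center μ f with hw
  have hw1 : ‖w‖ = 1 := by rw [hw]; exact norm_smul_inv_norm h0
  have h1 : inner ℝ w (center μ f) = ‖center μ f‖ := by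
    rw [hw, inner_smul_left, real_inner_self_eq_norm_sq]
    have := norm_ne_zero_iff.2 h0
    simp; field_simp
  rw [← h1, hμ.inner_center hf hfm]
  have i1 : Integrable (fun z : ℝ => (1 + z ^ 2) / 2) (marginal μ) :=
    ((integrable_const _).add ht.integrable_sq).div_const 2
  calc ∫ x, f x * inner ℝ w x ∂μ ≤ ∫ x, |inner ℝ w x| ∂μ := by
        refine integral_mono (hμ.integrable_mul_inner hf hfm w)
          (hμ.subgaussian_inner hn hw1).integrable.abs fun x => ?_
        refine (le_abs_self _).trans_eq ?_
        rw [abs_mul, hf.abs_eq, one_mul]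
    _ = ∫ z, |z| ∂(marginal μ) := hμ.integral_comp_inner hn hw1 (F := fun z => |z|) (by fun_prop)
    _ ≤ ∫ z, (1 + z ^ 2) / 2 ∂(marginal μ) := by
        refine integral_mono ht.integrable_id.abs i1 fun z => ?_
        simp only
        nlinarith [sq_nonneg (|z| - 1), sq_abs z]
    _ ≤ 2 := by
        rw [integral_div, integral_add (integrable_const _) ht.integrable_sq]
        have := ht.integral_sq_le
        simp
        linarith

theorem inner_center_halfspace (hn : 3 ≤ n) (hμ : IsBoundedRI μ √n C)
    {w : EuclideanSpace ℝ (Fin n)} (hw : ‖w‖ = 1) (t : ℝ) :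
    inner ℝ w (center μ (halfspace w t)) = thresholdMoment (marginal μ) t := by
  rw [hμ.inner_center isSignValued_halfspace measurable_halfspace]
  exact hμ.integral_comp_inner hn hw (F := fun z => sgn (z - t) * z)
    ((measurable_sgn.comp (by fun_prop)).mul measurable_id)

theorem integral_halfspace (hn : 3 ≤ n) (hμ : IsBoundedRI μ √n C)
    {w : EuclideanSpace ℝ (Fin n)} (hw : ‖w‖ = 1) (t : ℝ) :
    ∫ x, halfspace w t x ∂μ = 2 * upperTail (marginal μ) t - 1 := by
  have := isProbabilityMeasure_marginal μ
  rw [← IsTame.integral_sgn]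
  exact hμ.integral_comp_inner hn hw (F := fun z => sgn (z - t)) (measurable_sgn.comp (by fun_prop))

/-- Among the functions of a given mean, the halfspace with normal `w` maximizes `⟨w, E[x f(x)]⟩`,
and the deficit of `f` is the mean distance to the hyperplane over the points where they differ. -/
theorem thresholdMoment_sub_inner_center (hn : 3 ≤ n) (hμ : IsBoundedRI μ √n C)
    {w : EuclideanSpace ℝ (Fin n)} (hw : ‖w‖ = 1) (t : ℝ) {f : EuclideanSpace ℝ (Fin n) → ℝ}
    (hf : IsSignValued f) (hfm : Measurable f)
    (h : ∫ x, halfspace w t x ∂μ = ∫ x, f x ∂μ) :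
    thresholdMoment (marginal μ) t - inner ℝ w (center μ f) =
      2 * ∫ x in {x | f x ≠ halfspace w t x}, |inner ℝ w x - t| ∂μ := by
  have hm : MeasurableSet {x | f x ≠ halfspace w t x} :=
    (measurableSet_eq_fun hfm measurable_halfspace).compl
  have hfi := hf.integrable (μ := μ) hfm
  have hhi := (isSignValued_halfspace (w := w) (t := t)).integrable (μ := μ) measurable_halfspace
  have i1 := hμ.integrable_mul_inner hf hfm w
  have i2 := hμ.integrable_mul_inner (isSignValued_halfspace (w := w) (t := t))
    measurable_halfspace w
  have i3 : Integrable (fun x => halfspace w t x * inner ℝ w x - f x * inner ℝ w x) μ := i2.sub i1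
  have i4 : Integrable (fun x => t * halfspace w t x - t * f x) μ :=
    (hhi.const_mul t).sub (hfi.const_mul t)
  rw [← hμ.inner_center_halfspace hn hw, hμ.inner_center hf hfm,
    hμ.inner_center isSignValued_halfspace measurable_halfspace, ← integral_indicator hm,
    ← integral_const_mul, ← integral_sub i2 i1]
  have h1 : ∫ x, (t * halfspace w t x - t * f x) ∂μ = 0 := by
    rw [integral_sub (hhi.const_mul t) (hfi.const_mul t), integral_const_mul, integral_const_mul, h,
      sub_self]
  rw [← sub_zero (∫ x, _ ∂μ), ← h1, ← integral_sub i3 i4]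
  refine integral_congr_ae (.of_forall fun x => ?_)
  have h2 := sgn_mul_self (inner ℝ w x - t)
  change halfspace w t x * (inner ℝ w x - t) = _ at h2
  beta_reduce
  by_cases hx : f x = halfspace w t x
  · rw [indicator_of_notMem (by simpa using hx), hx]; ring
  · rw [indicator_of_mem (by simpa using hx), ← h2]
    have h3 : f x = -halfspace w t x := by
      rcases hf x with h3 | h3 <;>
        rcases isSignValued_halfspace (w := w) (t := t) x with h4 | h4 <;>
        simp_all
    rw [h3]; ring

theorem inner_center_le (hn : 3 ≤ n) (hμ : IsBoundedRI μ √n C)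
    {w : EuclideanSpace ℝ (Fin n)} (hw : ‖w‖ = 1) (t : ℝ) {f : EuclideanSpace ℝ (Fin n) → ℝ}
    (hf : IsSignValued f) (hfm : Measurable f)
    (h : ∫ x, halfspace w t x ∂μ = ∫ x, f x ∂μ) :
    inner ℝ w (center μ f) ≤ thresholdMoment (marginal μ) t := by
  have h1 := hμ.thresholdMoment_sub_inner_center hn hw t hf hfm h
  have h2 : 0 ≤ ∫ x in {x | f x ≠ halfspace w t x}, |inner ℝ w x - t| ∂μ :=
    integral_nonneg fun x => abs_nonneg _
  linarith

/-- The center of mass of a halfspace is parallel to its normal: all the halfspaces with threshold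
`t` have the same mean, so `w` maximizes the inner product with the center of mass among the unit
vectors. -/
theorem center_halfspace (hn : 3 ≤ n) (hμ : IsBoundedRI μ √n C)
    {w : EuclideanSpace ℝ (Fin n)} (hw : ‖w‖ = 1) (t : ℝ) :
    center μ (halfspace w t) = thresholdMoment (marginal μ) t • w := by
  set c := center μ (halfspace w t) with hc
  have h1 : inner ℝ w c = thresholdMoment (marginal μ) t := hμ.inner_center_halfspace hn hw t
  rcases eq_or_ne c 0 with h0 | h0
  · rw [← h1, h0]; simp
  set v := (‖c‖⁻¹ : ℝ) • c with hv
  have hv1 : ‖v‖ = 1 := by rw [hv]; exact norm_smul_inv_norm h0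
  have h2 : inner ℝ v c = ‖c‖ := by
    rw [hv, inner_smul_left, real_inner_self_eq_norm_sq]
    have := norm_ne_zero_iff.2 h0
    simp; field_simp
  have h3 := hμ.inner_center_le hn hv1 t (isSignValued_halfspace (w := w) (t := t))
    measurable_halfspace
    (by rw [hμ.integral_halfspace hn hv1, hμ.integral_halfspace hn hw])
  rw [← hc, h2, ← h1] at h3
  have h4 : inner ℝ w c = ‖w‖ * ‖c‖ := le_antisymm (real_inner_le_norm _ _) (by rwa [hw, one_mul])
  have h5 := inner_eq_norm_mul_iff_real.1 h4
  rw [hw, one_smul] at h5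
  rw [← h1, h4, hw, one_mul, h5]

/-- A function that is far from the halfspace of the same mean with normal `w` has a deficit in
direction `w`: the marginal has bounded density, so most of the points where the two differ are far
from the hyperplane. -/
theorem le_thresholdMoment_sub_inner_center (hn : 3 ≤ n) (hμ : IsBoundedRI μ √n C)
    {w : EuclideanSpace ℝ (Fin n)} (hw : ‖w‖ = 1) (t : ℝ) {f : EuclideanSpace ℝ (Fin n) → ℝ}
    (hf : IsSignValued f) (hfm : Measurable f)
    (h : ∫ x, halfspace w t x ∂μ = ∫ x, f x ∂μ) {ε : ℝ} (hε : 0 ≤ ε)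
    (hd : ε ≤ fdist μ f (halfspace w t)) :
    C * ε ^ 2 / 2 ≤ thresholdMoment (marginal μ) t - inner ℝ w (center μ f) := by
  have ht := hμ.isTame_marginal hn
  have hC := ht.pos
  rw [hμ.thresholdMoment_sub_inner_center hn hw t hf hfm h]
  set D := {x | f x ≠ halfspace w t x} with hD
  have hm : MeasurableSet D := (measurableSet_eq_fun hfm measurable_halfspace).compl
  set s := ε * C / 2 with hs
  have hs0 : 0 ≤ s := by positivity
  set N := {x : EuclideanSpace ℝ (Fin n) | |inner ℝ w x - t| ≤ s} with hN
  have hNm : MeasurableSet N := measurableSet_le (by fun_prop) (by fun_prop)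
  have hN1 : μ.real N ≤ ε / 2 := by
    have h1 := ht.measureReal_abs_sub_le t hs0
    rw [← hμ.map_inner (by omega) hw, map_measureReal_apply (by fun_prop)
      (measurableSet_le (by fun_prop) (by fun_prop))] at h1
    refine h1.trans_eq ?_
    rw [hs]; field_simp
  have hDN : ε / 2 ≤ μ.real (D \ N) := by
    have h1 : μ.real D ≤ μ.real (D \ N) + μ.real N :=
      (measureReal_mono (by rw [sdiff_union_self]; exact subset_union_left)).trans
        (measureReal_union_le _ _)
    have : ε ≤ μ.real D := hd
    linarith
  have i1 : Integrable (fun x => |inner ℝ w x - t|) μ :=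
    ((hμ.subgaussian_inner hn hw).integrable.sub (integrable_const t)).abs
  have h1 : s * μ.real (D \ N) ≤ ∫ x in D, |inner ℝ w x - t| ∂μ := by
    calc s * μ.real (D \ N) = ∫ _ in D \ N, s ∂μ := by
          rw [setIntegral_const, smul_eq_mul, mul_comm]
      _ ≤ ∫ x in D \ N, |inner ℝ w x - t| ∂μ :=
          setIntegral_mono_on (integrable_const s).integrableOn i1.integrableOn (hm.diff hNm)
            fun x hx => (not_le.1 hx.2).le
      _ ≤ _ := setIntegral_mono_set i1.integrableOn (.of_forall fun x => abs_nonneg _)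
            sdiff_subset.eventuallyLE
  have h2 : s * (ε / 2) ≤ s * μ.real (D \ N) := by gcongr
  calc C * ε ^ 2 / 2 = 2 * (s * (ε / 2)) := by rw [hs]; ring
    _ ≤ _ := by linarith

end IsBoundedRI

/-! ### Distance to a halfspace and norms of centers of mass -/

theorem exists_unit_inner_eq_norm {V : Type*} [NormedAddCommGroup V] [InnerProductSpace ℝ V]
    [Nontrivial V] (c : V) : ∃ w : V, ‖w‖ = 1 ∧ c = ‖c‖ • w ∧ inner ℝ w c = ‖c‖ := by
  rcases eq_or_ne c 0 with h0 | h0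
  · obtain ⟨w, hw⟩ := exists_norm_eq V zero_le_one
    exact ⟨w, hw, by simp [h0], by simp [h0]⟩
  · have h1 := norm_ne_zero_iff.2 h0
    refine ⟨(‖c‖⁻¹ : ℝ) • c, norm_smul_inv_norm h0, ?_, ?_⟩
    · rw [smul_smul, mul_inv_cancel₀ h1, one_smul]
    · rw [inner_smul_left, real_inner_self_eq_norm_sq]
      simp; field_simp

namespace IsBoundedRI

variable {n : ℕ} {μ : Measure (EuclideanSpace ℝ (Fin n))} {C : ℝ} [IsProbabilityMeasure μ]

/-- Every sign-valued function has a halfspace of the same mean aligned with it, and it is close to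
this halfspace if the norms of the two centers of mass are close, or if the mean is so close to `1`
or `-1` that any two functions of this mean are close. -/
theorem exists_halfspace (hn : 3 ≤ n) (hμ : IsBoundedRI μ √n C)
    {f : EuclideanSpace ℝ (Fin n) → ℝ} (hf : IsSignValued f) (hfm : Measurable f) :
    ∃ t h, upperTail (marginal μ) t = (1 + ∫ x, f x ∂μ) / 2 ∧ IsHalfspace h ∧
      (center μ f ≠ 0 → Aligned μ f h) ∧ ∫ x, h x ∂μ = ∫ x, f x ∂μ ∧
      ∀ ε, 0 < ε → ε ≤ 1 / 2 →
        (thresholdMoment (marginal μ) t ^ 2 - ‖center μ f‖ ^ 2 < C ^ 2 * ε ^ 3 / 8 ∨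
          1 - ε ≤ |∫ x, f x ∂μ|) → fdist μ f h ≤ ε := by
  have := isProbabilityMeasure_marginal μ
  have ht := hμ.isTame_marginal hn
  have hC := ht.pos
  have : Nontrivial (EuclideanSpace ℝ (Fin n)) :=
    Module.nontrivial_of_finrank_pos (R := ℝ) (by rw [finrank_euclideanSpace_fin]; omega)
  obtain ⟨w, hw, hcw, hwc⟩ := exists_unit_inner_eq_norm (center μ f)
  have hf1 := abs_le.1 (hf.abs_integral_le (μ := μ))
  obtain ⟨t, htf⟩ := ht.exists_upperTail_eq (p := (1 + ∫ x, f x ∂μ) / 2)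
    ⟨by linarith, by linarith⟩
  have hint : ∫ x, halfspace w t x ∂μ = ∫ x, f x ∂μ := by
    rw [hμ.integral_halfspace hn hw, htf]; ring
  have hle := hμ.inner_center_le hn hw t hf hfm hint
  rw [hwc] at hle
  refine ⟨t, halfspace w t, htf, isHalfspace_halfspace hw, fun h0 => ?_, hint,
    fun ε hε0 hε hor => ?_⟩
  · have h1 := norm_pos_iff.2 h0
    have h2 := h1.trans_le hle
    refine ⟨‖center μ f‖ / thresholdMoment (marginal μ) t, by positivity, ?_⟩
    rw [hμ.center_halfspace hn hw, smul_smul, div_mul_cancel₀ _ h2.ne']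
    exact hcw
  · have hdist := fdist_le hf hfm (isSignValued_halfspace (w := w) (t := t)) measurable_halfspace
      hint
    rcases hor with hor | hor
    · by_contra! hlt
      have h1 := hμ.le_thresholdMoment_sub_inner_center hn hw t hf hfm hint hε0.le hlt.le
      rw [hwc] at h1
      have h2 : |∫ x, f x ∂μ| ≤ 1 - ε := by linarith
      have h3 := abs_le.1 h2
      have h4 := ht.le_thresholdMoment hε (t := t) (by rw [htf]; linarith) (by rw [htf]; linarith)
      have h5 : C * ε ^ 2 / 2 * (C * ε / 4) ≤
          (thresholdMoment (marginal μ) t - ‖center μ f‖) *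
            (thresholdMoment (marginal μ) t + ‖center μ f‖) := by
        have h6 := norm_nonneg (center μ f)
        exact mul_le_mul h1 (by linarith) (by positivity)
          (by linarith [show 0 ≤ C * ε ^ 2 / 2 by positivity])
      nlinarith
    · linarith

/-- A function close to a halfspace has nearly the same mean and a center of mass of nearly the
same norm. -/
theorem abs_thresholdMoment_sq_sub_norm_center_sq_le (hn : 3 ≤ n) (hμ : IsBoundedRI μ √n C)
    {f : EuclideanSpace ℝ (Fin n) → ℝ} (hf : IsSignValued f) (hfm : Measurable f)
    {w : EuclideanSpace ℝ (Fin n)} (hw : ‖w‖ = 1) (t : ℝ) {τ : ℝ} (hτ : 0 < τ) (hτ1 : τ ≤ 1)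
    (h : fdist μ f (halfspace w t) ≤ τ) :
    |upperTail (marginal μ) t - (1 + ∫ x, f x ∂μ) / 2| ≤ τ ∧
      |thresholdMoment (marginal μ) t ^ 2 - ‖center μ f‖ ^ 2| ≤ 8 * (τ * (log (1 / τ) + 5)) := by
  have := isProbabilityMeasure_marginal μ
  have ht := hμ.isTame_marginal hn
  have : Nontrivial (EuclideanSpace ℝ (Fin n)) :=
    Module.nontrivial_of_finrank_pos (R := ℝ) (by rw [finrank_euclideanSpace_fin]; omega)
  set D := {x | f x ≠ halfspace w t x} with hD
  have hm : MeasurableSet D := (measurableSet_eq_fun hfm measurable_halfspace).compl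
  have hhs := isSignValued_halfspace (w := w) (t := t)
  have hle : ∀ x, |halfspace w t x - f x| ≤ 2 * D.indicator 1 x := by
    intro x
    by_cases hx : x ∈ D
    · rw [indicator_of_mem hx]
      have := hhs.abs_eq x
      have := hf.abs_eq x
      simp only [Pi.one_apply, mul_one]
      linarith [abs_sub (halfspace w t x) (f x)]
    · have hx' : f x = halfspace w t x := by simpa [hD] using hx
      rw [indicator_of_notMem hx, hx']
      simp
  have hDi : Integrable (D.indicator (1 : EuclideanSpace ℝ (Fin n) → ℝ)) μ :=
    (integrable_indicator_iff hm).2 (integrable_const (1 : ℝ)).integrableOn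
  have hfi := hf.integrable (μ := μ) hfm
  have hhi := hhs.integrable (μ := μ) measurable_halfspace
  have hDτ : μ.real D ≤ τ := h
  constructor
  · have h1 : |∫ x, (halfspace w t x - f x) ∂μ| ≤ 2 * μ.real D := by
      refine (abs_integral_le_integral_abs).trans ?_
      rw [← integral_indicator_one hm, ← integral_const_mul]
      exact integral_mono (hhi.sub hfi).abs (hDi.const_mul 2) hle
    rw [integral_sub hhi hfi, hμ.integral_halfspace hn hw] at h1
    rw [abs_le] at h1 ⊢
    constructor <;> linarith
  · obtain ⟨v, hv, -, hvc⟩ := exists_unit_inner_eq_norm (center μ (halfspace w t) - center μ f)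
    have i1 := hμ.integrable_mul_inner hf hfm v
    have i2 := hμ.integrable_mul_inner hhs measurable_halfspace v
    have hsub := hμ.subgaussian_inner hn hv
    have h1 : ‖center μ (halfspace w t) - center μ f‖ ≤ 2 * (τ * (log (1 / τ) + 5)) := by
      rw [← hvc, inner_sub_right, hμ.inner_center hf hfm, hμ.inner_center hhs measurable_halfspace,
        ← integral_sub i2 i1]
      calc _ ≤ ∫ x, 2 * D.indicator (fun x => |inner ℝ v x|) x ∂μ := by
            refine integral_mono (i2.sub i1) ((hsub.integrable.abs.indicator hm).const_mul 2)
              fun x => ?_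
            refine (le_abs_self _).trans ?_
            beta_reduce
            rw [← sub_mul, abs_mul]
            refine (mul_le_mul_of_nonneg_right (hle x) (abs_nonneg _)).trans_eq ?_
            by_cases hx : x ∈ D
            · simp only [indicator_of_mem hx, Pi.one_apply, mul_one]
            · simp only [indicator_of_notMem hx]; ring
        _ ≤ _ := by
            rw [integral_const_mul, integral_indicator hm]
            have := setIntegral_abs_le_of_subgaussian hsub hτ hDτ hτ1
            linarith
    have h2 : ‖center μ (halfspace w t)‖ = thresholdMoment (marginal μ) t := by
      rw [hμ.center_halfspace hn hw, norm_smul, hw, mul_one, norm_eq_abs,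
        abs_of_nonneg (ht.thresholdMoment_nonneg t)]
    have h3 := hμ.norm_center_le hn hf hfm
    have h4 := hμ.norm_center_le hn hhs measurable_halfspace
    have h5 := abs_norm_sub_norm_le (center μ (halfspace w t)) (center μ f)
    rw [h2] at h4 h5
    have h6 := norm_nonneg (center μ f)
    have h7 := ht.thresholdMoment_nonneg t
    rw [sq_sub_sq, abs_mul,
      abs_of_nonneg (by linarith : 0 ≤ thresholdMoment (marginal μ) t + ‖center μ f‖)]
    calc _ ≤ 4 * (2 * (τ * (log (1 / τ) + 5))) := by
          gcongr
          · linarith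
          · exact h5.trans h1
      _ = _ := by ring

end IsBoundedRI

/-- With distance `κ ε ^ (3 + η)` to a halfspace, the logarithm in the estimate for the centers of
mass is absorbed by `ε ^ η`, and the estimate is of order `ε ^ 3`. -/
theorem exists_mul_log_le {η b : ℝ} (hη : 0 < η) (hb : 0 < b) :
    ∃ κ : ℝ, 0 < κ ∧ ∀ ε ∈ Ioo (0 : ℝ) (1 / 2),
      κ * ε ^ (3 + η) ≤ 1 ∧
      κ * ε ^ (3 + η) * (log (1 / (κ * ε ^ (3 + η))) + 5) ≤ b * ε ^ (3 : ℕ) := by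
  set a := η / (3 + η) with ha
  have ha0 : 0 < a := by positivity
  have ha1 : 1 - a = 3 / (3 + η) := by rw [ha]; field_simp; ring
  have hA : 0 < 1 / a + 5 := by positivity
  set B := min 1 (b / (1 / a + 5)) with hB
  have hB0 : 0 < B := lt_min one_pos (by positivity)
  have hr : 0 < (3 + η) / 3 := by positivity
  refine ⟨B ^ ((3 + η) / 3), rpow_pos_of_pos hB0 _, fun ε hε => ?_⟩
  have hε0 := hε.1
  set τ := B ^ ((3 + η) / 3) * ε ^ (3 + η) with hτ
  have hτ0 : 0 < τ := mul_pos (rpow_pos_of_pos hB0 _) (rpow_pos_of_pos hε0 _)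
  have hτ1 : τ ≤ 1 := mul_le_one₀ (rpow_le_one hB0.le (min_le_left _ _) hr.le)
    (rpow_nonneg hε0.le _) (rpow_le_one hε0.le (by linarith [hε.2]) (by positivity))
  refine ⟨hτ1, ?_⟩
  have h1 : τ ^ (1 - a) = B * ε ^ (3 : ℕ) := by
    rw [hτ, mul_rpow (rpow_nonneg hB0.le _) (rpow_nonneg hε0.le _), ← rpow_mul hB0.le,
      ← rpow_mul hε0.le, ha1, div_mul_div_cancel₀ (by norm_num), div_self (by positivity),
      mul_div_cancel₀ _ (by positivity), rpow_one]
    norm_cast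
  have h2 : log (1 / τ) ≤ (1 / τ) ^ a / a := log_le_rpow_div (by positivity) ha0
  have h3 : τ * (1 / τ) ^ a = τ ^ (1 - a) := by
    rw [rpow_sub hτ0, rpow_one, one_div, inv_rpow hτ0.le]; ring
  have h4 : τ ≤ τ ^ (1 - a) := by
    conv_lhs => rw [← rpow_one τ]
    exact rpow_le_rpow_of_exponent_ge hτ0 hτ1 (by linarith)
  calc τ * (log (1 / τ) + 5) ≤ τ * ((1 / τ) ^ a / a + 5) := by gcongr
    _ = τ * (1 / τ) ^ a * (1 / a) + τ * 5 := by ring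
    _ ≤ τ ^ (1 - a) * (1 / a) + τ ^ (1 - a) * 5 := by rw [h3]; gcongr
    _ = B * (1 / a + 5) * ε ^ (3 : ℕ) := by rw [h1]; ring
    _ ≤ b * ε ^ (3 : ℕ) := by
        gcongr
        calc B * (1 / a + 5) ≤ b / (1 / a + 5) * (1 / a + 5) := by gcongr; exact min_le_right _ _
          _ = b := div_mul_cancel₀ _ hA.ne'

/-! ### Concentration of the bilinear estimator -/

section SubGaussian

variable {Ω : Type*} [MeasurableSpace Ω] {μ : Measure Ω} {X Z : Ω → ℝ} {c : ℝ≥0}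

theorem hasSubgaussianMGF_mono (h : HasSubgaussianMGF X c μ) {c' : ℝ≥0} (hc : c ≤ c') :
    HasSubgaussianMGF X c' μ :=
  ⟨h.integrable_exp_mul, fun t => (h.mgf_le t).trans (exp_le_exp.2 (by gcongr))⟩

theorem lintegral_exp_mul_le (h : HasSubgaussianMGF X c μ) (t : ℝ) :
    ∫⁻ x, ENNReal.ofReal (exp (t * X x)) ∂μ ≤ ENNReal.ofReal (exp (c * t ^ 2 / 2)) := by
  rw [← ofReal_integral_eq_lintegral_ofReal (h.integrable_exp_mul t)
    (.of_forall fun x => (exp_pos _).le)]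
  exact ENNReal.ofReal_le_ofReal (h.mgf_le t)

/-- Changing the signs of a sub-Gaussian variable and centering leaves it sub-Gaussian: by Jensen's
inequality the moment generating function at `t` is at most `E exp (t X) * E exp (-t X)`, hence at
most `(E cosh (t X)) ^ 2`, which does not depend on the signs. -/
theorem hasSubgaussianMGF_sub_integral_of_abs_eq [IsProbabilityMeasure μ]
    (hZ : HasSubgaussianMGF Z c μ) (hX : Measurable X) (h : ∀ x, |X x| = |Z x|) :
    HasSubgaussianMGF (fun x => X x - ∫ y, X y ∂μ) (2 * c) μ := by
  have hi : ∀ t, Integrable (fun x => exp (t * X x)) μ := by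
    intro t
    refine Integrable.mono' ((hZ.integrable_exp_mul t).add (hZ.integrable_exp_mul (-t)))
      (by fun_prop) (.of_forall fun x => ?_)
    rw [norm_of_nonneg (exp_pos _).le, Pi.add_apply]
    rcases abs_eq_abs.1 (h x) with h | h <;> rw [h]
    · linarith [exp_pos (-t * Z x)]
    · rw [mul_neg, ← neg_mul]; linarith [exp_pos (t * Z x)]
  have hXi : Integrable X μ := by
    refine Integrable.mono' hZ.integrable.abs hX.aestronglyMeasurable (.of_forall fun x => ?_)
    rw [norm_eq_abs, h]
  refine ⟨fun t => ?_, fun t => ?_⟩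
  · simp_rw [mul_sub, sub_eq_add_neg, exp_add]
    exact (hi t).mul_const _
  set m := ∫ y, X y ∂μ with hm
  have hjensen : exp (-t * m) ≤ ∫ x, exp (-t * X x) ∂μ := by
    have h1 : ∫ x, exp (-t * m) * (1 + (-t * X x - -t * m)) ∂μ = exp (-t * m) := by
      have i1 : Integrable (fun x => -t * X x - -t * m) μ :=
        (hXi.const_mul _).sub (integrable_const _)
      rw [integral_const_mul, integral_add (integrable_const _) i1,
        integral_sub (hXi.const_mul _) (integrable_const _), integral_const_mul]
      simp [← hm]
    rw [← h1]
    refine integral_mono (((integrable_const _).add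
      ((hXi.const_mul _).sub (integrable_const _))).const_mul _) (hi _) fun x => ?_
    have h2 := add_one_le_exp (-t * X x - -t * m)
    calc exp (-t * m) * (1 + (-t * X x - -t * m))
        ≤ exp (-t * m) * exp (-t * X x - -t * m) := by gcongr; linarith
      _ = exp (-t * X x) := by rw [← exp_add]; congr 1; ring
  set p := ∫ x, exp (t * X x) ∂μ with hp
  set q := ∫ x, exp (-t * X x) ∂μ with hq
  have hpq : p + q ≤ 2 * exp (c * t ^ 2 / 2) := by
    have h1 : p + q = ∫ x, exp (t * Z x) ∂μ + ∫ x, exp (-t * Z x) ∂μ := by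
      rw [hp, hq, ← integral_add (hi t) (hi (-t)),
        ← integral_add (hZ.integrable_exp_mul t) (hZ.integrable_exp_mul (-t))]
      refine integral_congr_ae (.of_forall fun x => ?_)
      rcases abs_eq_abs.1 (h x) with h | h <;> simp only [h]
      rw [mul_neg, neg_mul, neg_mul, mul_neg, neg_neg, add_comm]
    have h2 := hZ.mgf_le t
    have h3 := hZ.mgf_le (-t)
    rw [neg_sq] at h3
    simp only [mgf] at h2 h3
    linarith
  have hp0 : 0 ≤ p := integral_nonneg fun x => (exp_pos _).le
  have hq0 : 0 ≤ q := integral_nonneg fun x => (exp_pos _).le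
  calc mgf (fun x => X x - m) μ t = p * exp (-t * m) := by
        rw [mgf, hp, ← integral_mul_const]
        refine integral_congr_ae (.of_forall fun x => ?_)
        simp only
        rw [← exp_add]; congr 1; ring
    _ ≤ p * q := by gcongr
    _ ≤ exp (c * t ^ 2 / 2) ^ 2 := by nlinarith [sq_nonneg (p - q), exp_pos (c * t ^ 2 / 2)]
    _ = _ := by
        rw [← exp_nat_mul]; congr 1; push_cast; ring

/-- The average of independent copies of a sub-Gaussian variable. -/
theorem hasSubgaussianMGF_average [IsProbabilityMeasure μ] (hX : HasSubgaussianMGF X c μ) {m : ℕ}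
    (hm : 0 < m) :
    HasSubgaussianMGF (fun x : Fin m → Ω => (1 / (m : ℝ)) * ∑ i, X (x i)) (c / m)
      (Measure.pi fun _ => μ) := by
  have hind : iIndepFun (fun (i : Fin m) (x : Fin m → Ω) => X (x i)) (Measure.pi fun _ => μ) :=
    iIndepFun_pi fun _ => hX.aemeasurable
  have h1 : ∀ i ∈ Finset.univ, HasSubgaussianMGF (fun x : Fin m → Ω => X (x i)) c
      (Measure.pi fun _ => μ) := by
    intro i _
    have hmp := measurePreserving_eval (fun _ : Fin m => μ) i
    refine HasSubgaussianMGF.of_map (Y := Function.eval i) hmp.measurable.aemeasurable ?_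
    rwa [hmp.map_eq]
  have h2 := (HasSubgaussianMGF.sum_of_iIndepFun hind h1).const_mul (1 / (m : ℝ))
  refine hasSubgaussianMGF_mono h2 (le_of_eq ?_)
  have hm0 : (m : ℝ) ≠ 0 := by exact_mod_cast hm.ne'
  ext
  rw [Finset.sum_const, Finset.card_univ, Fintype.card_fin, nsmul_eq_mul]
  push_cast
  change (1 / (m : ℝ)) ^ 2 * (m * c) = c / m
  field_simp

/-- A Gaussian variable `g` linearizes the square: `exp (a X ^ 2) = E exp (√(2 a) X g)`. -/
theorem lintegral_exp_mul_sq_le [IsProbabilityMeasure μ] (hX : HasSubgaussianMGF X c μ)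
    (hXm : Measurable X) {a : ℝ} (ha : 0 ≤ a) (hac : 2 * a * c ≤ 3 / 4) :
    ∫⁻ x, ENNReal.ofReal (exp (a * X x ^ 2)) ∂μ ≤ 2 := by
  set γ := gaussianReal 0 1
  have hlin : ∀ x, ENNReal.ofReal (exp (a * X x ^ 2)) =
      ∫⁻ g, ENNReal.ofReal (exp (√(2 * a) * g * X x)) ∂γ := by
    intro x
    have h1 := mgf_fun_id_gaussianReal (μ := 0) (v := 1)
    have h2 := congrFun h1 (√(2 * a) * X x)
    rw [mgf] at h2
    have h3 : ∀ g, √(2 * a) * X x * g = √(2 * a) * g * X x := fun g => by ring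
    simp_rw [h3] at h2
    rw [← ofReal_integral_eq_lintegral_ofReal _ (.of_forall fun g => (exp_pos _).le), h2]
    · congr 2
      rw [mul_pow, sq_sqrt (by positivity)]
      push_cast
      ring
    · have := integrable_exp_mul_gaussianReal (μ := 0) (v := 1) (√(2 * a) * X x)
      simpa only [h3] using this
  simp_rw [hlin]
  rw [lintegral_lintegral_swap (by fun_prop)]
  have hb : a * c ≤ 3 / 8 := by linarith
  calc _ ≤ ∫⁻ g, ENNReal.ofReal (exp (a * c * g ^ 2)) ∂γ := by
        refine lintegral_mono fun g => (lintegral_exp_mul_le hX _).trans_eq ?_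
        congr 2
        rw [mul_pow, sq_sqrt (by positivity)]
        ring
    _ = ENNReal.ofReal (∫ g, (√(2 * π))⁻¹ * exp (-(1 / 2 - a * c) * g ^ 2)) := by
        rw [show γ = _ from gaussianReal_of_var_ne_zero 0 one_ne_zero,
          lintegral_withDensity_eq_lintegral_mul _ (measurable_gaussianPDF _ _) (by fun_prop),
          ofReal_integral_eq_lintegral_ofReal]
        · refine lintegral_congr fun g => ?_
          rw [Pi.mul_apply, gaussianPDF, ← ENNReal.ofReal_mul (gaussianPDFReal_nonneg _ _ _),
            gaussianPDFReal, mul_assoc, ← exp_add]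
          congr 3
          · simp
          · simp
            ring
        · exact (integrable_exp_neg_mul_sq (by linarith)).const_mul _
        · exact .of_forall fun g => by positivity
    _ ≤ 2 := by
        rw [integral_const_mul, integral_gaussian]
        have h1 : (√(2 * π))⁻¹ * √(π / (1 / 2 - a * c)) ≤ 2 := by
          rw [← sqrt_inv, ← sqrt_mul (by positivity)]
          refine (sqrt_le_left (by norm_num)).2 ?_
          have h2 : 0 < 1 / 2 - a * c := by linarith
          rw [show (2 * π)⁻¹ * (π / (1 / 2 - a * c)) = 1 / (2 * (1 / 2 - a * c)) by field_simp,
            div_le_iff₀ (by positivity)]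
          linarith
        calc _ ≤ ENNReal.ofReal 2 := ENNReal.ofReal_le_ofReal h1
          _ = 2 := by simp

end SubGaussian

section Bilinear

/-- The average of a vector-valued function over a sample. -/
noncomputable def average {Ω V : Type*} [NormedAddCommGroup V] [InnerProductSpace ℝ V]
    {m : ℕ} (Φ : Ω → V) (x : Fin m → Ω) : V :=
  (1 / (m : ℝ)) • ∑ i, Φ (x i)

theorem inner_average_sub {Ω V : Type*} [NormedAddCommGroup V] [InnerProductSpace ℝ V]
    {m : ℕ} (hm : 0 < m) (Φ : Ω → V) (c v : V) (x : Fin m → Ω) :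
    inner ℝ v (average Φ x - c) = (1 / (m : ℝ)) * ∑ i, inner ℝ v (Φ (x i) - c) := by
  have : (m : ℝ) ≠ 0 := by exact_mod_cast hm.ne'
  simp only [average, inner_sub_right, inner_smul_right, inner_sum, Finset.sum_sub_distrib]
  simp
  field_simp

variable {Ω : Type*} [MeasurableSpace Ω] {μ : Measure Ω} [IsProbabilityMeasure μ]
  {V : Type*} [NormedAddCommGroup V] [InnerProductSpace ℝ V]
  {m : ℕ} {Φ : Ω → V} {c : V}

/-- The deviation of the average of a sample in a given direction. -/
theorem subgaussian_inner_average (hm : 0 < m)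
    (h : ∀ v, HasSubgaussianMGF (fun x => inner ℝ v (Φ x - c)) (3 * ‖v‖₊ ^ 2) μ) (v : V) :
    HasSubgaussianMGF (fun x : Fin m → Ω => inner ℝ v (average Φ x - c)) (3 * ‖v‖₊ ^ 2 / m)
      (Measure.pi fun _ => μ) := by
  simp_rw [inner_average_sub hm]
  exact hasSubgaussianMGF_average (h v) hm

variable [MeasurableSpace V] [BorelSpace V] [FiniteDimensional ℝ V]

theorem measurable_average (hΦ : Measurable Φ) :
    Measurable (average (m := m) Φ) := by
  unfold average; fun_prop

/-- Decoupling: conditionally on the second sample, `⟨α, β⟩` is sub-Gaussian with variance proxy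
proportional to `‖β‖² / m`, and `‖β‖²` is a sum over coordinates, to which Jensen's inequality is
applied. -/
theorem lintegral_exp_inner_average_le (hm : 0 < m) (hd : 0 < Module.finrank ℝ V)
    (hΦ : Measurable Φ)
    (h : ∀ v, HasSubgaussianMGF (fun x => inner ℝ v (Φ x - c)) (3 * ‖v‖₊ ^ 2) μ) {s : ℝ}
    (hs : 12 * s ^ 2 * Module.finrank ℝ V ≤ (m : ℝ) ^ 2) :
    ∫⁻ p : (Fin m → Ω) × (Fin m → Ω),
        ENNReal.ofReal (exp (s * inner ℝ (average Φ p.2 - c) (average Φ p.1 - c)))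
        ∂((Measure.pi fun _ => μ).prod (Measure.pi fun _ => μ)) ≤ 2 := by
  have hma := measurable_average (m := m) hΦ
  have hm0 : (0 : ℝ) < m := by exact_mod_cast hm
  set d := Module.finrank ℝ V with hdef
  have hd0 : (0 : ℝ) < d := by exact_mod_cast hd
  set b := stdOrthonormalBasis ℝ V
  set l := 3 * s ^ 2 / (2 * m) with hl
  have hl0 : 0 ≤ l := by positivity
  rw [lintegral_prod_symm' _ (by fun_prop)]
  calc _ ≤ ∫⁻ y : Fin m → Ω, ∑ k, ENNReal.ofReal (1 / d) *
          ENNReal.ofReal (exp (l * d * (inner ℝ (b k) (average Φ y - c)) ^ 2))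
          ∂(Measure.pi fun _ => μ) := by
        refine lintegral_mono fun y => ?_
        refine (lintegral_exp_mul_le (subgaussian_inner_average hm h (average Φ y - c)) s).trans ?_
        simp_rw [← ENNReal.ofReal_mul (show (0 : ℝ) ≤ 1 / d by positivity)]
        rw [← ENNReal.ofReal_sum_of_nonneg fun k _ => by positivity]
        apply ENNReal.ofReal_le_ofReal
        have h1 := convexOn_exp.map_sum_le (t := Finset.univ) (w := fun _ : Fin d => 1 / (d : ℝ))
          (p := fun k => l * d * (inner ℝ (b k) (average Φ y - c)) ^ 2)
          (fun _ _ => by positivity) (by simp; field_simp) (fun _ _ => mem_univ _)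
        refine le_trans (exp_le_exp.2 (le_of_eq ?_)) h1
        have h2 := b.sum_sq_norm_inner_right (average Φ y - c)
        simp only [smul_eq_mul, norm_eq_abs, sq_abs] at h2 ⊢
        rw [← Finset.mul_sum, ← Finset.mul_sum, h2, hl]
        push_cast
        field_simp
    _ ≤ ∑ k : Fin d, ENNReal.ofReal (1 / d) * 2 := by
        rw [lintegral_finsetSum _ (by fun_prop)]
        refine Finset.sum_le_sum fun k _ => ?_
        rw [lintegral_const_mul _ (by fun_prop)]
        gcongr
        refine lintegral_exp_mul_sq_le (subgaussian_inner_average hm h (b k)) (by fun_prop)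
          (by positivity) ?_
        have h3 : ‖b k‖₊ = 1 := by ext; simp
        rw [h3, hl]
        push_cast
        rw [show 2 * (3 * s ^ 2 / (2 * m) * d) * (3 * 1 ^ 2 / m) = 9 * s ^ 2 * d / (m : ℝ) ^ 2 by
          field_simp; ring, div_le_iff₀ (by positivity)]
        linarith
    _ = 2 := by
        rw [Finset.sum_const, Finset.card_univ, Fintype.card_fin, nsmul_eq_mul, ← mul_assoc,
          ← ENNReal.ofReal_natCast, ← ENNReal.ofReal_mul (by positivity)]
        rw [mul_one_div_cancel hd0.ne']
        simp

/-- The tail bound for the bilinear estimator before the choice of the sample size. -/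
theorem measureReal_inner_average_le (hm : 0 < m) (hd : 0 < Module.finrank ℝ V)
    (hΦ : Measurable Φ)
    (h : ∀ v, HasSubgaussianMGF (fun x => inner ℝ v (Φ x - c)) (3 * ‖v‖₊ ^ 2) μ)
    (hc : ‖c‖ ≤ 2) {e : ℝ} (he : 0 < e) :
    ((Measure.pi fun _ : Fin m => μ).prod (Measure.pi fun _ : Fin m => μ)).real
        {p | e < |inner ℝ (average Φ p.1) (average Φ p.2) - ‖c‖ ^ 2|} ≤
      4 * exp (-(m * e ^ 2 / 216)) + 4 * exp (-(m * e / (12 * √(Module.finrank ℝ V)))) := by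
  set P := Measure.pi fun _ : Fin m => μ with hP
  have hma := measurable_average (m := m) hΦ
  have hm0 : (0 : ℝ) < m := by exact_mod_cast hm
  set d := Module.finrank ℝ V with hdef
  have hd0 : (0 : ℝ) < d := by exact_mod_cast hd
  -- the linear terms
  have hlin : ∀ v : V, ‖v‖ ≤ 2 → P.real {x | e / 3 ≤ inner ℝ v (average Φ x - c)} ≤
      exp (-(m * e ^ 2 / 216)) := by
    intro v hv
    have h1 : 3 * ‖v‖₊ ^ 2 / m ≤ (12 / m : ℝ≥0) := by
      gcongr
      have : ‖v‖₊ ≤ 2 := by exact_mod_cast hv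
      calc 3 * ‖v‖₊ ^ 2 ≤ 3 * 2 ^ 2 := by gcongr
        _ = 12 := by norm_num
    have h2 := (hasSubgaussianMGF_mono (subgaussian_inner_average hm h v) h1).measure_ge_le
      (by positivity : 0 ≤ e / 3)
    refine h2.trans_eq ?_
    congr 1
    push_cast
    field_simp
    norm_num
  -- the quadratic term
  have hquad : ∀ s : ℝ, |s| = m / (4 * √d) → (P.prod P).real
      {p | m * e / (12 * √d) ≤ s * inner ℝ (average Φ p.2 - c) (average Φ p.1 - c)} ≤
        2 * exp (-(m * e / (12 * √d))) := by
    intro s hs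
    have h1 : 12 * s ^ 2 * d ≤ (m : ℝ) ^ 2 := by
      rw [← sq_abs, hs, div_pow, mul_pow, sq_sqrt hd0.le]
      rw [show 12 * ((m : ℝ) ^ 2 / (4 ^ 2 * d)) * d = 12 / 16 * m ^ 2 by field_simp; norm_num]
      nlinarith [sq_nonneg (m : ℝ)]
    have h2 := lintegral_exp_inner_average_le hm hd hΦ h h1
    have h3 := mul_meas_ge_le_lintegral₀ (μ := P.prod P)
      (f := fun p => ENNReal.ofReal (exp (s * inner ℝ (average Φ p.2 - c) (average Φ p.1 - c))))
      (by fun_prop) (ENNReal.ofReal (exp (m * e / (12 * √d))))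
    have h4 : {p : (Fin m → Ω) × (Fin m → Ω) | ENNReal.ofReal (exp (m * e / (12 * √d))) ≤
        ENNReal.ofReal (exp (s * inner ℝ (average Φ p.2 - c) (average Φ p.1 - c)))} =
        {p | m * e / (12 * √d) ≤ s * inner ℝ (average Φ p.2 - c) (average Φ p.1 - c)} := by
      ext p
      simp only [mem_ofPred_eq]
      rw [ENNReal.ofReal_le_ofReal_iff (exp_pos _).le, exp_le_exp]
    rw [h4] at h3
    have h5 := ENNReal.toReal_mono (by norm_num) (h3.trans h2)
    rw [ENNReal.toReal_mul, ENNReal.toReal_ofReal (exp_pos _).le] at h5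
    rw [exp_neg, ← div_eq_mul_inv, le_div_iff₀ (exp_pos _), mul_comm]
    simpa [measureReal_def] using h5
  have hfst : ∀ S : Set (Fin m → Ω), MeasurableSet S →
      (P.prod P).real (Prod.fst ⁻¹' S) = P.real S :=
    fun S hS => measurePreserving_fst.measureReal_preimage hS.nullMeasurableSet
  have hsnd : ∀ S : Set (Fin m → Ω), MeasurableSet S →
      (P.prod P).real (Prod.snd ⁻¹' S) = P.real S :=
    fun S hS => measurePreserving_snd.measureReal_preimage hS.nullMeasurableSet
  set A : V → Set (Fin m → Ω) := fun v => {x | e / 3 ≤ inner ℝ v (average Φ x - c)} with hA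
  have hAm : ∀ v, MeasurableSet (A v) := fun v => measurableSet_le (by fun_prop) (by fun_prop)
  set Q : ℝ → Set ((Fin m → Ω) × (Fin m → Ω)) := fun s =>
    {p | m * e / (12 * √d) ≤ s * inner ℝ (average Φ p.2 - c) (average Φ p.1 - c)} with hQ
  set s := m / (4 * √d) with hs
  have hs0 : 0 < s := by positivity
  have hcover : {p : (Fin m → Ω) × (Fin m → Ω) |
      e < |inner ℝ (average Φ p.1) (average Φ p.2) - ‖c‖ ^ 2|} ⊆
      ((Prod.fst ⁻¹' A c ∪ Prod.fst ⁻¹' A (-c)) ∪ (Prod.snd ⁻¹' A c ∪ Prod.snd ⁻¹' A (-c))) ∪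
        (Q s ∪ Q (-s)) := by
    intro p hp
    by_contra hcon
    simp only [mem_union, mem_preimage, not_or, hA, hQ, mem_ofPred_eq, not_le, inner_neg_left,
      neg_mul] at hcon hp
    obtain ⟨⟨⟨a1, a2⟩, a3, a4⟩, a5, a6⟩ := hcon
    have h1 : m * e / (12 * √d) = s * (e / 3) := by rw [hs]; field_simp; norm_num
    rw [h1, ← mul_neg] at a6
    rw [h1] at a5
    have a5 := lt_of_mul_lt_mul_left a5 hs0.le
    have a6 := lt_of_mul_lt_mul_left a6 hs0.le
    have h2 : inner ℝ (average Φ p.1) (average Φ p.2) - ‖c‖ ^ 2 =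
        inner ℝ c (average Φ p.1 - c) + inner ℝ c (average Φ p.2 - c) +
          inner ℝ (average Φ p.2 - c) (average Φ p.1 - c) := by
      simp only [inner_sub_left, inner_sub_right, real_inner_self_eq_norm_sq]
      rw [real_inner_comm c (average Φ p.2), real_inner_comm (average Φ p.1) (average Φ p.2)]
      ring
    rw [h2] at hp
    refine absurd hp (not_lt.2 (abs_le.2 ⟨?_, ?_⟩)) <;> linarith
  have hc' : ‖-c‖ ≤ 2 := by rwa [norm_neg]
  have b1 := hlin c hc
  have b2 := hlin (-c) hc'
  have b3 := hquad s (abs_of_pos hs0)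
  have b4 := hquad (-s) (by rw [abs_neg, abs_of_pos hs0])
  refine (measureReal_mono hcover).trans ?_
  refine (measureReal_union_le _ _).trans ?_
  have c1 := measureReal_union_le (μ := P.prod P) (Prod.fst ⁻¹' A c ∪ Prod.fst ⁻¹' A (-c))
    (Prod.snd ⁻¹' A c ∪ Prod.snd ⁻¹' A (-c))
  have c2 := measureReal_union_le (μ := P.prod P) (Prod.fst ⁻¹' A c) (Prod.fst ⁻¹' A (-c))
  have c3 := measureReal_union_le (μ := P.prod P) (Prod.snd ⁻¹' A c) (Prod.snd ⁻¹' A (-c))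
  have c4 := measureReal_union_le (μ := P.prod P) (Q s) (Q (-s))
  rw [hfst _ (hAm _), hfst _ (hAm _)] at c2
  rw [hsnd _ (hAm _), hsnd _ (hAm _)] at c3
  linarith

end Bilinear

/-! ### Independent samples -/

section Samples

variable {Ω : Type*} [MeasurableSpace Ω] {μ : Measure Ω} [IsProbabilityMeasure μ]

/-- A subfamily of an independent sample is an independent sample. -/
theorem measurePreserving_comp_injective {ι κ : Type*} [Fintype ι] [Fintype κ] {g : κ → ι}
    (hg : Function.Injective g) :
    MeasurePreserving (fun (x : ι → Ω) (k : κ) => x (g k)) (Measure.pi fun _ => μ)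
      (Measure.pi fun _ => μ) := by
  refine ⟨by fun_prop, ?_⟩
  have h1 : iIndepFun (fun (i : ι) (x : ι → Ω) => x i) (Measure.pi fun _ => μ) :=
    iIndepFun_pi (X := fun _ x => x) fun _ => aemeasurable_id
  have h2 := h1.precomp hg
  rw [iIndepFun_iff_map_fun_eq_pi_map (fun i => (measurable_pi_apply (g i)).aemeasurable)] at h2
  rw [h2]
  congr 1
  ext1 k
  exact (measurePreserving_eval (fun _ : ι => μ) (g k)).map_eq

theorem measurePreserving_sum {ι κ : Type*} [Fintype ι] [Fintype κ] :
    MeasurePreserving (fun x : ι ⊕ κ → Ω => (fun i => x (.inl i), fun k => x (.inr k)))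
      (Measure.pi fun _ => μ) ((Measure.pi fun _ => μ).prod (Measure.pi fun _ => μ)) :=
  measurePreserving_sumPiEquivProdPi fun _ => μ

/-- An event which has small probability conditionally on the first sample has small
probability. -/
theorem measureReal_pi_sum_le {ι κ : Type*} [Fintype ι] [Fintype κ]
    {S : Set ((ι → Ω) × (κ → Ω))} (hS : MeasurableSet S) {δ : ℝ} (hδ : 0 ≤ δ)
    (h : ∀ u, (Measure.pi fun _ : κ => μ).real {y | (u, y) ∈ S} ≤ δ) :
    (Measure.pi fun _ : ι ⊕ κ => μ).real
      {x | ((fun i => x (.inl i), fun k => x (.inr k)) : (ι → Ω) × (κ → Ω)) ∈ S} ≤ δ := by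
  have h1 := measurePreserving_sum (μ := μ) (ι := ι) (κ := κ)
  refine (h1.measureReal_preimage hS.nullMeasurableSet).le.trans ?_
  refine ENNReal.toReal_le_of_le_ofReal hδ ?_
  rw [Measure.prod_apply hS]
  calc _ ≤ ∫⁻ _ : ι → Ω, ENNReal.ofReal δ ∂(Measure.pi fun _ : ι => μ) := by
        refine lintegral_mono fun u => ?_
        exact (ENNReal.le_ofReal_iff_toReal_le (measure_ne_top _ _) hδ).2 (h u)
    _ = _ := by simp

/-- Hoeffding's inequality for the average of a function with values in an interval. -/
theorem measureReal_average_sub_ge_le {Y : Ω → ℝ} (hY : Measurable Y) {a b : ℝ}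
    (hab : ∀ x, Y x ∈ Icc a b) {m : ℕ} (hm : 0 < m) {e : ℝ} (he : 0 ≤ e) :
    (Measure.pi fun _ : Fin m => μ).real
        {x | e ≤ (1 / (m : ℝ)) * ∑ i, Y (x i) - ∫ y, Y y ∂μ} ≤
      exp (-(2 * m * e ^ 2 / (b - a) ^ 2)) := by
  have hm0 : (m : ℝ) ≠ 0 := by exact_mod_cast hm.ne'
  have h1 := hasSubgaussianMGF_average
    (hasSubgaussianMGF_of_mem_Icc (μ := μ) hY.aemeasurable (.of_forall hab)) hm
  have h2 := h1.measure_ge_le he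
  have h3 : ∀ x : Fin m → Ω, (1 / (m : ℝ)) * ∑ i, (Y (x i) - ∫ y, Y y ∂μ) =
      (1 / (m : ℝ)) * ∑ i, Y (x i) - ∫ y, Y y ∂μ := by
    intro x
    rw [Finset.sum_sub_distrib, mul_sub]
    simp
    field_simp
  simp_rw [h3] at h2
  refine h2.trans_eq ?_
  congr 1
  push_cast
  rw [norm_eq_abs, div_pow, sq_abs]
  field_simp

theorem ipSize_pos {L : ℝ} (hL : 0 < L) {n : ℕ} (hn : 0 < n) {e δ : ℝ} (he : 0 < e) (hδ : 0 < δ)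
    (hδ1 : δ ≤ 1 / 2) : 0 < ipSize L n e δ := by
  have h1 : 0 < log (1 / δ) := log_pos (by rw [lt_div_iff₀ hδ]; linarith)
  have h2 : 0 < √(n : ℝ) := sqrt_pos.2 (by exact_mod_cast hn)
  exact Nat.ceil_pos.2 (by positivity)

section IP

variable {V : Type*} [NormedAddCommGroup V] [InnerProductSpace ℝ V]

theorem estimateIP_eq_inner_average {m : ℕ} {Z : Type*} (ψ : Z → V × ℝ) (x y : Fin m → Z) :
    estimateIP (fun i => ψ (x i)) (fun j => ψ (y j)) =
      inner ℝ (average (fun z => (ψ z).2 • (ψ z).1) x)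
        (average (fun z => (ψ z).2 • (ψ z).1) y) := by
  simp only [estimateIP, average, inner_smul_left, inner_smul_right, sum_inner, inner_sum,
    conj_trivial]
  simp only [Finset.mul_sum]
  rw [Finset.sum_comm]
  refine Finset.sum_congr rfl fun i _ => Finset.sum_congr rfl fun j _ => ?_
  ring

/-- With the sample size of the algorithm, the bilinear estimator is accurate up to `e` with
probability at least `1 - δ`, if the labelled points are sub-Gaussian in every direction and the
dimension is at most `n`. -/
theorem measureReal_estimateIP_le [MeasurableSpace V] [BorelSpace V] [FiniteDimensional ℝ V]
    {n : ℕ} (hd : 0 < Module.finrank ℝ V) (hdn : Module.finrank ℝ V ≤ n)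
    {ψ : Ω → V × ℝ} (hψ : Measurable ψ) {c : V}
    (h : ∀ v, HasSubgaussianMGF (fun x => inner ℝ v ((ψ x).2 • (ψ x).1 - c)) (3 * ‖v‖₊ ^ 2) μ)
    (hc : ‖c‖ ≤ 2) {e δ : ℝ} (he : 0 < e) (he1 : e ≤ 1) (hδ : 0 < δ) (hδ1 : δ ≤ 1 / 2) :
    (Measure.pi fun _ : Fin (ipSize 864 n e δ) ⊕ Fin (ipSize 864 n e δ) => μ).real
        {x | e < |estimateIP (fun i => ψ (x (.inl i))) (fun j => ψ (x (.inr j))) - ‖c‖ ^ 2|} ≤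
      δ := by
  set m := ipSize 864 n e δ with hm
  have hm0 : 0 < m := ipSize_pos (by norm_num) (by omega) he hδ hδ1
  have hΦ : Measurable fun z => (ψ z).2 • (ψ z).1 := by fun_prop
  have hma := measurable_average (m := m) hΦ
  have h1 := measureReal_inner_average_le hm0 hd hΦ h hc he
  have h2 := (measurePreserving_sum (μ := μ) (ι := Fin m) (κ := Fin m)).measureReal_preimage
    (s := {p | e < |inner ℝ (average (fun z => (ψ z).2 • (ψ z).1) p.1)
      (average (fun z => (ψ z).2 • (ψ z).1) p.2) - ‖c‖ ^ 2|})
    (measurableSet_lt (by fun_prop) (by fun_prop)).nullMeasurableSet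
  rw [← h2] at h1
  have h3 : {x : Fin m ⊕ Fin m → Ω | e < |estimateIP (fun i => ψ (x (.inl i)))
      (fun j => ψ (x (.inr j))) - ‖c‖ ^ 2|} = (fun x : Fin m ⊕ Fin m → Ω =>
        (fun i => x (.inl i), fun k => x (.inr k))) ⁻¹'
      {p | e < |inner ℝ (average (fun z => (ψ z).2 • (ψ z).1) p.1)
        (average (fun z => (ψ z).2 • (ψ z).1) p.2) - ‖c‖ ^ 2|} := by
    ext x
    simp only [mem_ofPred_eq, mem_preimage]
    rw [estimateIP_eq_inner_average ψ (fun i => x (.inl i)) (fun j => x (.inr j))]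
  rw [h3]
  refine h1.trans ?_
  -- both exponents are at least `4 log (1 / δ)`
  set l := log (1 / δ) with hl
  have hl0 : 0 < l := log_pos (by rw [lt_div_iff₀ hδ]; linarith)
  have hn1 : (1 : ℝ) ≤ √n := by
    rw [← sqrt_one]; exact sqrt_le_sqrt (by exact_mod_cast (by omega : 1 ≤ n))
  have hdn' : √(Module.finrank ℝ V) ≤ √(n : ℝ) := sqrt_le_sqrt (by exact_mod_cast hdn)
  have hd0 : 0 < √(Module.finrank ℝ V : ℝ) := sqrt_pos.2 (by exact_mod_cast hd)
  have hmle : 864 * (√n / e ^ 2) * l ≤ m := Nat.le_ceil _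
  have hme : 864 * √n * l ≤ m * e ^ 2 := by
    calc 864 * √n * l = 864 * (√n / e ^ 2) * l * e ^ 2 := by field_simp
      _ ≤ m * e ^ 2 := by gcongr
  have e1 : 4 * l ≤ m * e ^ 2 / 216 := by
    rw [le_div_iff₀ (by norm_num)]
    have : 864 * 1 * l ≤ 864 * √n * l := by gcongr
    linarith
  have e2 : 4 * l ≤ m * e / (12 * √(Module.finrank ℝ V)) := by
    rw [le_div_iff₀ (by positivity)]
    have h4 : (m : ℝ) * e ^ 2 ≤ m * e := by
      gcongr
      exact pow_le_of_le_one he.le he1 two_ne_zero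
    have h5 : √(Module.finrank ℝ V) * l ≤ √n * l := by gcongr
    have h6 : 0 ≤ √(n : ℝ) * l := by positivity
    linarith
  have h7 : exp (-(4 * l)) = δ ^ 4 := by
    rw [hl, one_div, log_inv, mul_neg, neg_neg]
    rw [show 4 * log δ = (4 : ℕ) * log δ by norm_num, exp_nat_mul, exp_log hδ]
  have h8 : 4 * exp (-(m * e ^ 2 / 216)) ≤ 4 * δ ^ 4 := by rw [← h7]; gcongr
  have h9 : 4 * exp (-(m * e / (12 * √(Module.finrank ℝ V)))) ≤ 4 * δ ^ 4 := by rw [← h7]; gcongr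
  have h10 : δ ^ 3 ≤ (1 / 2) ^ 3 := pow_le_pow_left₀ hδ.le hδ1 3
  have h11 : δ ^ 4 ≤ δ * (1 / 2) ^ 3 := by
    calc δ ^ 4 = δ * δ ^ 3 := by ring
      _ ≤ _ := by gcongr
  linarith

end IP

/-- The estimate of the mean of a sign-valued function. -/
theorem measureReal_estimateMean_le {V : Type*} {ψ : Ω → V × ℝ} (hψ : Measurable fun x => (ψ x).2)
    (hs : IsSignValued fun x => (ψ x).2) {e δ : ℝ} (he : 0 < e) (hδ : 0 < δ) (hδ1 : δ ≤ 1) :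
    (Measure.pi fun _ : Fin (meanSize e δ) => μ).real
      {x | e < |estimateMean (fun i => ψ (x i)) - ∫ y, (ψ y).2 ∂μ|} ≤ δ := by
  set m := meanSize e δ with hm
  have hlog : 0 < log (2 / δ) := log_pos (by rw [lt_div_iff₀ hδ]; linarith)
  have hm0 : 0 < m := Nat.ceil_pos.2 (by positivity)
  have hmle : 2 / e ^ 2 * log (2 / δ) ≤ m := Nat.le_ceil _
  have hbound : exp (-(2 * m * e ^ 2 / (1 - -1) ^ 2)) ≤ δ / 2 := by
    have h1 : log (2 / δ) ≤ 2 * m * e ^ 2 / (1 - -1) ^ 2 := by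
      calc log (2 / δ) = 2 / e ^ 2 * log (2 / δ) * e ^ 2 / 2 := by field_simp
        _ ≤ m * e ^ 2 / 2 := by gcongr
        _ = _ := by ring
    calc _ ≤ exp (-log (2 / δ)) := by gcongr
      _ = δ / 2 := by rw [exp_neg, exp_log (by positivity), inv_div]
  have hI : ∀ x, (ψ x).2 ∈ Icc (-1 : ℝ) 1 := fun x => abs_le.1 (hs.abs_eq x).le
  have hI' : ∀ x, -(ψ x).2 ∈ Icc (-1 : ℝ) 1 := fun x =>
    ⟨by linarith [(hI x).2], by linarith [(hI x).1]⟩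
  have h1 := measureReal_average_sub_ge_le (μ := μ) hψ hI hm0 he.le
  have h2 := measureReal_average_sub_ge_le (μ := μ) (Y := fun x => -(ψ x).2) hψ.neg hI' hm0 he.le
  calc _ ≤ (Measure.pi fun _ : Fin m => μ).real
        ({x | e ≤ (1 / (m : ℝ)) * ∑ i, (ψ (x i)).2 - ∫ y, (ψ y).2 ∂μ} ∪
          {x | e ≤ (1 / (m : ℝ)) * ∑ i, -(ψ (x i)).2 - ∫ y, -(ψ y).2 ∂μ}) := by
        refine measureReal_mono fun x hx => ?_
        rw [mem_ofPred_eq, estimateMean, lt_abs] at hx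
        rcases hx with hx | hx
        · exact Or.inl hx.le
        · refine Or.inr ?_
          rw [mem_ofPred_eq, Finset.sum_neg_distrib, integral_neg]
          linarith
    _ ≤ _ := (measureReal_union_le _ _).trans (by linarith)

end Samples

/-! ### The empirical threshold -/

section Threshold

variable {n k : ℕ}

/-- The fraction of the points whose first coordinate is at least `t`. -/
noncomputable def empiricalTail (X : Fin k → EuclideanSpace ℝ (Fin n)) (t : ℝ) : ℝ :=
  ((Finset.univ.filter fun i => t ≤ firstCoord (X i)).card : ℝ) / (k : ℝ)

theorem empiricalThreshold_eq (v : ℝ) (X : Fin k → EuclideanSpace ℝ (Fin n)) :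
    empiricalThreshold v X = sSup {t | (1 - v) / 2 ≤ empiricalTail X t} := rfl

theorem empiricalTail_antitone (X : Fin k → EuclideanSpace ℝ (Fin n)) :
    Antitone (empiricalTail X) := by
  intro s t hst
  unfold empiricalTail
  gcongr with i _

theorem empiricalTail_eq_average (X : Fin k → EuclideanSpace ℝ (Fin n)) (t : ℝ) :
    empiricalTail X t = (1 / (k : ℝ)) * ∑ i, (Ici t).indicator 1 (firstCoord (X i)) := by
  rw [empiricalTail, Finset.card_filter, div_eq_mul_one_div, mul_comm]
  push_cast
  simp [indicator]

theorem measurable_empiricalTail (t : ℝ) :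
    Measurable fun X : Fin k → EuclideanSpace ℝ (Fin n) => empiricalTail X t := by
  simp_rw [empiricalTail_eq_average]
  refine Measurable.const_mul (Finset.measurable_fun_sum _ fun i _ => ?_) _
  exact (measurable_one.indicator measurableSet_Ici).comp
    (measurable_firstCoord.comp (measurable_pi_apply i))

theorem empiricalTail_le_one (X : Fin k → EuclideanSpace ℝ (Fin n)) (t : ℝ) :
    empiricalTail X t ≤ 1 := by
  refine div_le_one_of_le₀ ?_ (Nat.cast_nonneg _)
  exact_mod_cast (Finset.card_filter_le _ _).trans (by simp)

theorem empiricalTail_nonneg (X : Fin k → EuclideanSpace ℝ (Fin n)) (t : ℝ) :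
    0 ≤ empiricalTail X t := by unfold empiricalTail; positivity

theorem exists_empiricalTail_eq_one (hk : 0 < k) (X : Fin k → EuclideanSpace ℝ (Fin n)) :
    ∃ t, empiricalTail X t = 1 := by
  obtain ⟨B, hB⟩ := (Set.finite_range fun i => firstCoord (X i)).bddBelow
  refine ⟨B, ?_⟩
  rw [empiricalTail, Finset.filter_true_of_mem fun i _ => hB (mem_range_self i)]
  have : (k : ℝ) ≠ 0 := by exact_mod_cast hk.ne'
  simp [this]

theorem exists_empiricalTail_eq_zero (X : Fin k → EuclideanSpace ℝ (Fin n)) :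
    ∃ t, empiricalTail X t = 0 := by
  obtain ⟨B, hB⟩ := (Set.finite_range fun i => firstCoord (X i)).bddAbove
  refine ⟨B + 1, ?_⟩
  rw [empiricalTail, Finset.filter_false_of_mem]
  · simp
  · intro i _ h
    have : firstCoord (X i) ≤ B := hB (mem_range_self i)
    linarith

theorem bddAbove_of_lt_one {v : ℝ} (hv : v < 1) (X : Fin k → EuclideanSpace ℝ (Fin n)) :
    BddAbove {t | (1 - v) / 2 ≤ empiricalTail X t} := by
  obtain ⟨B, hB⟩ := exists_empiricalTail_eq_zero X
  refine ⟨B, fun t ht => ?_⟩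
  by_contra! hlt
  have h1 := empiricalTail_antitone X hlt.le
  have h2 : (1 - v) / 2 ≤ empiricalTail X t := ht
  linarith

theorem le_empiricalThreshold {v : ℝ} (hv : v < 1) {X : Fin k → EuclideanSpace ℝ (Fin n)} {t : ℝ}
    (h : (1 - v) / 2 ≤ empiricalTail X t) : t ≤ empiricalThreshold v X :=
  le_csSup (bddAbove_of_lt_one hv X) h

theorem exists_of_lt_empiricalThreshold (hk : 0 < k) {v : ℝ} (hv : -1 ≤ v)
    {X : Fin k → EuclideanSpace ℝ (Fin n)} {s : ℝ} (h : s < empiricalThreshold v X) :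
    ∃ t, s < t ∧ (1 - v) / 2 ≤ empiricalTail X t := by
  obtain ⟨t₀, ht₀⟩ := exists_empiricalTail_eq_one hk X
  obtain ⟨t, ht, hst⟩ := exists_lt_of_lt_csSup
    ⟨t₀, show (1 - v) / 2 ≤ empiricalTail X t₀ by linarith⟩ h
  exact ⟨t, hst, ht⟩

theorem measurable_empiricalThreshold (hk : 0 < k) :
    Measurable fun p : ℝ × (Fin k → EuclideanSpace ℝ (Fin n)) => empiricalThreshold p.1 p.2 := by
  refine measurable_of_Ioi fun a => ?_
  set D : Set (ℝ × (Fin k → EuclideanSpace ℝ (Fin n))) := {p | -1 ≤ p.1 ∧ p.1 < 1} with hD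
  have hDm : MeasurableSet D :=
    (measurableSet_le measurable_const measurable_fst).inter
      (measurableSet_lt measurable_fst measurable_const)
  -- outside of `D` the set whose supremum is taken is empty or all of `ℝ`
  have hdeg : ∀ p ∉ D, empiricalThreshold p.1 p.2 = 0 := by
    intro p hp
    rw [empiricalThreshold_eq]
    rcases lt_or_ge p.1 (-1) with h | h
    · convert! Real.sSup_empty using 2
      refine eq_empty_of_forall_notMem fun t (ht : (1 - p.1) / 2 ≤ _) => ?_
      linarith [empiricalTail_le_one p.2 t]
    · have h1 : 1 ≤ p.1 := not_lt.1 fun h' => hp ⟨h, h'⟩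
      convert! Real.sSup_univ using 2
      refine eq_univ_of_forall fun t => ?_
      have := empiricalTail_nonneg p.2 t
      change (1 - p.1) / 2 ≤ _
      linarith
  have : (fun p : ℝ × (Fin k → EuclideanSpace ℝ (Fin n)) => empiricalThreshold p.1 p.2) ⁻¹' Ioi a =
      (D ∩ ⋃ q : ℚ, {p | a < q ∧ (1 - p.1) / 2 ≤ empiricalTail p.2 q}) ∪
        (Dᶜ ∩ {_p | a < 0}) := by
    ext p
    simp only [mem_preimage, mem_Ioi, mem_union, mem_inter_iff, mem_iUnion, mem_ofPred_eq,
      mem_compl_iff]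
    by_cases hp : p ∈ D
    · simp only [hp, true_and, not_true, false_and, or_false]
      constructor
      · intro h
        obtain ⟨t, hat, ht⟩ := exists_of_lt_empiricalThreshold hk hp.1 h
        obtain ⟨q, hq1, hq2⟩ := exists_rat_btwn hat
        exact ⟨q, hq1, ht.trans (empiricalTail_antitone _ hq2.le)⟩
      · rintro ⟨q, hq1, hq2⟩
        exact hq1.trans_le (le_empiricalThreshold hp.2 hq2)
    · simp [hp, hdeg p hp]
  rw [this]
  refine (hDm.inter (MeasurableSet.iUnion fun q => ?_)).union (hDm.compl.inter (.const _))
  refine (MeasurableSet.const _).inter (measurableSet_le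
    (by fun_prop : Measurable fun p : ℝ × (Fin k → EuclideanSpace ℝ (Fin n)) => (1 - p.1) / 2) ?_)
  exact (measurable_empiricalTail _).comp measurable_snd

/-- The empirical threshold has nearly the prescribed tail. Only one threshold on each side is
relevant, so that no uniform bound over all thresholds is needed. -/
theorem measureReal_empiricalThreshold_le {μ : Measure (EuclideanSpace ℝ (Fin n))}
    [IsProbabilityMeasure μ] {C : ℝ} (ht : IsTame (marginal μ) C) {v : ℝ} (hv : -1 ≤ v)
    (hv1 : v < 1) {e δ : ℝ} (he : 0 < e) (hδ : 0 < δ) (hδ1 : δ ≤ 1) :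
    (Measure.pi fun _ : Fin (thresholdSize e δ) => μ).real
      {X | e / 2 < |upperTail (marginal μ) (empiricalThreshold v X) - (1 - v) / 2|} ≤ δ / 2 := by
  have := IsBoundedRI.isProbabilityMeasure_marginal μ
  set k := thresholdSize e δ with hk
  have hlog : 0 < log (4 / δ) := log_pos (by rw [lt_div_iff₀ hδ]; linarith)
  have hk0 : 0 < k := Nat.ceil_pos.2 (by positivity)
  have hkle : 1 / (2 * (e / 2) ^ 2) * log (4 / δ) ≤ k := Nat.le_ceil _
  have hbound : exp (-(2 * k * (e / 2) ^ 2 / (1 - 0) ^ 2)) ≤ δ / 4 := by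
    have h1 : log (4 / δ) ≤ 2 * k * (e / 2) ^ 2 / (1 - 0) ^ 2 := by
      calc log (4 / δ) = 2 * (1 / (2 * (e / 2) ^ 2) * log (4 / δ)) * (e / 2) ^ 2 := by field_simp
        _ ≤ 2 * k * (e / 2) ^ 2 := by gcongr
        _ = _ := by ring
    calc _ ≤ exp (-log (4 / δ)) := by gcongr
      _ = δ / 4 := by rw [exp_neg, exp_log (by positivity), inv_div]
  have hbound' : exp (-(2 * k * (e / 2) ^ 2 / (0 - -1) ^ 2)) ≤ δ / 4 := by
    simpa using hbound
  set Y : ℝ → EuclideanSpace ℝ (Fin n) → ℝ := fun t x => (Ici t).indicator 1 (firstCoord x) with hY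
  have hYm : ∀ t, Measurable (Y t) := fun t =>
    (measurable_one.indicator measurableSet_Ici).comp measurable_firstCoord
  have hYI : ∀ t x, Y t x ∈ Icc (0 : ℝ) 1 := by
    intro t x
    by_cases h : t ≤ firstCoord x <;> simp [hY, indicator, h]
  have hYI' : ∀ t x, -Y t x ∈ Icc (-1 : ℝ) 0 := fun t x =>
    ⟨by linarith [(hYI t x).2], by linarith [(hYI t x).1]⟩
  have hYint : ∀ t, ∫ x, Y t x ∂μ = upperTail (marginal μ) t := by
    intro t
    rw [upperTail, marginal, map_measureReal_apply measurable_firstCoord measurableSet_Ici,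
      ← integral_indicator_one (measurable_firstCoord measurableSet_Ici)]
    rfl
  have hup : ∀ t, (Measure.pi fun _ : Fin k => μ).real
      {X | e / 2 ≤ empiricalTail X t - upperTail (marginal μ) t} ≤ δ / 4 := by
    intro t
    have h1 := measureReal_average_sub_ge_le (μ := μ) (hYm t) (hYI t) hk0
      (by positivity : 0 ≤ e / 2)
    rw [hYint] at h1
    simp_rw [empiricalTail_eq_average]
    exact h1.trans hbound
  have hdown : ∀ t, (Measure.pi fun _ : Fin k => μ).real
      {X | e / 2 ≤ upperTail (marginal μ) t - empiricalTail X t} ≤ δ / 4 := by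
    intro t
    have h1 := measureReal_average_sub_ge_le (μ := μ) (Y := fun x => -Y t x) (hYm t).neg (hYI' t)
      hk0
      (by positivity : 0 ≤ e / 2)
    simp only [Finset.sum_neg_distrib, integral_neg, hYint] at h1
    refine le_trans (le_of_eq ?_) (h1.trans hbound')
    congr 1
    ext X
    rw [mem_ofPred_eq, mem_ofPred_eq, empiricalTail_eq_average]
    constructor <;> intro h <;> linarith
  have h1 : (Measure.pi fun _ : Fin k => μ).real
      {X | upperTail (marginal μ) (empiricalThreshold v X) < (1 - v) / 2 - e / 2} ≤ δ / 4 := by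
    rcases le_or_gt ((1 - v) / 2 - e / 2) 0 with h0 | h0
    · rw [show {X : Fin k → EuclideanSpace ℝ (Fin n) | upperTail (marginal μ)
        (empiricalThreshold v X) < (1 - v) / 2 - e / 2} = ∅ from
        eq_empty_of_forall_notMem fun X hX => absurd (lt_of_lt_of_le hX h0)
          (not_lt.2 measureReal_nonneg), measureReal_empty]
      positivity
    · obtain ⟨t, htt⟩ := ht.exists_upperTail_eq (p := (1 - v) / 2 - e / 2) ⟨h0.le, by linarith⟩
      refine (measureReal_mono fun X hX => ?_).trans (hup t)
      rw [mem_ofPred_eq, ← htt] at hX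
      have h2 : t < empiricalThreshold v X :=
        not_le.1 fun h => absurd hX (not_lt.2 (IsTame.upperTail_antitone _ h))
      obtain ⟨s, hts, hs⟩ := exists_of_lt_empiricalThreshold hk0 hv h2
      have h3 := empiricalTail_antitone X hts.le
      rw [mem_ofPred_eq, htt]
      linarith
  have h2 : (Measure.pi fun _ : Fin k => μ).real
      {X | (1 - v) / 2 + e / 2 < upperTail (marginal μ) (empiricalThreshold v X)} ≤ δ / 4 := by
    rcases le_or_gt 1 ((1 - v) / 2 + e / 2) with h0 | h0
    · rw [show {X : Fin k → EuclideanSpace ℝ (Fin n) | (1 - v) / 2 + e / 2 < upperTail (marginal μ)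
        (empiricalThreshold v X)} = ∅ from
        eq_empty_of_forall_notMem fun X hX => absurd (lt_of_le_of_lt h0 hX)
          (not_lt.2 measureReal_le_one), measureReal_empty]
      positivity
    · obtain ⟨t, htt⟩ := ht.exists_upperTail_eq (p := (1 - v) / 2 + e / 2) ⟨by linarith, h0.le⟩
      refine (measureReal_mono fun X hX => ?_).trans (hdown t)
      rw [mem_ofPred_eq, ← htt] at hX
      have h2 : empiricalThreshold v X < t :=
        not_le.1 fun h => absurd hX (not_lt.2 (IsTame.upperTail_antitone _ h))
      have h3 : empiricalTail X t < (1 - v) / 2 :=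
        not_le.1 fun h => absurd h2 (not_lt.2 (le_empiricalThreshold hv1 h))
      rw [mem_ofPred_eq, htt]
      linarith
  calc _ ≤ (Measure.pi fun _ : Fin k => μ).real
        ({X | upperTail (marginal μ) (empiricalThreshold v X) < (1 - v) / 2 - e / 2} ∪
          {X | (1 - v) / 2 + e / 2 < upperTail (marginal μ) (empiricalThreshold v X)}) := by
        refine measureReal_mono fun X hX => ?_
        rw [mem_ofPred_eq, lt_abs] at hX
        rcases hX with hX | hX
        · exact Or.inr (by rw [mem_ofPred_eq]; linarith)
        · exact Or.inl (by rw [mem_ofPred_eq]; linarith)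
    _ ≤ _ := (measureReal_union_le _ _).trans (by linarith)

end Threshold

/-! ### Accuracy of all the estimates -/

section Reindex

variable {Ω : Type*} [MeasurableSpace Ω] {μ : Measure Ω} [IsProbabilityMeasure μ]
  {ι κ J : Type*} [Fintype ι] [Fintype κ] [Fintype J]

theorem measureReal_comp_injective_le {g : κ → J} (hg : Function.Injective g)
    {S : Set (κ → Ω)} (hS : MeasurableSet S) {δ : ℝ}
    (h : (Measure.pi fun _ : κ => μ).real S ≤ δ) :
    (Measure.pi fun _ : J => μ).real {x | (fun k => x (g k)) ∈ S} ≤ δ :=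
  ((measurePreserving_comp_injective (μ := μ) hg).measureReal_preimage
    hS.nullMeasurableSet).le.trans h

/-- The conditional form of `measureReal_comp_injective_le`: the event concerns two disjoint parts
of the sample, and is unlikely for every value of the first part. -/
theorem measureReal_comp_sumElim_le {g : ι → J} {h : κ → J}
    (hgh : Function.Injective (Sum.elim g h)) {S : Set ((ι → Ω) × (κ → Ω))} (hS : MeasurableSet S)
    {δ : ℝ} (hδ : 0 ≤ δ) (hu : ∀ u, (Measure.pi fun _ : κ => μ).real {y | (u, y) ∈ S} ≤ δ) :
    (Measure.pi fun _ : J => μ).real {x | (fun i => x (g i), fun k => x (h k)) ∈ S} ≤ δ :=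
  measureReal_comp_injective_le (S := {x : ι ⊕ κ → Ω |
    ((fun i => x (.inl i), fun k => x (.inr k)) : (ι → Ω) × (κ → Ω)) ∈ S}) hgh
    ((measurePreserving_sum (μ := μ)).measurable hS) (measureReal_pi_sum_le hS hδ hu)

end Reindex

section Measurability

variable {n : ℕ} {α : Type*} [MeasurableSpace α]

theorem measurable_estimateMean {V : Type*} {m : ℕ} {S : α → Fin m → V × ℝ}
    (hS : ∀ i, Measurable fun a => (S a i).2) : Measurable fun a => estimateMean (S a) := by
  unfold estimateMean
  exact (Finset.measurable_fun_sum _ fun i _ => hS i).const_mul _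

theorem measurable_estimateIP {V : Type*} [NormedAddCommGroup V] [InnerProductSpace ℝ V]
    [FiniteDimensional ℝ V] [MeasurableSpace V] [BorelSpace V] {m : ℕ} {S T : α → Fin m → V × ℝ}
    (hS : ∀ i, Measurable fun a => S a i) (hT : ∀ i, Measurable fun a => T a i) :
    Measurable fun a => estimateIP (S a) (T a) := by
  unfold estimateIP
  refine (Finset.measurable_fun_sum _ fun i _ => Finset.measurable_fun_sum _ fun j _ =>
    ?_).const_mul _
  exact ((hS i).snd.mul (hT j).snd).mul ((hS i).fst.inner (hT j).fst)

theorem measurable_projectedExample {t : α → ℝ} {x : α → EuclideanSpace ℝ (Fin n)}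
    (ht : Measurable t) (hx : Measurable x) :
    Measurable fun a => projectedExample (t a) (x a) :=
  (measurable_firstCoord.comp hx).prodMk
    (measurable_sgn.comp ((measurable_firstCoord.comp hx).sub ht))

theorem measurable_thresholdMoment (ν : Measure ℝ) [SFinite ν] :
    Measurable (thresholdMoment ν) := by
  have h : Measurable fun p : ℝ × ℝ => sgn (p.2 - p.1) * p.2 :=
    (measurable_sgn.comp (measurable_snd.sub measurable_fst)).mul measurable_snd
  exact h.stronglyMeasurable.integral_prod_right.measurable

end Measurability

variable {n : ℕ} {μ : Measure (EuclideanSpace ℝ (Fin n))} [IsProbabilityMeasure μ] {C : ℝ}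
  {f : EuclideanSpace ℝ (Fin n) → ℝ}

theorem IsBoundedRI.hasSubgaussianMGF_inner_sub_center (hn : 3 ≤ n) (hμ : IsBoundedRI μ √n C)
    (hf : IsSignValued f) (hfm : Measurable f) (v : EuclideanSpace ℝ (Fin n)) :
    HasSubgaussianMGF (fun x => inner ℝ v (f x • x - center μ f)) (3 * ‖v‖₊ ^ 2) μ := by
  have : Nonempty (Fin n) := ⟨⟨0, by omega⟩⟩
  obtain ⟨w, hw, hv, -⟩ := exists_unit_inner_eq_norm v
  have h1 := hasSubgaussianMGF_sub_integral_of_abs_eq (X := fun x => f x * inner ℝ w x)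
    (hμ.subgaussian_inner hn hw) (hfm.mul (by fun_prop))
    (fun x => by rw [abs_mul, hf.abs_eq, one_mul])
  rw [← hμ.inner_center hf hfm] at h1
  have h2 := h1.const_mul ‖v‖
  refine hasSubgaussianMGF_mono (h2.congr (.of_forall fun x => ?_)) (le_of_eq ?_)
  · dsimp only
    conv_rhs => rw [hv]
    rw [inner_smul_left, inner_sub_right, inner_smul_right]
    rfl
  · ext
    push_cast
    change ‖v‖ ^ 2 * (2 * (3 / 2)) = 3 * ‖v‖ ^ 2
    ring

theorem IsBoundedRI.hasSubgaussianMGF_projectedExample_sub (hn : 3 ≤ n) (hμ : IsBoundedRI μ √n C)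
    (t v : ℝ) :
    HasSubgaussianMGF (fun x : EuclideanSpace ℝ (Fin n) => inner ℝ v ((projectedExample t x).2 •
      (projectedExample t x).1 - thresholdMoment (marginal μ) t)) (3 * ‖v‖₊ ^ 2) μ := by
  have h0 : HasSubgaussianMGF (firstCoord : EuclideanSpace ℝ (Fin n) → ℝ) (3 / 2) μ :=
    (HasSubgaussianMGF.id_map_iff measurable_firstCoord.aemeasurable).1
      (hμ.isTame_marginal hn).subgaussian
  have hm : Measurable fun z : ℝ => sgn (z - t) * z :=
    (measurable_sgn.comp (by fun_prop)).mul measurable_id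
  have h1 := hasSubgaussianMGF_sub_integral_of_abs_eq
    (X := fun x : EuclideanSpace ℝ (Fin n) => sgn (firstCoord x - t) * firstCoord x) h0
    (hm.comp measurable_firstCoord) (fun x => by rw [abs_mul, abs_sgn, one_mul])
  have h2 : ∫ x : EuclideanSpace ℝ (Fin n), sgn (firstCoord x - t) * firstCoord x ∂μ =
      thresholdMoment (marginal μ) t := by
    rw [thresholdMoment, marginal, integral_map measurable_firstCoord.aemeasurable
      hm.aestronglyMeasurable]
  rw [h2] at h1
  refine hasSubgaussianMGF_mono ((h1.const_mul v).congr (.of_forall fun x => ?_)) (le_of_eq ?_)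
  · simp [projectedExample, mul_comm]
  · ext
    push_cast
    change v ^ 2 * (2 * (3 / 2)) = 3 * ‖v‖ ^ 2
    rw [norm_eq_abs, sq_abs]
    ring

theorem IsBoundedRI.abs_thresholdMoment_le (hn : 3 ≤ n) (hμ : IsBoundedRI μ √n C) (t : ℝ) :
    |thresholdMoment (marginal μ) t| ≤ 2 := by
  have : Nonempty (Fin n) := ⟨⟨0, by omega⟩⟩
  obtain ⟨w, hw⟩ := exists_norm_eq (EuclideanSpace ℝ (Fin n)) zero_le_one
  have h := hμ.norm_center_le hn (isSignValued_halfspace (w := w) (t := t)) measurable_halfspace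
  rwa [hμ.center_halfspace hn hw, norm_smul, hw, mul_one] at h

/-- The estimates that the tester computes from the points `x` are accurate: the mean and the
squared norm of the center of mass up to `e`, the tail of the empirical threshold (relative to the
estimated mean) and the squared norm for this threshold up to `e / 2`. -/
def IsAccurate (μ : Measure (EuclideanSpace ℝ (Fin n))) (f : EuclideanSpace ℝ (Fin n) → ℝ) (e : ℝ)
    {a b k d : ℕ}
    (x : Fin a ⊕ (Fin b ⊕ Fin b) ⊕ Fin k ⊕ (Fin d ⊕ Fin d) → EuclideanSpace ℝ (Fin n)) : Prop :=
  let v : ℝ := estimateMean fun i => (x (.inl i), f (x (.inl i)))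
  let t : ℝ := empiricalThreshold v fun i => x (.inr (.inr (.inl i)))
  |v - ∫ y, f y ∂μ| ≤ e ∧
  |estimateIP (fun i => (x (.inr (.inl (.inl i))), f (x (.inr (.inl (.inl i))))))
    (fun i => (x (.inr (.inl (.inr i))), f (x (.inr (.inl (.inr i)))))) - ‖center μ f‖ ^ 2| ≤ e ∧
  (|v| < 1 → |upperTail (marginal μ) t - (1 - v) / 2| ≤ e / 2) ∧
  |estimateHalfspaceNorm v (fun i => x (.inr (.inr (.inl i))))
    (fun i => x (.inr (.inr (.inr (.inl i))))) (fun i => x (.inr (.inr (.inr (.inr i))))) -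
      thresholdMoment (marginal μ) t ^ 2| ≤ e / 2

/-- With the sample sizes of the tester, all its estimates are accurate with probability at least
`1 - δ`. The last two estimates are treated conditionally on the samples that they depend on. -/
theorem IsBoundedRI.measureReal_not_isAccurate_le (hn : 3 ≤ n) (hμ : IsBoundedRI μ √n C)
    (hf : IsSignValued f) (hfm : Measurable f) {e δ : ℝ} (he : 0 < e) (he1 : e ≤ 1) (hδ : 0 < δ)
    (hδ1 : δ ≤ 1 / 2) :
    (Measure.pi fun _ : Fin (meanSize e (δ / 3)) ⊕
      (Fin (ipSize 864 n e (δ / 3)) ⊕ Fin (ipSize 864 n e (δ / 3))) ⊕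
      Fin (thresholdSize e (δ / 3)) ⊕
      (Fin (ipSize 864 n (e / 2) (δ / 3 / 2)) ⊕ Fin (ipSize 864 n (e / 2) (δ / 3 / 2))) => μ).real
        {x | ¬ IsAccurate μ f e x} ≤ δ := by
  have := isProbabilityMeasure_marginal μ
  have ht := hμ.isTame_marginal hn
  set a := meanSize e (δ / 3)
  set b := ipSize 864 n e (δ / 3)
  set k := thresholdSize e (δ / 3) with hk
  set d := ipSize 864 n (e / 2) (δ / 3 / 2)
  have hk0 : 0 < k := by
    have : 0 < log (4 / (δ / 3)) := log_pos (by rw [lt_div_iff₀ (by positivity)]; linarith)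
    exact Nat.ceil_pos.2 (by positivity)
  set P := (Measure.pi fun _ : Fin a ⊕ (Fin b ⊕ Fin b) ⊕ Fin k ⊕ (Fin d ⊕ Fin d) => μ)
  have hfin : Module.finrank ℝ (EuclideanSpace ℝ (Fin n)) = n := finrank_euclideanSpace_fin
  set ψ : EuclideanSpace ℝ (Fin n) → EuclideanSpace ℝ (Fin n) × ℝ := fun x => (x, f x) with hψ
  have hψm : Measurable ψ := measurable_id.prodMk hfm
  set V : (Fin a → EuclideanSpace ℝ (Fin n)) → ℝ := fun u => estimateMean fun i => ψ (u i) with hV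
  have hVm : Measurable V := measurable_estimateMean fun i => hψm.snd.comp (measurable_pi_apply i)
  have hTm : Measurable (upperTail (marginal μ)) := ht.continuous_upperTail.measurable
  have hPm := measurable_thresholdMoment (marginal μ)
  have hθm := measurable_empiricalThreshold (n := n) hk0
  -- the mean of the labels
  have h1 : P.real {x | (fun i => x (.inl i)) ∈
      {u : Fin a → EuclideanSpace ℝ (Fin n) | e < |V u - ∫ y, f y ∂μ|}} ≤ δ / 3 :=
    measureReal_comp_injective_le (g := Sum.inl) Sum.inl_injective
      (measurableSet_lt measurable_const (hVm.sub_const _).abs)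
      (measureReal_estimateMean_le (ψ := ψ) hfm hf he (by positivity) (by linarith))
  -- the norm of the center of mass
  have h2 : P.real {x | (fun i => x (.inr (.inl i))) ∈
      {u : Fin b ⊕ Fin b → EuclideanSpace ℝ (Fin n) |
        e < |estimateIP (fun i => ψ (u (.inl i))) (fun i => ψ (u (.inr i))) - ‖center μ f‖ ^ 2|}} ≤
      δ / 3 :=
    measureReal_comp_injective_le (g := fun i => Sum.inr (Sum.inl i))
      (Sum.inr_injective.comp Sum.inl_injective)
      (measurableSet_lt measurable_const ((measurable_estimateIP
        (fun i => hψm.comp (measurable_pi_apply (Sum.inl i)))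
        (fun i => hψm.comp (measurable_pi_apply (Sum.inr i)))).sub_const _).abs)
      (measureReal_estimateIP_le (by omega) hfin.le hψm
        (hμ.hasSubgaussianMGF_inner_sub_center hn hf hfm) (hμ.norm_center_le hn hf hfm) he he1
        (by positivity) (by linarith))
  -- the threshold, for every value of the estimated mean
  have h3 : P.real {x | ((fun i => x (.inl i), fun i => x (.inr (.inr (.inl i)))) :
      (Fin a → EuclideanSpace ℝ (Fin n)) × (Fin k → EuclideanSpace ℝ (Fin n))) ∈
      {p : (Fin a → EuclideanSpace ℝ (Fin n)) × (Fin k → EuclideanSpace ℝ (Fin n)) | |V p.1| < 1 ∧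
        e / 2 < |upperTail (marginal μ) (empiricalThreshold (V p.1) p.2) - (1 - V p.1) / 2|}} ≤
      δ / 3 / 2 := by
    refine measureReal_comp_sumElim_le (g := Sum.inl) (h := fun i => Sum.inr (Sum.inr (Sum.inl i)))
      ?_ ?_ (by positivity) fun u => ?_
    · rintro (i | i) (j | j) h <;> simp_all
    · have hv : Measurable fun p : (Fin a → EuclideanSpace ℝ (Fin n)) ×
          (Fin k → EuclideanSpace ℝ (Fin n)) => V p.1 := hVm.comp measurable_fst
      exact (measurableSet_lt hv.abs measurable_const).inter (measurableSet_lt measurable_const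
        ((hTm.comp (hθm.comp (hv.prodMk measurable_snd))).sub
          ((measurable_const.sub hv).div_const 2)).abs)
    · by_cases hu : |V u| < 1
      · have hu' := abs_lt.1 hu
        refine (measureReal_mono fun y hy => ?_).trans
          (measureReal_empiricalThreshold_le ht hu'.1.le hu'.2 he (by positivity) (by linarith))
        exact hy.2
      · rw [show {y : Fin k → EuclideanSpace ℝ (Fin n) | (u, y) ∈
          {p : (Fin a → EuclideanSpace ℝ (Fin n)) × (Fin k → EuclideanSpace ℝ (Fin n)) |
            |V p.1| < 1 ∧ e / 2 < |upperTail (marginal μ) (empiricalThreshold (V p.1) p.2) -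
              (1 - V p.1) / 2|}} = ∅ from eq_empty_of_forall_notMem fun y hy => hu hy.1,
          measureReal_empty]
        positivity
  -- the norm of the projected halfspace, for every value of the threshold
  set θ : (Fin a ⊕ Fin k → EuclideanSpace ℝ (Fin n)) → ℝ := fun u =>
    empiricalThreshold (V fun i => u (.inl i)) (fun i => u (.inr i)) with hθ
  have hθm' : Measurable θ := hθm.comp ((hVm.comp (by fun_prop)).prodMk (by fun_prop))
  have h4 : P.real {x | ((fun i => x (Sum.elim Sum.inl (fun i => .inr (.inr (.inl i))) i),
      fun i => x (.inr (.inr (.inr i)))) :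
      (Fin a ⊕ Fin k → EuclideanSpace ℝ (Fin n)) × (Fin d ⊕ Fin d → EuclideanSpace ℝ (Fin n))) ∈
      {p : (Fin a ⊕ Fin k → EuclideanSpace ℝ (Fin n)) × (Fin d ⊕ Fin d → EuclideanSpace ℝ (Fin n)) |
        e / 2 < |estimateIP (fun i => projectedExample (θ p.1) (p.2 (.inl i)))
          (fun i => projectedExample (θ p.1) (p.2 (.inr i))) -
            thresholdMoment (marginal μ) (θ p.1) ^ 2|}} ≤ δ / 3 / 2 := by
    refine measureReal_comp_sumElim_le (J := Fin a ⊕ (Fin b ⊕ Fin b) ⊕ Fin k ⊕ (Fin d ⊕ Fin d))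
      (g := Sum.elim Sum.inl (fun i => .inr (.inr (.inl i))))
      (h := fun i => Sum.inr (Sum.inr (Sum.inr i))) ?_ ?_ (by positivity) fun u => ?_
    · rintro ((i | i) | i) ((j | j) | j) h <;> simp_all
    · have hθ' : Measurable fun p : (Fin a ⊕ Fin k → EuclideanSpace ℝ (Fin n)) ×
          (Fin d ⊕ Fin d → EuclideanSpace ℝ (Fin n)) => θ p.1 := hθm'.comp measurable_fst
      exact measurableSet_lt measurable_const ((measurable_estimateIP
        (fun i => measurable_projectedExample hθ' (by fun_prop))
        (fun i => measurable_projectedExample hθ' (by fun_prop))).sub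
          ((hPm.comp hθ').pow_const 2)).abs
    · have h := measureReal_estimateIP_le (V := ℝ) (n := n) (μ := μ) (by simp) (by simp; omega)
        (measurable_projectedExample measurable_const measurable_id)
        (hμ.hasSubgaussianMGF_projectedExample_sub hn (θ u)) (hμ.abs_thresholdMoment_le hn (θ u))
        (e := e / 2) (δ := δ / 3 / 2) (by positivity) (by linarith) (by positivity) (by linarith)
      simp only [norm_eq_abs, sq_abs] at h
      exact h
  calc _ ≤ P.real ((_ ∪ _) ∪ (_ ∪ _)) := by
        refine measureReal_mono fun x hx => ?_
        by_contra hx'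
        simp only [mem_union, not_or] at hx'
        refine hx ⟨not_lt.1 hx'.1.1, not_lt.1 hx'.1.2, fun hv => ?_, not_lt.1 hx'.2.2⟩
        exact not_lt.1 fun h => hx'.2.1 ⟨hv, h⟩
    _ ≤ δ / 3 + δ / 3 + (δ / 3 / 2 + δ / 3 / 2) :=
      (measureReal_union_le _ _).trans (add_le_add
        ((measureReal_union_le _ _).trans (add_le_add h1 h2))
        ((measureReal_union_le _ _).trans (add_le_add h3 h4)))
    _ = δ := by ring

/-- An event that contains the accurate samples has probability at least `1 - δ`, whether or not it
is measurable. -/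
theorem IsBoundedRI.le_exampleProb (hn : 3 ≤ n) (hμ : IsBoundedRI μ √n C)
    (hf : IsSignValued f) (hfm : Measurable f) {K₁ ε δ : ℝ} (he : 0 < K₁ * C ^ 2 * ε ^ 3)
    (he1 : K₁ * C ^ 2 * ε ^ 3 ≤ 1) (hδ : 0 < δ) (hδ1 : δ ≤ 1 / 2)
    {A : (ExampleIndex 864 K₁ C n ε δ → EuclideanSpace ℝ (Fin n) × ℝ) → Prop}
    (hA : ∀ x : ExampleIndex 864 K₁ C n ε δ → EuclideanSpace ℝ (Fin n),
      IsAccurate μ f (K₁ * C ^ 2 * ε ^ 3) x → A fun i => (x i, f (x i))) :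
    1 - δ ≤ exampleProb μ f A := by
  have h1 := hμ.measureReal_not_isAccurate_le hn hf hfm he he1 hδ hδ1
  have h2 : (1 : ℝ) ≤ (Measure.pi fun _ : ExampleIndex 864 K₁ C n ε δ => μ).real
      ({x | A fun i => (x i, f (x i))} ∪ {x | ¬ IsAccurate μ f (K₁ * C ^ 2 * ε ^ 3) x}) := by
    rw [← probReal_univ (μ := Measure.pi fun _ : ExampleIndex 864 K₁ C n ε δ => μ)]
    refine measureReal_mono fun x _ => ?_
    by_cases hx : IsAccurate μ f (K₁ * C ^ 2 * ε ^ 3) x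
    · exact Or.inl (hA x hx)
    · exact Or.inr hx
  have h3 := h2.trans (measureReal_union_le _ _)
  unfold exampleProb
  linarith

/-- For accurate estimates, the estimated norm of the halfspace is close to that of every halfspace
whose mean is close to the mean of `f`. -/
theorem IsAccurate.abs_estimateHalfspaceNorm_sub_le (ht : IsTame (marginal μ) C) {e : ℝ}
    {a b k d : ℕ}
    {x : Fin a ⊕ (Fin b ⊕ Fin b) ⊕ Fin k ⊕ (Fin d ⊕ Fin d) → EuclideanSpace ℝ (Fin n)}
    (hx : IsAccurate μ f e x)
    (hv : |estimateMean fun i => (x (.inl i), f (x (.inl i)))| < 1) {t τ : ℝ}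
    (h : |upperTail (marginal μ) t - (1 + ∫ y, f y ∂μ) / 2| ≤ τ) :
    |estimateHalfspaceNorm (estimateMean fun i => (x (.inl i), f (x (.inl i))))
      (fun i => x (.inr (.inr (.inl i)))) (fun i => x (.inr (.inr (.inr (.inl i)))))
      (fun i => x (.inr (.inr (.inr (.inr i))))) - thresholdMoment (marginal μ) t ^ 2| ≤
      e / 2 + 36 * (e + τ) := by
  have := IsBoundedRI.isProbabilityMeasure_marginal μ
  obtain ⟨h1, -, h3, h4⟩ := hx
  have h3 := h3 hv
  set v := estimateMean fun i => (x (.inl i), f (x (.inl i)))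
  set θ := empiricalThreshold v fun i => x (.inr (.inr (.inl i)))
  -- the tester's threshold has tail `(1 - v) / 2`, so it approximates `-t`
  have h5 := ht.abs_thresholdMoment_sq_sub_le θ (-t)
  rw [ht.thresholdMoment_neg, ht.upperTail_neg] at h5
  have h6 : |upperTail (marginal μ) θ - (1 - upperTail (marginal μ) t)| ≤ e + τ := by
    rw [abs_le] at *
    constructor <;> linarith
  have h7 := abs_le.1 (h5.trans (mul_le_mul_of_nonneg_left h6 (by norm_num)))
  rw [abs_le] at h4 ⊢
  constructor <;> linarith [h4.1, h4.2, h7.1, h7.2]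

/-! ### Soundness and completeness of the tester -/

/-- Acceptance on accurate estimates yields the halfspace. -/
theorem IsBoundedRI.soundness (hn : 3 ≤ n) (hμ : IsBoundedRI μ √n C)
    (hf : IsSignValued f) (hfm : Measurable f) {ε δ : ℝ} (hε : 0 < ε) (hε1 : ε ≤ 1 / 2)
    {x : ExampleIndex 864 (1 / 2000) C n ε δ → EuclideanSpace ℝ (Fin n)}
    (hx : IsAccurate μ f (1 / 2000 * C ^ 2 * ε ^ 3) x)
    (hacc : SimpleTesterAccepts 864 (1 / 2000) (1 / 16) C ε δ fun i => (x i, f (x i))) :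
    ∃ h, IsHalfspace h ∧ (center μ f ≠ 0 → Aligned μ f h) ∧
      ∫ y, h y ∂μ = ∫ y, f y ∂μ ∧ fdist μ f h ≤ ε := by
  have ht := hμ.isTame_marginal hn
  obtain ⟨t, h, htail, hh, hal, hmean, hdist⟩ := hμ.exists_halfspace hn hf hfm
  refine ⟨h, hh, hal, hmean, hdist ε hε hε1 ?_⟩
  have hC2 : C ^ 2 ≤ 1 := pow_le_one₀ hμ.2.2.1.le hμ.2.2.2.1
  have hC0 : 0 < C ^ 2 := pow_pos hμ.2.2.1 2
  have hε2 : ε ^ 3 ≤ ε := pow_le_of_le_one hε.le (by linarith) three_ne_zero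
  have hCε : C ^ 2 * ε ^ 3 ≤ ε := by
    calc C ^ 2 * ε ^ 3 ≤ 1 * ε := by gcongr
      _ = ε := one_mul _
  have hCε0 : 0 < C ^ 2 * ε ^ 3 := by positivity
  have key := fun hv => hx.abs_estimateHalfspaceNorm_sub_le ht hv (t := t) (τ := 0)
    (by rw [htail]; simp)
  obtain ⟨h1, h2, -, -⟩ := hx
  simp only [SimpleTesterAccepts] at hacc
  set v := estimateMean fun i => (x (.inl i), f (x (.inl i)))
  by_cases hv : 1 - ε / 2 ≤ |v|
  · right
    have := abs_sub_abs_le_abs_sub v (∫ y, f y ∂μ)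
    linarith
  · left
    have key := abs_le.1 (key (by linarith))
    have h2 := abs_le.1 h2
    have hacc := hacc.resolve_right hv
    linarith [key.1, h2.1, h2.2]

/-- Accurate estimates lead to acceptance if `f` is close to a halfspace. -/
theorem IsBoundedRI.completeness (hn : 3 ≤ n) (hμ : IsBoundedRI μ √n C)
    (hf : IsSignValued f) (hfm : Measurable f) {ε δ τ : ℝ} (hε : 0 < ε) (hτ : 0 < τ) (hτ1 : τ ≤ 1)
    (hlog : τ * (log (1 / τ) + 5) ≤ C ^ 2 / 2000 * ε ^ 3)
    {h : EuclideanSpace ℝ (Fin n) → ℝ} (hh : IsHalfspace h) (hfh : fdist μ f h ≤ τ)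
    {x : ExampleIndex 864 (1 / 2000) C n ε δ → EuclideanSpace ℝ (Fin n)}
    (hx : IsAccurate μ f (1 / 2000 * C ^ 2 * ε ^ 3) x) :
    SimpleTesterAccepts 864 (1 / 2000) (1 / 16) C ε δ fun i => (x i, f (x i)) := by
  have ht := hμ.isTame_marginal hn
  obtain ⟨w, t, hw, hwt⟩ := hh
  obtain rfl : h = halfspace w t := funext hwt
  obtain ⟨htail, hgap⟩ :=
    hμ.abs_thresholdMoment_sq_sub_norm_center_sq_le hn hf hfm hw t hτ hτ1 hfh
  have hCε0 : 0 < C ^ 2 * ε ^ 3 := mul_pos (pow_pos hμ.2.2.1 2) (pow_pos hε 3)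
  have hττ : τ ≤ τ * (log (1 / τ) + 5) := by
    have : 0 ≤ log (1 / τ) := log_nonneg (by rw [le_div_iff₀ hτ]; linarith)
    exact le_mul_of_one_le_right hτ.le (by linarith)
  have key := fun hv => hx.abs_estimateHalfspaceNorm_sub_le ht hv htail
  obtain ⟨-, h2, -, -⟩ := hx
  simp only [SimpleTesterAccepts]
  set v := estimateMean fun i => (x (.inl i), f (x (.inl i)))
  by_cases hv : 1 - ε / 2 ≤ |v|
  · exact Or.inr hv
  · left
    have key := abs_le.1 (key (by linarith))
    have h2 := abs_le.1 h2
    have hgap := abs_le.1 hgap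
    linarith [key.2, h2.1, hgap.2]

/-! ### The number of examples -/

theorem ceil_le_mul_add_one {x M U : ℝ} (hx : x ≤ M * U) (hx0 : 0 ≤ x) (hU : 1 ≤ U) :
    (⌈x⌉₊ : ℝ) ≤ (M + 1) * U := by
  have := Nat.ceil_lt_add_one hx0
  linarith

theorem simpleTesterSamples_le {L K₁ C : ℝ} (hL : 0 < L) (hK : 0 < K₁) (hC : 0 < C) {n : ℕ}
    (hn : 1 ≤ n) {ε δ : ℝ} (hε : ε ∈ Ioo (0 : ℝ) (1 / 2)) (hδ : δ ∈ Ioo (0 : ℝ) (1 / 2)) :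
    (simpleTesterSamples L K₁ C n ε δ : ℝ) ≤
      ((20 + 50 * L) / (K₁ * C ^ 2) ^ 2 + 6) * (√n / ε ^ 6 * log (1 / δ)) := by
  obtain ⟨hε0, hε1⟩ := hε
  obtain ⟨hδ0, hδ1⟩ := hδ
  set D := (K₁ * C ^ 2) ^ 2 with hD
  have hD0 : 0 < D := by positivity
  have he2 : (K₁ * C ^ 2 * ε ^ 3) ^ 2 = D * ε ^ 6 := by rw [hD]; ring
  have he2' : (K₁ * C ^ 2 * ε ^ 3 / 2) ^ 2 = D * ε ^ 6 / 4 := by rw [hD]; ring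
  set l := log (1 / δ) with hl
  have hl2 : log 2 ≤ l := log_le_log (by norm_num) (by rw [le_div_iff₀ hδ0]; linarith)
  have hlog2 := log_two_gt_d9
  have hn1 : (1 : ℝ) ≤ √n := by
    rw [← sqrt_one]; exact sqrt_le_sqrt (by exact_mod_cast hn)
  have hε6 : ε ^ 6 ≤ 1 / 64 := by
    calc ε ^ 6 ≤ (1 / 2) ^ 6 := by gcongr
      _ = 1 / 64 := by norm_num
  set U := √n / ε ^ 6 * l with hU
  have hU0 : l / ε ^ 6 ≤ U := by
    rw [hU, div_mul_eq_mul_div]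
    gcongr
    nlinarith
  have hU1 : 1 ≤ U := by
    refine le_trans ?_ hU0
    rw [le_div_iff₀ (by positivity)]
    linarith
  have hlog : ∀ c : ℝ, 1 ≤ c → c ≤ 16 → 0 ≤ log (c / δ) ∧ log (c / δ) ≤ 5 * l := by
    intro c hc1 hc
    have h1 : log c ≤ 4 * log 2 := by
      rw [show 4 * log 2 = log (2 ^ 4) by rw [log_pow]; norm_num]
      exact log_le_log (by linarith) (by linarith)
    have h2 : log (c / δ) = log c + l := by
      rw [hl, log_div (by linarith) hδ0.ne', one_div, log_inv]; ring
    have h3 := log_nonneg hc1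
    constructor <;> linarith
  have hl6 : log (2 / (δ / 3)) = log (6 / δ) := by congr 1; field_simp; norm_num
  have hl3 : log (1 / (δ / 3)) = log (3 / δ) := by congr 1; field_simp
  have hl12 : log (4 / (δ / 3)) = log (12 / δ) := by congr 1; field_simp; norm_num
  have hl6' : log (1 / (δ / 3 / 2)) = log (6 / δ) := by congr 1; field_simp; norm_num
  obtain ⟨p6, q6⟩ := hlog 6 (by norm_num) (by norm_num)
  obtain ⟨p3, q3⟩ := hlog 3 (by norm_num) (by norm_num)
  obtain ⟨p12, q12⟩ := hlog 12 (by norm_num) (by norm_num)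
  have b1 : (meanSize (K₁ * C ^ 2 * ε ^ 3) (δ / 3) : ℝ) ≤ (10 / D + 1) * U := by
    rw [meanSize, he2, hl6]
    refine ceil_le_mul_add_one ?_ (by positivity) hU1
    calc 2 / (D * ε ^ 6) * log (6 / δ) ≤ 2 / (D * ε ^ 6) * (5 * l) := by gcongr
      _ = 10 / D * (l / ε ^ 6) := by field_simp; ring
      _ ≤ 10 / D * U := by gcongr
  have b2 : (ipSize L n (K₁ * C ^ 2 * ε ^ 3) (δ / 3) : ℝ) ≤ (5 * L / D + 1) * U := by
    rw [ipSize, he2, hl3]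
    refine ceil_le_mul_add_one ?_ (by positivity) hU1
    calc L * (√n / (D * ε ^ 6)) * log (3 / δ) ≤ L * (√n / (D * ε ^ 6)) * (5 * l) := by gcongr
      _ = 5 * L / D * U := by rw [hU]; field_simp
  have b3 : (thresholdSize (K₁ * C ^ 2 * ε ^ 3) (δ / 3) : ℝ) ≤ (10 / D + 1) * U := by
    rw [thresholdSize, he2', hl12]
    refine ceil_le_mul_add_one ?_ (by positivity) hU1
    calc 1 / (2 * (D * ε ^ 6 / 4)) * log (12 / δ) ≤ 1 / (2 * (D * ε ^ 6 / 4)) * (5 * l) := by gcongr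
      _ = 10 / D * (l / ε ^ 6) := by field_simp; ring
      _ ≤ 10 / D * U := by gcongr
  have b4 : (ipSize L n (K₁ * C ^ 2 * ε ^ 3 / 2) (δ / 3 / 2) : ℝ) ≤ (20 * L / D + 1) * U := by
    rw [ipSize, he2', hl6']
    refine ceil_le_mul_add_one ?_ (by positivity) hU1
    calc L * (√n / (D * ε ^ 6 / 4)) * log (6 / δ)
        ≤ L * (√n / (D * ε ^ 6 / 4)) * (5 * l) := by gcongr
      _ = 20 * L / D * U := by rw [hU]; field_simp; ring
  have hsum : ((20 + 50 * L) / D + 6) * U = (10 / D + 1) * U + ((5 * L / D + 1) * U +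
      (5 * L / D + 1) * U) + (10 / D + 1) * U + ((20 * L / D + 1) * U + (20 * L / D + 1) * U) := by
    ring
  rw [hsum]
  simp only [simpleTesterSamples, Fintype.card_sum, Fintype.card_fin]
  push_cast
  linarith

end HalfspaceTesting

theorem mainTheorem4 :
    ∃ L K₁ K₃ : ℝ, 0 < L ∧ 0 < K₁ ∧ 0 < K₃ ∧
    ∀ C : ℝ, 0 < C → C ≤ 1 →
      (∃ A : ℝ, 0 < A ∧ ∀ (n : ℕ), 3 ≤ n → ∀ ε ∈ Set.Ioo (0 : ℝ) (1 / 2),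
        ∀ δ ∈ Set.Ioo (0 : ℝ) (1 / 2),
          (simpleTesterSamples L K₁ C n ε δ : ℝ) ≤
            A * (Real.sqrt n / ε ^ 6 * Real.log (1 / δ))) ∧
      ∀ η : ℝ, 0 < η → ∃ K₂ : ℝ, 0 < K₂ ∧
        ∀ (n : ℕ), 3 ≤ n →
        ∀ (μ : MeasureTheory.Measure (EuclideanSpace ℝ (Fin n)))
          [MeasureTheory.IsProbabilityMeasure μ],
        IsBoundedRI μ (Real.sqrt n) C →
        ∀ f : EuclideanSpace ℝ (Fin n) → ℝ, Measurable f → IsSignValued f →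
        ∀ ε ∈ Set.Ioo (0 : ℝ) (1 / 2), ∀ δ ∈ Set.Ioo (0 : ℝ) (1 / 2),
          ((∃ h, IsHalfspace h ∧ fdist μ f h ≤ K₂ * ε ^ (3 + η)) →
            1 - δ ≤ exampleProb μ f (SimpleTesterAccepts L K₁ K₃ C ε δ)) ∧
          1 - δ ≤ exampleProb μ f (fun S => SimpleTesterAccepts L K₁ K₃ C ε δ S →
            ∃ h, IsHalfspace h ∧ (center μ f ≠ 0 → Aligned μ f h) ∧
              ∫ x, h x ∂μ = ∫ x, f x ∂μ ∧ fdist μ f h ≤ ε) := by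
  -- In units of `C ^ 2 * ε ^ 3`, the estimation errors sum to `37.5 * K₁ < 1 / 50`. Soundness needs
  -- `K₃ + 1 / 50 ≤ 1 / 8`. Completeness needs that `K₃` exceeds `1 / 50` plus the effect of the
  -- distance to a halfspace, which is at most `(8 + 36) / 2000`.
  refine ⟨864, 1 / 2000, 1 / 16, by norm_num, by norm_num, by norm_num, fun C hC hC1 =>
    ⟨⟨(20 + 50 * 864) / (1 / 2000 * C ^ 2) ^ 2 + 6, by positivity, fun n hn ε hε δ hδ =>
      simpleTesterSamples_le (by norm_num) (by norm_num) hC (by omega) hε hδ⟩, fun η hη => ?_⟩⟩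
  obtain ⟨κ, hκ, hκε⟩ := exists_mul_log_le hη (by positivity : 0 < C ^ 2 / 2000)
  refine ⟨κ, hκ, fun n hn μ _ hμ f hfm hf ε hε δ hδ => ?_⟩
  have hε0 := hε.1
  have he : 0 < 1 / 2000 * C ^ 2 * ε ^ 3 := by positivity
  have he1 : 1 / 2000 * C ^ 2 * ε ^ 3 ≤ 1 := by
    have h1 : C ^ 2 ≤ 1 := pow_le_one₀ hC.le hC1
    have h2 : ε ^ 3 ≤ 1 := pow_le_one₀ hε0.le (by linarith [hε.2])
    calc 1 / 2000 * C ^ 2 * ε ^ 3 ≤ 1 * 1 * 1 := by gcongr; norm_num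
      _ = 1 := by norm_num
  obtain ⟨hτ1, hlog⟩ := hκε ε hε
  constructor
  · rintro ⟨h, hh, hfh⟩
    exact hμ.le_exampleProb hn hf hfm he he1 hδ.1 hδ.2.le fun x hx =>
      hμ.completeness hn hf hfm hε0 (by positivity) hτ1 hlog hh hfh hx
  · exact hμ.le_exampleProb hn hf hfm he he1 hδ.1 hδ.2.le fun x hx hacc =>
      hμ.soundness hn hf hfm hε0 hε.2.le hx hacc
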